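/- Conventions. Spaces are compactly generated and products are taken in that category. Operads are non-symmetric topological operads $O=\{O(n)\}_{n\ge 0}$ with unit $\mathrm{id}\in O(1)$, and a bimodule over an operad $P$ is a sequence of spaces $M(n)$ with a left action $P(n)\times M(m_1)\times\dots\times M(m_n)\to M(m_1+\dots+m_n)$ and a right action $M(n)\times P(m_1)\times\dots\times P(m_n)\to M(m_1+\dots+m_n)$ that are unital, associative and compatible. $\mathcal{A}ssoc_{>0}$ is the operad with a single point $a_n$ in each arity $n\ge 1$ and nothing in arity $0$. A bimodule is called cofibrant if it is obtained from the free bimodule on the empty collection by a (possibly transfinite) sequence of free attachments of cells, i.e. of pushouts of free bimodules on collections of spheres $\partial D$ into the free bimodules on the corresponding collections of discs $D$. The bimodule $\square$. $\square(0)=\emptyset$ and $\square(n)=[0,1]^{n-1}$ for $n\ge 1$. The left action of $a_n$ concatenates $n$ tuples, inserting a coordinate $1$ between consecutive tuples; the right action replaces the $i$-th of the $n$ positions separated by the $n-1$ coordinates by $m_i$ positions, separated by $m_i-1$ new coordinates equal to $0$. The Stasheff operad. $K(0)=\emptyset$, $K(1)=\ast$, and for $n\ge 2$, $K(n)$ is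 the Stasheff polytope of dimension $n-2$, realised as the space of planar rooted trees with $n$ leaves, each of whose internal vertices has at least two inputs, with a length in $[0,1]$ for each internal edge, edges of length $0$ being contracted. Operadic composition grafts trees, the new internal edges having length $1$. Let $p\colon K\to\mathcal{A}ssoc_{>0}$ be the projection. The spaces $BK(n)$. For a planar rooted tree $T$ with $n$ leaves whose internal vertices ("beads") all have at least two outgoing edges, let $B(T)$ be the set of its beads, partially ordered by the tree with the lowest bead as least element, and $|b|$ the number of outgoing edges of $b$. Put $\lambda(T)=\prod_{b\in B(T)}K(|b|)$, $\chi(T)=\{\text{order preserving maps } B(T)\to[0,1]\}$, so that a point of $\lambda(T)\times\chi(T)$ is a tuple $(x_b,t_b)_{b\in B(T)}$. On the category $\Psi_n$ of such trees and contractions of edges, $\lambda$ is a covariant functor by operadic composition and $\chi$ is a contravariant functor by composition with the maps of beads. Let $\overline{BK}(n)=\lambda\otimes_{\Psi_n}\chi$ be the coend (it is a point for $n=1$ and empty for $n=0$), and let $BK(n)$ be the quotient of $\overline{BK}(n)$ that identifies two points $(x_b,t_b)$ and $(x'_b,t'_b)$ over the same tree $T$ if for every bead $b$ one has $(x_b,t_b)=(x'_b,t'_b)$,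 or $t_b=t'_b=0$, or $t_b=t'_b=1$. Evaluation. Let $O$ be an operad with a morphism of operads $\eta\colon\mathcal{A}ssoc_{>0}\to O$; through $\eta$ it is an $\mathcal{A}ssoc_{>0}$-bimodule. A loop $h$ of operad maps $K\to O$ based at $\eta\circ p$ is a family of continuous maps $h_n\colon[0,1]\times K(n)\to O(n)$ such that each $h(t,-)$ is a morphism of operads and $h(0,-)=h(1,-)=\eta\circ p$. It sends the point $(x_b,t_b)_{b\in B(T)}$ to the composition in $O$, according to the tree $T$, of the elements $h_{|b|}(t_b,x_b)\in O(|b|)$ (to $\mathrm{id}$ if $T$ is the trivial tree). Proposition. (i) The spaces $BK(n)$, $n\ge 0$, form a cofibrant $\mathcal{A}ssoc_{>0}$-bimodule with the following structure given by grafting: for $n\ge 2$ the left action of $a_n$ on the classes of $n$ points grafts the $n$ trees to the $n$-corolla, whose bead gets the parameter $t=0$ and an arbitrary element of $K(n)$; the right action of $(a_{m_1},\dots,a_{m_n})$ on the class of a point grafts corollas with $m_1,\dots,m_n$ leaves to the leaves of its tree, whose beads get the parameter $t=1$ and arbitrary elements of $K(m_1),\dots,K(m_n)$ (nothing is grafted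 where $m_i=1$). For every $O$, $\eta$ and every loop $h$ of operad maps $K\to O$ based at $\eta\circ p$, evaluation along $h$ is well defined on $BK$, and it is a morphism of $\mathcal{A}ssoc_{>0}$-bimodules $\zeta^h\colon BK\to O$. (ii) $BK(0)$ is empty, and $BK(n)$ is contractible for each $n\ge 1$. (iii) With this structure $BK$ is homeomorphic to $\square$ as an $\mathcal{A}ssoc_{>0}$-bimodule. -/

import Mathlib

universe u v w

/-! ### Blocks of positions -/

/-- The bijection between pairs (block `i`, position `r` in block `i`) and positions in the
concatenation of blocks of lengths `k 0, k 1, …`. -/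
def blk {n m : ℕ} (k : Fin n → ℕ) (h : ∑ i, k i = m) : (Σ i, Fin (k i)) ≃ Fin m :=
  finSigmaFinEquiv.trans (finCongr h)

theorem blk_val {n m : ℕ} (k : Fin n → ℕ) (h : ∑ i, k i = m) (i : Fin n) (r : Fin (k i)) :
    (blk k h ⟨i, r⟩).val = (∑ i' ∈ Finset.univ.filter (· < i), k i') + r.val := by
  have : (blk k h ⟨i, r⟩).val = (finSigmaFinEquiv ⟨i, r⟩).val := rfl
  rw [this, finSigmaFinEquiv_apply]
  congr 1
  symm
  refine Finset.sum_bij' (fun a ha => ⟨a.val, by simpa using ha⟩) (fun b _ => Fin.castLE i.2.le b)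
    ?_ ?_ ?_ ?_ ?_
  · simp
  · intro b _
    have : Fin.castLE i.2.le b < i := b.2
    simpa using this
  · simp
  · simp
  · simp

theorem blk_lt_of_fst_lt {n m : ℕ} (k : Fin n → ℕ) (h : ∑ i, k i = m) {i j : Fin n}
    (r : Fin (k i)) (s : Fin (k j)) (hij : i < j) : blk k h ⟨i, r⟩ < blk k h ⟨j, s⟩ := by
  rw [Fin.lt_def, blk_val, blk_val]
  have h1 : (∑ i' ∈ Finset.univ.filter (· < i), k i') + k i
      ≤ ∑ i' ∈ Finset.univ.filter (· < j), k i' := by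
    rw [add_comm, ← Finset.sum_insert (s := Finset.univ.filter (· < i)) (by simp)]
    apply Finset.sum_le_sum_of_subset
    intro a ha
    simp only [Finset.mem_insert, Finset.mem_filter, Finset.mem_univ, true_and] at ha ⊢
    rcases ha with rfl | ha
    · exact hij
    · exact ha.trans hij
  have := r.2
  omega

theorem blk_lt_iff {n m : ℕ} (k : Fin n → ℕ) (h : ∑ i, k i = m) {i j : Fin n}
    (r : Fin (k i)) (s : Fin (k j)) :
    blk k h ⟨i, r⟩ < blk k h ⟨j, s⟩ ↔ i < j ∨ (i = j ∧ r.val < s.val) := by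
  rcases lt_trichotomy i j with hij | rfl | hij
  · simp [blk_lt_of_fst_lt k h r s hij, hij]
  · rw [Fin.lt_def, blk_val, blk_val]
    simp
  · have := blk_lt_of_fst_lt k h s r hij
    simp [this.not_gt, hij.not_gt, hij.ne']

theorem blk_zero_iff {n m : ℕ} (k : Fin n → ℕ) (h : ∑ i, k i = m) (hk : ∀ i, 1 ≤ k i)
    (i : Fin n) (r : Fin (k i)) :
    (blk k h ⟨i, r⟩).val = 0 ↔ i.val = 0 ∧ r.val = 0 := by
  constructor
  · intro h0
    have key : ∀ (j : Fin n) (s : Fin (k j)), ¬ (j < i ∨ (j = i ∧ s.val < r.val)) := by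
      intro j s hh
      have := (blk_lt_iff k h s r).2 hh
      rw [Fin.lt_def] at this
      omega
    constructor
    · by_contra hi
      exact key ⟨0, by omega⟩ ⟨0, hk _⟩ (Or.inl (by rw [Fin.lt_def]; exact Nat.pos_of_ne_zero hi))
    · by_contra hr
      exact key i ⟨0, hk _⟩ (Or.inr ⟨rfl, Nat.pos_of_ne_zero hr⟩)
  · rintro ⟨hi, hr⟩
    by_contra h0
    obtain ⟨⟨j, s⟩, hj⟩ := (blk k h).surjective ⟨0, by have := (blk k h ⟨i, r⟩).2; omega⟩
    have : blk k h ⟨j, s⟩ < blk k h ⟨i, r⟩ := by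
      rw [hj, Fin.lt_def]; exact Nat.pos_of_ne_zero h0
    rw [blk_lt_iff, Fin.lt_def] at this
    omega

theorem blk_last_iff {n m : ℕ} (k : Fin n → ℕ) (h : ∑ i, k i = m) (hk : ∀ i, 1 ≤ k i)
    (i : Fin n) (r : Fin (k i)) :
    (blk k h ⟨i, r⟩).val + 1 = m ↔ i.val + 1 = n ∧ r.val + 1 = k i := by
  constructor
  · intro h0
    have key : ∀ (j : Fin n) (s : Fin (k j)), ¬ (i < j ∨ (i = j ∧ r.val < s.val)) := by
      intro j s hh
      have := (blk_lt_iff k h r s).2 hh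
      rw [Fin.lt_def] at this
      have := (blk k h ⟨j, s⟩).2
      omega
    have hi := i.2
    have hr := r.2
    constructor
    · by_contra hi'
      exact key ⟨n - 1, by omega⟩ ⟨0, hk _⟩ (Or.inl (by rw [Fin.lt_def]; simp only; omega))
    · by_contra hr'
      exact key i ⟨k i - 1, by omega⟩ (Or.inr ⟨rfl, by simp only; omega⟩)
  · rintro ⟨hi, hr⟩
    by_contra h0
    have hm := (blk k h ⟨i, r⟩).2
    obtain ⟨⟨j, s⟩, hj⟩ := (blk k h).surjective ⟨m - 1, by omega⟩
    have : blk k h ⟨i, r⟩ < blk k h ⟨j, s⟩ := by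
      rw [hj, Fin.lt_def]; simp only; omega
    rw [blk_lt_iff, Fin.lt_def] at this
    rcases this with h1 | ⟨rfl, h1⟩
    · have := j.2
      omega
    · have := s.2
      omega

theorem blk_one {m : ℕ} (h : ∑ _i : Fin 1, m = m) (i : Fin 1) (r : Fin m) :
    blk (fun _ : Fin 1 => m) h ⟨i, r⟩ = r := by
  apply Fin.ext
  rw [blk_val]
  have : Finset.univ.filter (· < i) = ∅ := by
    ext a; simp
  simp

theorem blk_ones {n : ℕ} (h : ∑ _i : Fin n, 1 = n) (i : Fin n) (r : Fin 1) :
    blk (fun _ : Fin n => 1) h ⟨i, r⟩ = i := by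
  apply Fin.ext
  rw [blk_val]
  simp only [Finset.sum_const, smul_eq_mul, mul_one]
  have : (Finset.univ.filter (· < i)) = Finset.Iio i := by ext; simp
  simp [this]

theorem sum_blk {n p m : ℕ} (k : Fin n → ℕ) (h1 : ∑ i, k i = p) (l : Fin p → ℕ)
    (h2 : ∑ a, l a = m) : ∑ i, ∑ j, l (blk k h1 ⟨i, j⟩) = m := by
  rw [← h2, ← Equiv.sum_comp (blk k h1) l, Fintype.sum_sigma]

theorem blk_blk {n p m : ℕ} (k : Fin n → ℕ) (h1 : ∑ i, k i = p) (l : Fin p → ℕ)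
    (h2 : ∑ a, l a = m) (s : Fin n → ℕ) (hs : ∀ i, ∑ j, l (blk k h1 ⟨i, j⟩) = s i)
    (h3 : ∑ i, s i = m) (i : Fin n) (j : Fin (k i)) (r : Fin (l (blk k h1 ⟨i, j⟩))) :
    blk l h2 ⟨blk k h1 ⟨i, j⟩, r⟩ =
      blk s h3 ⟨i, blk (fun j => l (blk k h1 ⟨i, j⟩)) (hs i) ⟨j, r⟩⟩ := by
  apply Fin.ext
  rw [blk_val, blk_val, blk_val, ← add_assoc]
  congr 1
  rw [Finset.sum_filter, ← Equiv.sum_comp (blk k h1), Fintype.sum_sigma]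
  simp only [blk_lt_iff]
  rw [Finset.sum_filter, Finset.sum_filter,
    ← Finset.sum_erase_add Finset.univ _ (Finset.mem_univ i),
    ← Finset.sum_erase_add Finset.univ (fun a => if a < i then s a else 0) (Finset.mem_univ i)]
  simp only [lt_irrefl, if_false, add_zero, false_or, true_and]
  congr 1
  apply Finset.sum_congr rfl
  intro a ha
  have hne : a ≠ i := by simpa using ha
  by_cases hlt : a < i
  · simp [hlt, hs]
  · simp [hlt, hne]

/-! ### Spaces, non-symmetric operads, bimodules

Spaces are compactly generated spaces, products are taken in that category: a map out of a finite
product is continuous for the compactly generated product topology if and only if its composite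
with every continuous map from a compact Hausdorff space to the ordinary product is continuous. -/

/-- Continuity with respect to the compactly generated topology of the source. -/
def KContinuous {X Y : Type u} [TopologicalSpace X] [TopologicalSpace Y] (f : X → Y) : Prop :=
  ∀ (K : Type u) [TopologicalSpace K] [CompactSpace K] [T2Space K] (g : K → X),
    Continuous g → Continuous (fun z => f (g z))

/-- Topological operads without symmetric group actions. The composition
`comp k h x y = x(y 0, …, y (n-1))` takes values in arity `m`, where `m` is any number with a proof
`h` that it is the sum of the arities of the `y i`. -/
structure NSOperad where
  X : ℕ → Type u
  [top : ∀ n, TopologicalSpace (X n)]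
  [cg : ∀ n, CompactlyGeneratedSpace (X n)]
  one : X 1
  comp : ∀ {n m : ℕ} (k : Fin n → ℕ), ∑ i, k i = m → X n → (∀ i, X (k i)) → X m
  comp_cont : ∀ {n m : ℕ} (k : Fin n → ℕ) (h : ∑ i, k i = m),
    KContinuous (fun q : X n × (∀ i, X (k i)) => comp k h q.1 q.2)
  one_comp : ∀ {m : ℕ} (h : ∑ _i : Fin 1, m = m) (y : X m),
    comp (fun _ : Fin 1 => m) h one (fun _ => y) = y
  comp_one : ∀ {n : ℕ} (h : ∑ _i : Fin n, 1 = n) (x : X n),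
    comp (fun _ : Fin n => 1) h x (fun _ => one) = x
  assoc : ∀ {n p m : ℕ} (k : Fin n → ℕ) (h1 : ∑ i, k i = p) (l : Fin p → ℕ)
    (h2 : ∑ a, l a = m) (s : Fin n → ℕ) (hs : ∀ i, ∑ j, l (blk k h1 ⟨i, j⟩) = s i)
    (h3 : ∑ i, s i = m) (x : X n) (y : ∀ i, X (k i)) (z : ∀ a, X (l a)),
    comp l h2 (comp k h1 x y) z =
      comp s h3 x (fun i => comp (fun j => l (blk k h1 ⟨i, j⟩)) (hs i) (y i)
        (fun j => z (blk k h1 ⟨i, j⟩)))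

attribute [instance] NSOperad.top NSOperad.cg

/-- Morphisms of operads. -/
structure NSOperad.Hom (P : NSOperad.{u}) (Q : NSOperad.{v}) where
  toFun : ∀ n, P.X n → Q.X n
  cont : ∀ n, Continuous (toFun n)
  map_one : toFun 1 P.one = Q.one
  map_comp : ∀ {n m : ℕ} (k : Fin n → ℕ) (h : ∑ i, k i = m) (x : P.X n) (y : ∀ i, P.X (k i)),
    toFun m (P.comp k h x y) = Q.comp k h (toFun n x) (fun i => toFun (k i) (y i))

/-- Composition of morphisms of operads. -/
def NSOperad.Hom.trans {P : NSOperad.{u}} {Q : NSOperad.{v}} {R : NSOperad.{w}}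
    (f : P.Hom Q) (g : Q.Hom R) : P.Hom R where
  toFun n x := g.toFun n (f.toFun n x)
  cont n := (g.cont n).comp (f.cont n)
  map_one := by rw [f.map_one, g.map_one]
  map_comp k h x y := by rw [f.map_comp, g.map_comp]

/-- The structure of a bimodule over the operad `P` on a sequence `X` of spaces. -/
structure BimodStr (P : NSOperad.{0}) (X : ℕ → Type u) [∀ n, TopologicalSpace (X n)] where
  cg : ∀ n, CompactlyGeneratedSpace (X n)
  left : ∀ {n m : ℕ} (k : Fin n → ℕ), ∑ i, k i = m → P.X n → (∀ i, X (k i)) → X m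
  right : ∀ {n m : ℕ} (k : Fin n → ℕ), ∑ i, k i = m → X n → (∀ i, P.X (k i)) → X m
  left_cont : ∀ {n m : ℕ} (k : Fin n → ℕ) (h : ∑ i, k i = m),
    KContinuous (fun q : P.X n × (∀ i, X (k i)) => left k h q.1 q.2)
  right_cont : ∀ {n m : ℕ} (k : Fin n → ℕ) (h : ∑ i, k i = m),
    KContinuous (fun q : X n × (∀ i, P.X (k i)) => right k h q.1 q.2)
  one_left : ∀ {m : ℕ} (h : ∑ _i : Fin 1, m = m) (y : X m),
    left (fun _ : Fin 1 => m) h P.one (fun _ => y) = y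
  right_one : ∀ {n : ℕ} (h : ∑ _i : Fin n, 1 = n) (x : X n),
    right (fun _ : Fin n => 1) h x (fun _ => P.one) = x
  left_left : ∀ {n p m : ℕ} (k : Fin n → ℕ) (h1 : ∑ i, k i = p) (l : Fin p → ℕ)
    (h2 : ∑ a, l a = m) (s : Fin n → ℕ) (hs : ∀ i, ∑ j, l (blk k h1 ⟨i, j⟩) = s i)
    (h3 : ∑ i, s i = m) (x : P.X n) (y : ∀ i, P.X (k i)) (z : ∀ a, X (l a)),
    left l h2 (P.comp k h1 x y) z =
      left s h3 x (fun i => left (fun j => l (blk k h1 ⟨i, j⟩)) (hs i) (y i)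
        (fun j => z (blk k h1 ⟨i, j⟩)))
  right_right : ∀ {n p m : ℕ} (k : Fin n → ℕ) (h1 : ∑ i, k i = p) (l : Fin p → ℕ)
    (h2 : ∑ a, l a = m) (s : Fin n → ℕ) (hs : ∀ i, ∑ j, l (blk k h1 ⟨i, j⟩) = s i)
    (h3 : ∑ i, s i = m) (x : X n) (y : ∀ i, P.X (k i)) (z : ∀ a, P.X (l a)),
    right l h2 (right k h1 x y) z =
      right s h3 x (fun i => P.comp (fun j => l (blk k h1 ⟨i, j⟩)) (hs i) (y i)
        (fun j => z (blk k h1 ⟨i, j⟩)))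
  left_right : ∀ {n p m : ℕ} (k : Fin n → ℕ) (h1 : ∑ i, k i = p) (l : Fin p → ℕ)
    (h2 : ∑ a, l a = m) (s : Fin n → ℕ) (hs : ∀ i, ∑ j, l (blk k h1 ⟨i, j⟩) = s i)
    (h3 : ∑ i, s i = m) (x : P.X n) (y : ∀ i, X (k i)) (z : ∀ a, P.X (l a)),
    right l h2 (left k h1 x y) z =
      left s h3 x (fun i => right (fun j => l (blk k h1 ⟨i, j⟩)) (hs i) (y i)
        (fun j => z (blk k h1 ⟨i, j⟩)))

/-- Bimodules over the operad `P`. -/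
structure NSBimod (P : NSOperad.{0}) where
  X : ℕ → Type u
  [top : ∀ n, TopologicalSpace (X n)]
  str : BimodStr P X

attribute [instance] NSBimod.top

/-- Morphisms of bimodules. -/
@[ext]
structure NSBimod.Hom {P : NSOperad.{0}} (M : NSBimod.{u} P) (N : NSBimod.{v} P) where
  toFun : ∀ n, M.X n → N.X n
  cont : ∀ n, Continuous (toFun n)
  map_left : ∀ {n m : ℕ} (k : Fin n → ℕ) (h : ∑ i, k i = m) (x : P.X n) (y : ∀ i, M.X (k i)),
    toFun m (M.str.left k h x y) = N.str.left k h x (fun i => toFun (k i) (y i))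
  map_right : ∀ {n m : ℕ} (k : Fin n → ℕ) (h : ∑ i, k i = m) (x : M.X n) (y : ∀ i, P.X (k i)),
    toFun m (M.str.right k h x y) = N.str.right k h (toFun n x) y

/-- The category of bimodules over `P`. -/
instance NSBimod.category (P : NSOperad.{0}) : CategoryTheory.Category (NSBimod.{u} P) where
  Hom M N := NSBimod.Hom M N
  id M := ⟨fun _ x => x, fun _ => continuous_id, fun _ _ _ _ => rfl, fun _ _ _ _ => rfl⟩
  comp f g := ⟨fun n x => g.toFun n (f.toFun n x), fun n => (g.cont n).comp (f.cont n),
    fun k h x y => by rw [f.map_left, g.map_left], fun k h x y => by rw [f.map_right, g.map_right]⟩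

/-! ### Cellular cofibrant bimodules -/

/-- The disc of dimension `d`. -/
abbrev Disc (d : ℕ) : Type := Metric.closedBall (0 : EuclideanSpace ℝ (Fin d)) 1

/-- The boundary sphere of the disc of dimension `d` (empty for `d = 0`). -/
abbrev DiscBoundary (d : ℕ) : Type := Metric.sphere (0 : EuclideanSpace ℝ (Fin d)) 1

/-- The inclusion of the boundary sphere. -/
def DiscBoundary.incl {d : ℕ} (z : DiscBoundary d) : Disc d :=
  ⟨z.1, Metric.sphere_subset_closedBall z.2⟩

/-- `φ : A ⟶ B` is a free attachment of cells: in arity `n` there is a set `ι n` of discs `D c` of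
dimensions `dim n c`, with attaching maps `f` from their boundary spheres to `A`, and `B` is the
pushout of `A` and the free bimodule on the discs along the free bimodule on the boundary spheres.
By the universal property of free bimodules, this says that there are characteristic maps `Φ` from
the discs to `B` extending `φ ∘ f`, and that the morphisms from `B` to any bimodule `C` are the pairs
of a morphism `A ⟶ C` and a family of continuous maps from the discs to `C` that agree on the
boundary spheres. -/
def CellAttachment (P : NSOperad.{0}) :
    CategoryTheory.MorphismProperty (NSBimod.{u} P) := fun A B φ =>
  ∃ (ι : ℕ → Type u) (dim : ∀ n, ι n → ℕ)
    (f : ∀ n (c : ι n), DiscBoundary (dim n c) → A.X n) (Φ : ∀ n (c : ι n), Disc (dim n c) → B.X n),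
    (∀ n c, Continuous (f n c)) ∧ (∀ n c, Continuous (Φ n c)) ∧
    (∀ n c z, Φ n c z.incl = φ.toFun n (f n c z)) ∧
    ∀ (C : NSBimod.{u} P) (g : A ⟶ C) (e : ∀ n (c : ι n), Disc (dim n c) → C.X n),
      (∀ n c, Continuous (e n c)) → (∀ n c z, e n c z.incl = g.toFun n (f n c z)) →
      ∃! ψ : B ⟶ C, CategoryTheory.CategoryStruct.comp φ ψ = g ∧
        ∀ n c z, ψ.toFun n (Φ n c z) = e n c z

/-- A bimodule is (cellular) cofibrant if it is obtained from the initial bimodule (the free bimodule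
on the empty collection) by a transfinite sequence of free attachments of cells. -/
def NSBimod.Cofibrant {P : NSOperad.{0}} (M : NSBimod.{u} P) : Prop :=
  ∃ (E : NSBimod.{u} P) (hE : CategoryTheory.Limits.IsInitial E),
    (CellAttachment.{u} P).transfiniteCompositions.{u} (hE.to M)

/-! ### The operad of associative algebras without unit -/

/-- The components of the operad `assocPos`: a point in each positive arity and nothing in arity
zero. -/
abbrev AssocPosSpace (n : ℕ) : Type := PLift (1 ≤ n)

instance AssocPosSpace.instTopologicalSpace (n : ℕ) : TopologicalSpace (AssocPosSpace n) := ⊥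

instance AssocPosSpace.instDiscreteTopology (n : ℕ) : DiscreteTopology (AssocPosSpace n) := ⟨rfl⟩

/-- The operad with a point in each positive arity and nothing in arity zero. -/
def assocPos : NSOperad.{0} where
  X := AssocPosSpace
  cg _ := inferInstance
  one := ⟨le_refl 1⟩
  comp {n m} k h x y := ⟨by
    have h1 := (y ⟨0, x.down⟩).down
    have h2 := Finset.single_le_sum (f := k) (fun i _ => Nat.zero_le _)
      (Finset.mem_univ ⟨0, x.down⟩)
    omega⟩
  comp_cont k h := fun K _ _ _ g _ => continuous_of_const (fun _ _ => rfl)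
  one_comp _ _ := rfl
  comp_one _ _ := rfl
  assoc _ _ _ _ _ _ _ _ _ _ := rfl

/-- An operad `O` with a morphism `η` from `assocPos` is a bimodule over `assocPos`. -/
def NSOperad.toBimod (O : NSOperad.{u}) (η : assocPos.Hom O) : NSBimod.{u} assocPos where
  X := O.X
  str :=
    { cg := O.cg
      left := fun {n _} k h x y => O.comp k h (η.toFun n x) y
      right := fun k h x y => O.comp k h x (fun i => η.toFun (k i) (y i))
      left_cont := fun {n _} k h K _ _ _ g hg => O.comp_cont k h K
        (fun z => (η.toFun n (g z).1, (g z).2))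
        (((η.cont n).comp (continuous_fst.comp hg)).prodMk (continuous_snd.comp hg))
      right_cont := fun k h K _ _ _ g hg => O.comp_cont k h K
        (fun z => ((g z).1, fun i => η.toFun (k i) ((g z).2 i)))
        ((continuous_fst.comp hg).prodMk (continuous_pi fun i =>
          (η.cont (k i)).comp ((continuous_apply i).comp (continuous_snd.comp hg))))
      one_left := fun h y => by rw [η.map_one, O.one_comp]
      right_one := fun h x => by simp only [η.map_one, O.comp_one]
      left_left := fun k h1 l h2 s hs h3 x y z => by
        rw [η.map_comp, O.assoc k h1 l h2 s hs h3]
      right_right := fun k h1 l h2 s hs h3 x y z => by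
        rw [O.assoc k h1 l h2 s hs h3]
        simp only [η.map_comp]
      left_right := fun k h1 l h2 s hs h3 x y z => by
        rw [O.assoc k h1 l h2 s hs h3] }

/-! ### The cube bimodule -/

/-- The cube of dimension `n - 1` for `n ≥ 1`, nothing for `n = 0`. The coordinate with index `g`
belongs to the gap between the positions `g` and `g + 1` of `0, …, n - 1`. -/
abbrev CubeSpace (n : ℕ) : Type := {_d : Fin (n - 1) → unitInterval // 1 ≤ n}

/-- The position in `Fin m` to the left of a gap. -/
def gapPos {m : ℕ} (g : Fin (m - 1)) : Fin m := ⟨g.val, by omega⟩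

/-- The left action concatenates, with a coordinate `1` between consecutive blocks. -/
def cubeLeft {n m : ℕ} (k : Fin n → ℕ) (h : ∑ i, k i = m) (y : ∀ i, CubeSpace (k i))
    (g : Fin (m - 1)) : unitInterval :=
  match (blk k h).symm (gapPos g) with
  | ⟨i, r⟩ => if hr : r.val + 1 < k i then (y i).1 ⟨r.val, by omega⟩ else 1

/-- The right action replaces each position by a block, with coordinates `0` inside the blocks (the
last value `0` is never used). -/
def cubeRight {n m : ℕ} (k : Fin n → ℕ) (h : ∑ i, k i = m) (x : CubeSpace n)
    (g : Fin (m - 1)) : unitInterval :=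
  match (blk k h).symm (gapPos g) with
  | ⟨i, r⟩ => if r.val + 1 < k i then 0
      else if hi : i.val + 1 < n then x.1 ⟨i.val, by omega⟩ else 0

theorem cubeLeft_eq {n m : ℕ} (k : Fin n → ℕ) (h : ∑ i, k i = m) (y : ∀ i, CubeSpace (k i))
    (g : Fin (m - 1)) (i : Fin n) (r : Fin (k i)) (e : gapPos g = blk k h ⟨i, r⟩) :
    cubeLeft k h y g = if hr : r.val + 1 < k i then (y i).1 ⟨r.val, by omega⟩ else 1 := by
  have : (blk k h).symm (gapPos g) = ⟨i, r⟩ := by rw [e, Equiv.symm_apply_apply]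
  simp only [cubeLeft]
  rw [this]

theorem cubeRight_eq {n m : ℕ} (k : Fin n → ℕ) (h : ∑ i, k i = m) (x : CubeSpace n)
    (g : Fin (m - 1)) (i : Fin n) (r : Fin (k i)) (e : gapPos g = blk k h ⟨i, r⟩) :
    cubeRight k h x g = if r.val + 1 < k i then 0
      else if hi : i.val + 1 < n then x.1 ⟨i.val, by omega⟩ else 0 := by
  have : (blk k h).symm (gapPos g) = ⟨i, r⟩ := by rw [e, Equiv.symm_apply_apply]
  simp only [cubeRight]
  rw [this]

theorem gapPos_of_eq {m : ℕ} (a : Fin m) (ha : a.val + 1 < m) :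
    gapPos (⟨a.val, by omega⟩ : Fin (m - 1)) = a := rfl

theorem exists_blk_blk {n p m : ℕ} (k : Fin n → ℕ) (h1 : ∑ i, k i = p) (l : Fin p → ℕ)
    (h2 : ∑ a, l a = m) (a : Fin m) : ∃ (i : Fin n) (j : Fin (k i))
      (r : Fin (l (blk k h1 ⟨i, j⟩))), a = blk l h2 ⟨blk k h1 ⟨i, j⟩, r⟩ := by
  obtain ⟨⟨q, r⟩, rfl⟩ := (blk l h2).surjective a
  obtain ⟨⟨i, j⟩, rfl⟩ := (blk k h1).surjective q
  exact ⟨i, j, r, rfl⟩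

theorem one_le_of_sum {n m : ℕ} (k : Fin n → ℕ) (h : ∑ i, k i = m) (hn : 1 ≤ n)
    (hk : ∀ i, 1 ≤ k i) : 1 ≤ m :=
  ((assocPos.comp k h ⟨hn⟩ (fun i => ⟨hk i⟩)) : PLift (1 ≤ m)).down

theorem cube_left_left {n p m : ℕ} (k : Fin n → ℕ) (h1 : ∑ i, k i = p) (l : Fin p → ℕ)
    (h2 : ∑ a, l a = m) (s : Fin n → ℕ) (hs : ∀ i, ∑ j, l (blk k h1 ⟨i, j⟩) = s i)
    (h3 : ∑ i, s i = m) (z : ∀ a, CubeSpace (l a)) (w : ∀ i, CubeSpace (s i))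
    (hw : ∀ i, (w i).1 = cubeLeft (fun j => l (blk k h1 ⟨i, j⟩)) (hs i)
      (fun j => z (blk k h1 ⟨i, j⟩))) :
    cubeLeft l h2 z = cubeLeft s h3 w := by
  funext g
  obtain ⟨i, j, r, e⟩ := exists_blk_blk k h1 l h2 (gapPos g)
  have hl := fun j => blk_last_iff (fun j => l (blk k h1 ⟨i, j⟩)) (hs i)
    (fun j => (z (blk k h1 ⟨i, j⟩)).2) j
  rw [cubeLeft_eq l h2 z g _ r e, cubeLeft_eq s h3 w g i _ (e.trans (blk_blk k h1 l h2 s hs h3 i j r))]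
  have hl' := hl j r
  set b := blk (fun j => l (blk k h1 ⟨i, j⟩)) (hs i) ⟨j, r⟩ with hb
  have hb2 := b.2
  have hr2 := r.2
  by_cases hc : b.val + 1 < s i
  · rw [dif_pos hc, hw i, cubeLeft_eq _ _ _ _ j r (gapPos_of_eq b hc)]
  · rw [dif_neg hc, dif_neg]
    have := hl'.1 (by omega)
    omega

theorem cube_right_right {n p m : ℕ} (k : Fin n → ℕ) (h1 : ∑ i, k i = p) (l : Fin p → ℕ)
    (h2 : ∑ a, l a = m) (s : Fin n → ℕ) (hs : ∀ i, ∑ j, l (blk k h1 ⟨i, j⟩) = s i)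
    (h3 : ∑ i, s i = m) (hlpos : ∀ a, 1 ≤ l a) (hk : ∀ i, 1 ≤ k i) (x : CubeSpace n)
    (x' : CubeSpace p) (hx' : x'.1 = cubeRight k h1 x) :
    cubeRight l h2 x' = cubeRight s h3 x := by
  funext g
  obtain ⟨i, j, r, e⟩ := exists_blk_blk k h1 l h2 (gapPos g)
  have hl' := blk_last_iff (fun j => l (blk k h1 ⟨i, j⟩)) (hs i) (fun j => hlpos _) j r
  have hk' := blk_last_iff k h1 hk i j
  rw [cubeRight_eq l h2 x' g _ r e,
    cubeRight_eq s h3 x g i _ (e.trans (blk_blk k h1 l h2 s hs h3 i j r))]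
  set b := blk (fun j => l (blk k h1 ⟨i, j⟩)) (hs i) ⟨j, r⟩ with hb
  have hb2 := b.2
  have hq2 := (blk k h1 ⟨i, j⟩).2
  have hr2 := r.2
  have hj2 := j.2
  have hi2 := i.2
  by_cases hr : r.val + 1 < l (blk k h1 ⟨i, j⟩)
  · rw [if_pos hr, if_pos (by omega)]
  · rw [if_neg hr]
    by_cases hqp : (blk k h1 ⟨i, j⟩).val + 1 < p
    · rw [dif_pos hqp, hx', cubeRight_eq k h1 x _ i j (gapPos_of_eq (blk k h1 ⟨i, j⟩) hqp)]
      by_cases hj : j.val + 1 < k i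
      · rw [if_pos hj, if_pos (by omega)]
      · rw [if_neg hj, if_neg (by omega)]
    · rw [dif_neg hqp, if_neg (by omega), dif_neg (by omega)]

theorem cube_left_right {n p m : ℕ} (k : Fin n → ℕ) (h1 : ∑ i, k i = p) (l : Fin p → ℕ)
    (h2 : ∑ a, l a = m) (s : Fin n → ℕ) (hs : ∀ i, ∑ j, l (blk k h1 ⟨i, j⟩) = s i)
    (h3 : ∑ i, s i = m) (hlpos : ∀ a, 1 ≤ l a) (y : ∀ i, CubeSpace (k i))
    (x' : CubeSpace p) (hx' : x'.1 = cubeLeft k h1 y) (w : ∀ i, CubeSpace (s i))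
    (hw : ∀ i, (w i).1 = cubeRight (fun j => l (blk k h1 ⟨i, j⟩)) (hs i) (y i)) :
    cubeRight l h2 x' = cubeLeft s h3 w := by
  funext g
  obtain ⟨i, j, r, e⟩ := exists_blk_blk k h1 l h2 (gapPos g)
  have hl' := blk_last_iff (fun j => l (blk k h1 ⟨i, j⟩)) (hs i) (fun j => hlpos _) j r
  have hk' := blk_last_iff k h1 (fun i => (y i).2) i j
  have e' := e.trans (blk_blk k h1 l h2 s hs h3 i j r)
  have hm' := blk_last_iff s h3 (fun i => (w i).2) i
    (blk (fun j => l (blk k h1 ⟨i, j⟩)) (hs i) ⟨j, r⟩)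
  rw [cubeRight_eq l h2 x' g _ r e, cubeLeft_eq s h3 w g i _ e']
  have hg : (gapPos g).val + 1 < m := by have := g.2; simp only [gapPos]; omega
  rw [e'] at hg
  set b := blk (fun j => l (blk k h1 ⟨i, j⟩)) (hs i) ⟨j, r⟩ with hb
  have hb2 := b.2
  have hq2 := (blk k h1 ⟨i, j⟩).2
  have hr2 := r.2
  have hj2 := j.2
  have hi2 := i.2
  by_cases hc : b.val + 1 < s i
  · rw [dif_pos hc, hw i, cubeRight_eq _ _ _ _ j r (gapPos_of_eq b hc)]
    by_cases hr : r.val + 1 < l (blk k h1 ⟨i, j⟩)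
    · rw [if_pos hr, if_pos hr]
    · rw [if_neg hr, if_neg hr, dif_pos (by omega), dif_pos (by omega), hx',
        cubeLeft_eq k h1 y _ i j (gapPos_of_eq (blk k h1 ⟨i, j⟩) (by omega)), dif_pos (by omega)]
  · have h4 := hl'.1 (by omega)
    rw [dif_neg hc, if_neg (by omega), dif_pos (by omega), hx',
      cubeLeft_eq k h1 y _ i j (gapPos_of_eq (blk k h1 ⟨i, j⟩) (by omega)), dif_neg (by omega)]

theorem continuous_cubeLeft {Z : Type} [TopologicalSpace Z] {n m : ℕ} (k : Fin n → ℕ)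
    (h : ∑ i, k i = m) (f : Z → ∀ i, CubeSpace (k i)) (hf : Continuous f) :
    Continuous (fun z => cubeLeft k h (f z)) := by
  refine continuous_pi fun g => ?_
  obtain ⟨⟨i, r⟩, e⟩ := (blk k h).surjective (gapPos g)
  simp only [cubeLeft_eq k h _ g i r e.symm]
  split_ifs with hr
  · exact (continuous_apply _).comp (continuous_subtype_val.comp ((continuous_apply i).comp hf))
  · exact continuous_const

theorem continuous_cubeRight {Z : Type} [TopologicalSpace Z] {n m : ℕ} (k : Fin n → ℕ)
    (h : ∑ i, k i = m) (f : Z → CubeSpace n) (hf : Continuous f) :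
    Continuous (fun z => cubeRight k h (f z)) := by
  refine continuous_pi fun g => ?_
  obtain ⟨⟨i, r⟩, e⟩ := (blk k h).surjective (gapPos g)
  simp only [cubeRight_eq k h _ g i r e.symm]
  split_ifs with hr hi
  · exact continuous_const
  · exact (continuous_apply (⟨i.val, by omega⟩ : Fin (n - 1))).comp
      (continuous_subtype_val.comp hf)
  · exact continuous_const

theorem cube_one_left {m : ℕ} (h : ∑ _i : Fin 1, m = m) (y : CubeSpace m) :
    cubeLeft (fun _ : Fin 1 => m) h (fun _ => y) = y.1 := by
  funext g
  have hg := g.2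
  rw [cubeLeft_eq _ h _ g 0 (gapPos g) (blk_one h 0 _).symm]
  exact dif_pos (by simp only [gapPos]; omega)

theorem cube_right_one {n : ℕ} (h : ∑ _i : Fin n, 1 = n) (x : CubeSpace n) :
    cubeRight (fun _ : Fin n => 1) h x = x.1 := by
  funext g
  have hg := g.2
  rw [cubeRight_eq _ h _ g (gapPos g) 0 (blk_ones h _ _).symm, if_neg (by simp)]
  exact dif_pos (by simp only [gapPos]; omega)

/-- The bimodule of cubes over `assocPos`. -/
def cube : NSBimod.{0} assocPos where
  X := CubeSpace
  str :=
    { cg := fun _ => inferInstance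
      left := fun k h x y => ⟨cubeLeft k h y, one_le_of_sum k h x.down (fun i => (y i).2)⟩
      right := fun k h x y => ⟨cubeRight k h x, one_le_of_sum k h x.2 (fun i => (y i).down)⟩
      left_cont := fun k h _ _ _ _ _ hg =>
        (continuous_cubeLeft k h _ (continuous_snd.comp hg)).subtype_mk _
      right_cont := fun k h _ _ _ _ _ hg =>
        (continuous_cubeRight k h _ (continuous_fst.comp hg)).subtype_mk _
      one_left := fun h y => Subtype.ext (cube_one_left h y)
      right_one := fun h x => Subtype.ext (cube_right_one h x)
      left_left := fun k h1 l h2 s hs h3 _ y z => Subtype.ext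
        (cube_left_left k h1 l h2 s hs h3 z
          (fun i => ⟨cubeLeft (fun j => l (blk k h1 ⟨i, j⟩)) (hs i)
            (fun j => z (blk k h1 ⟨i, j⟩)),
            one_le_of_sum _ (hs i) (y i).down (fun j => (z (blk k h1 ⟨i, j⟩)).2)⟩) (fun _ => rfl))
      right_right := fun k h1 l h2 s hs h3 x y z => Subtype.ext
        (cube_right_right k h1 l h2 s hs h3 (fun a => (z a).down) (fun i => (y i).down) x _ rfl)
      left_right := fun k h1 l h2 s hs h3 x y z => Subtype.ext
        (cube_left_right k h1 l h2 s hs h3 (fun a => (z a).down) y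
          ⟨cubeLeft k h1 y, one_le_of_sum k h1 x.down (fun i => (y i).2)⟩ rfl
          (fun i => ⟨cubeRight (fun j => l (blk k h1 ⟨i, j⟩)) (hs i) (y i),
            one_le_of_sum _ (hs i) (y i).2 (fun j => (z (blk k h1 ⟨i, j⟩)).down)⟩) (fun _ => rfl)) }

/-! ### The Stasheff operad

The associahedron with `n` leaves is realised by its standard cubical subdivision: a point is a
planar tree with `n` leaves, all of whose internal vertices have at least two inputs, with a length
in `[0,1]` for each internal edge, where an edge of length `0` may be contracted. Such a tree is
recorded by the function that sends `(a, b)`, `a ≤ b`, to the length of the edge below the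
subtree with set of leaves `{a, …, b}`, or to `0` if there is no such edge; the sets of leaves of the
subtrees of a tree are pairwise nested or disjoint. The external edges, i.e. those below a single
leaf and the root edge, are given length `1` by convention. The operadic composition grafts trees,
the new internal edges having length `1`, so that the faces of the associahedron are given by
the equations that certain internal edges have length `1`. -/

/-- The conditions on the function of edge lengths. -/
structure IsTreeLength {n : ℕ} (d : Fin n → Fin n → unitInterval) : Prop where
  pos : 1 ≤ n
  off : ∀ a b, b < a → d a b = 0
  leaf : ∀ a, d a a = 1
  whole : ∀ a b, a.val = 0 → b.val + 1 = n → d a b = 1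
  cross : ∀ a b c e, a < c → c ≤ b → b < e → d a b = 0 ∨ d c e = 0

/-- The `n`-th space of the Stasheff operad: the associahedron of dimension `n - 2` for `n ≥ 2`, a
point for `n = 1` and empty for `n = 0`. -/
abbrev StasheffSpace (n : ℕ) : Type := {d : Fin n → Fin n → unitInterval // IsTreeLength d}

/-- The edge lengths of the grafting of the trees `y i` to the leaves of the tree `x`: sets of
leaves inside a block `i` belong to `y i`, unions of blocks belong to `x`, other sets do not occur. -/
def stasheffComp {n m : ℕ} (k : Fin n → ℕ) (h : ∑ i, k i = m) (x : Fin n → Fin n → unitInterval)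
    (y : ∀ i, Fin (k i) → Fin (k i) → unitInterval) (a b : Fin m) : unitInterval :=
  match (blk k h).symm a, (blk k h).symm b with
  | ⟨i, r⟩, ⟨j, t⟩ =>
    if hij : i = j then y j (Fin.cast (congrArg k hij) r) t
    else if r.val = 0 ∧ t.val + 1 = k j then x i j else 0

theorem stasheffComp_same {n m : ℕ} (k : Fin n → ℕ) (h : ∑ i, k i = m)
    (x : Fin n → Fin n → unitInterval) (y : ∀ i, Fin (k i) → Fin (k i) → unitInterval)
    (i : Fin n) (r t : Fin (k i)) :
    stasheffComp k h x y (blk k h ⟨i, r⟩) (blk k h ⟨i, t⟩) = y i r t := by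
  simp only [stasheffComp]
  rw [Equiv.symm_apply_apply, Equiv.symm_apply_apply]
  simp

theorem stasheffComp_ne {n m : ℕ} (k : Fin n → ℕ) (h : ∑ i, k i = m)
    (x : Fin n → Fin n → unitInterval) (y : ∀ i, Fin (k i) → Fin (k i) → unitInterval)
    (i j : Fin n) (r : Fin (k i)) (t : Fin (k j)) (hij : i ≠ j) :
    stasheffComp k h x y (blk k h ⟨i, r⟩) (blk k h ⟨j, t⟩) =
      if r.val = 0 ∧ t.val + 1 = k j then x i j else 0 := by
  simp only [stasheffComp]
  rw [Equiv.symm_apply_apply, Equiv.symm_apply_apply]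
  simp [hij]

theorem stasheffComp_isTreeLength {n m : ℕ} (k : Fin n → ℕ) (h : ∑ i, k i = m)
    (x : StasheffSpace n) (y : ∀ i, StasheffSpace (k i)) :
    IsTreeLength (stasheffComp k h x.1 (fun i => (y i).1)) := by
  have hk : ∀ i, 1 ≤ k i := fun i => (y i).2.pos
  refine ⟨one_le_of_sum k h x.2.pos hk, ?_, ?_, ?_, ?_⟩
  · intro a b hab
    obtain ⟨⟨i, r⟩, rfl⟩ := (blk k h).surjective a
    obtain ⟨⟨j, t⟩, rfl⟩ := (blk k h).surjective b
    rw [blk_lt_iff] at hab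
    by_cases hij : i = j
    · subst hij
      rw [stasheffComp_same]
      exact (y i).2.off _ _ (by simpa using hab)
    · rw [stasheffComp_ne _ _ _ _ _ _ _ _ hij]
      split_ifs
      · exact x.2.off _ _ (by grind)
      · rfl
  · intro a
    obtain ⟨⟨i, r⟩, rfl⟩ := (blk k h).surjective a
    rw [stasheffComp_same]
    exact (y i).2.leaf _
  · intro a b ha hb
    obtain ⟨⟨i, r⟩, rfl⟩ := (blk k h).surjective a
    obtain ⟨⟨j, t⟩, rfl⟩ := (blk k h).surjective b
    rw [blk_zero_iff k h hk] at ha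
    rw [blk_last_iff k h hk] at hb
    by_cases hij : i = j
    · subst hij
      rw [stasheffComp_same]
      exact (y i).2.whole _ _ ha.2 hb.2
    · rw [stasheffComp_ne _ _ _ _ _ _ _ _ hij, if_pos ⟨ha.2, hb.2⟩]
      exact x.2.whole _ _ ha.1 hb.1
  · intro a b c e hac hcb hbe
    obtain ⟨⟨ia, ra⟩, rfl⟩ := (blk k h).surjective a
    obtain ⟨⟨ib, rb⟩, rfl⟩ := (blk k h).surjective b
    obtain ⟨⟨ic, rc⟩, rfl⟩ := (blk k h).surjective c
    obtain ⟨⟨ie, re⟩, rfl⟩ := (blk k h).surjective e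
    rw [← not_lt] at hcb
    rw [blk_lt_iff] at hac hcb hbe
    have hrb := rb.2
    have hre := re.2
    by_cases hab : ia = ib
    · subst hab
      have hca : ia = ic := by
        by_contra hne
        apply hcb
        left
        rcases hac with h1 | h1
        · exact h1
        · exact absurd h1.1 hne
      subst hca
      by_cases hae : ia = ie
      · subst hae
        rw [stasheffComp_same, stasheffComp_same]
        exact (y ia).2.cross _ _ _ _ (by simpa using hac) (by simpa using hcb) (by simpa using hbe)
      · right
        rw [stasheffComp_ne _ _ _ _ _ _ _ _ hae, if_neg]
        have : ra.val < rc.val := by simpa using hac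
        omega
    · by_cases hce : ic = ie
      · subst hce
        left
        rw [stasheffComp_ne _ _ _ _ _ _ _ _ hab, if_neg]
        rintro ⟨h1, h2⟩
        have hbc : ib = ic := by
          by_contra hne
          rcases hbe with h3 | h3
          · exact hcb (Or.inl h3)
          · exact hne h3.1
        subst hbc
        simp at hbe
        omega
      · rw [stasheffComp_ne _ _ _ _ _ _ _ _ hab, stasheffComp_ne _ _ _ _ _ _ _ _ hce]
        by_cases h1 : ra.val = 0 ∧ rb.val + 1 = k ib
        · by_cases h2 : rc.val = 0 ∧ re.val + 1 = k ie
          · rw [if_pos h1, if_pos h2]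
            refine x.2.cross _ _ _ _ ?_ ?_ ?_
            · rcases hac with h3 | ⟨rfl, h3⟩
              · exact h3
              · omega
            · by_contra h3
              exact hcb (Or.inl (not_le.1 h3))
            · rcases hbe with h3 | ⟨rfl, h3⟩
              · exact h3
              · omega
          · right; rw [if_neg h2]
        · left; rw [if_neg h1]

theorem stasheffComp_assoc {n p m : ℕ} (k : Fin n → ℕ) (h1 : ∑ i, k i = p) (l : Fin p → ℕ)
    (h2 : ∑ a, l a = m) (s : Fin n → ℕ) (hs : ∀ i, ∑ j, l (blk k h1 ⟨i, j⟩) = s i)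
    (h3 : ∑ i, s i = m) (hl : ∀ a, 1 ≤ l a) (x : Fin n → Fin n → unitInterval)
    (y : ∀ i, Fin (k i) → Fin (k i) → unitInterval)
    (z : ∀ a, Fin (l a) → Fin (l a) → unitInterval) :
    stasheffComp l h2 (stasheffComp k h1 x y) z =
      stasheffComp s h3 x (fun i => stasheffComp (fun j => l (blk k h1 ⟨i, j⟩)) (hs i) (y i)
        (fun j => z (blk k h1 ⟨i, j⟩))) := by
  funext a b
  obtain ⟨i, j, r, rfl⟩ := exists_blk_blk k h1 l h2 a
  obtain ⟨i', j', r', rfl⟩ := exists_blk_blk k h1 l h2 b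
  have e := blk_blk k h1 l h2 s hs h3 i j r
  have e' := blk_blk k h1 l h2 s hs h3 i' j' r'
  by_cases hi : i = i'
  · subst hi
    by_cases hj : j = j'
    · subst hj
      rw [stasheffComp_same, e, e', stasheffComp_same, stasheffComp_same]
    · have hne : blk k h1 ⟨i, j⟩ ≠ blk k h1 ⟨i, j'⟩ := by simpa using hj
      rw [stasheffComp_ne _ _ _ _ _ _ _ _ hne, e, e', stasheffComp_same, stasheffComp_same,
        stasheffComp_ne _ _ _ _ _ _ _ _ hj]
  · have hne : blk k h1 ⟨i, j⟩ ≠ blk k h1 ⟨i', j'⟩ := by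
      intro hh
      have := (blk k h1).injective hh
      simp only [Sigma.mk.injEq] at this
      exact hi this.1
    rw [stasheffComp_ne _ _ _ _ _ _ _ _ hne, e, e', stasheffComp_ne _ _ _ _ _ _ _ _ hi,
      stasheffComp_ne _ _ _ _ _ _ _ _ hi]
    have u1 := blk_zero_iff _ (hs i) (fun _ => hl _) j r
    have u2 := blk_last_iff _ (hs i') (fun _ => hl _) j' r'
    split_ifs <;> first | rfl | (exfalso; tauto)

theorem continuous_stasheffComp {Z : Type} [TopologicalSpace Z] {n m : ℕ} (k : Fin n → ℕ)
    (h : ∑ i, k i = m) (f : Z → StasheffSpace n) (hf : Continuous f)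
    (g : Z → ∀ i, StasheffSpace (k i)) (hg : Continuous g) :
    Continuous (fun z => stasheffComp k h (f z).1 (fun i => (g z i).1)) := by
  refine continuous_pi fun a => continuous_pi fun b => ?_
  obtain ⟨⟨i, r⟩, rfl⟩ := (blk k h).surjective a
  obtain ⟨⟨j, t⟩, rfl⟩ := (blk k h).surjective b
  by_cases hij : i = j
  · subst hij
    simp only [stasheffComp_same]
    exact (continuous_apply t).comp ((continuous_apply r).comp
      (continuous_subtype_val.comp ((continuous_apply i).comp hg)))
  · simp only [stasheffComp_ne _ _ _ _ _ _ _ _ hij]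
    split_ifs
    · exact (continuous_apply j).comp ((continuous_apply i).comp (continuous_subtype_val.comp hf))
    · exact continuous_const

theorem stasheff_one_isTreeLength : IsTreeLength (fun _ _ : Fin 1 => (1 : unitInterval)) :=
  ⟨le_refl 1, fun a b h => by omega, fun _ => rfl, fun _ _ _ _ => rfl, fun a b c e h _ _ => by omega⟩

/-- The Stasheff operad. -/
def stasheff : NSOperad.{0} where
  X := StasheffSpace
  cg _ := inferInstance
  one := ⟨fun _ _ => 1, stasheff_one_isTreeLength⟩
  comp k h x y := ⟨stasheffComp k h x.1 (fun i => (y i).1), stasheffComp_isTreeLength k h x y⟩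
  comp_cont k h := fun K _ _ _ g hg => (continuous_stasheffComp k h _ (continuous_fst.comp hg) _
    (continuous_snd.comp hg)).subtype_mk _
  one_comp {m} h y := by
    apply Subtype.ext
    funext a b
    have := stasheffComp_same (fun _ : Fin 1 => m) h (fun _ _ => 1) (fun _ => y.1) 0 a b
    rwa [blk_one, blk_one] at this
  comp_one {n} h x := by
    apply Subtype.ext
    funext a b
    change stasheffComp (fun _ : Fin n => 1) h x.1 (fun _ _ _ => 1) a b = x.1 a b
    by_cases hab : a = b
    · subst hab
      have := stasheffComp_same (fun _ : Fin n => 1) h x.1 (fun _ _ _ => 1) a 0 0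
      rw [blk_ones] at this
      rw [this, x.2.leaf]
    · have := stasheffComp_ne (fun _ : Fin n => 1) h x.1 (fun _ _ _ => 1) a b 0 0 hab
      rw [blk_ones, blk_ones] at this
      rw [this, if_pos (by simp)]
  assoc k h1 l h2 s hs h3 x y z := Subtype.ext
    (stasheffComp_assoc k h1 l h2 s hs h3 (fun a => (z a).2.pos) x.1 (fun i => (y i).1)
      (fun a => (z a).1))

/-- The projection of the Stasheff operad onto the operad of associative algebras. -/
def stasheffProj : stasheff.Hom assocPos where
  toFun _ x := ⟨x.2.pos⟩
  cont _ := continuous_of_const (fun _ _ => rfl)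
  map_one := rfl
  map_comp _ _ _ _ := rfl

/-! ### Planar trees -/

/-- Planar rooted trees with `m` leaves. A tree is either the trivial tree with one leaf, or its root
edge ends in a bead with `n ≥ 2` outgoing edges carrying trees `c i` with `k i` leaves. -/
inductive PTree : ℕ → Type
  | leaf {m : ℕ} (h : m = 1) : PTree m
  | node {n m : ℕ} (k : Fin n → ℕ) (hn : 2 ≤ n) (h : ∑ i, k i = m) (c : ∀ i, PTree (k i)) : PTree m

/-- The set of beads of a tree. -/
def PTree.Bead : {m : ℕ} → PTree m → Type
  | _, .leaf _ => Empty
  | _, .node _ _ _ c => WithBot (Σ i, (c i).Bead)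

/-- The partial order on the beads induced by the tree, with the lowest bead as least element; beads
in different branches are not comparable. -/
@[reducible]
def PTree.beadOrder : {m : ℕ} → (T : PTree m) → PartialOrder T.Bead
  | _, .leaf _ => inferInstanceAs (PartialOrder Empty)
  | _, .node _ _ _ c =>
    letI := fun i => (c i).beadOrder
    inferInstanceAs (PartialOrder (WithBot (Σ i, (c i).Bead)))

instance PTree.instPartialOrderBead {m : ℕ} (T : PTree m) : PartialOrder T.Bead := T.beadOrder

/-- The lowest bead of a nontrivial tree. -/
def PTree.rootBead {n m : ℕ} (k : Fin n → ℕ) (hn : 2 ≤ n) (h : ∑ i, k i = m)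
    (c : ∀ i, PTree (k i)) : (PTree.node k hn h c).Bead :=
  (⊥ : WithBot (Σ i, (c i).Bead))

/-- The beads of the branch `c i` as beads of the whole tree. -/
def PTree.branchBead {n m : ℕ} (k : Fin n → ℕ) (hn : 2 ≤ n) (h : ∑ i, k i = m)
    (c : ∀ i, PTree (k i)) (i : Fin n) (b : (c i).Bead) : (PTree.node k hn h c).Bead :=
  ((⟨i, b⟩ : Σ i, (c i).Bead) : WithBot (Σ i, (c i).Bead))

/-- The number of outgoing edges of a bead. -/
def PTree.arity : {m : ℕ} → (T : PTree m) → T.Bead → ℕ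
  | _, .leaf _ => fun b => Empty.elim b
  | _, .node (n := n) _ _ _ c => WithBot.recBotCoe n (fun b => (c b.1).arity b.2)

/-- The space `∏ P(|b|)` over the beads `b` of `T`. -/
abbrev PTree.Lam (P : NSOperad.{0}) {m : ℕ} (T : PTree m) : Type := ∀ b : T.Bead, P.X (T.arity b)

/-- The polytope of order preserving maps from the beads of `T` to `[0,1]`. -/
abbrev PTree.Chi {m : ℕ} (T : PTree m) : Type := {t : T.Bead → unitInterval // Monotone t}

/-- The space `∏ P(|b|) × {order preserving maps}`; its points are tuples `(x_b, t_b)`. -/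
abbrev PTree.Cell (P : NSOperad.{0}) {m : ℕ} (T : PTree m) : Type := T.Lam P × T.Chi

/-- Planar rooted trees whose beads `b` are decorated with a number `t_b` in `[0,1]` and an element
`x_b` of `P(|b|)`, without conditions on the `t_b`. -/
inductive DTree (P : NSOperad.{0}) : ℕ → Type
  | leaf {m : ℕ} (h : m = 1) : DTree P m
  | node {n m : ℕ} (k : Fin n → ℕ) (hn : 2 ≤ n) (h : ∑ i, k i = m) (t : unitInterval) (x : P.X n)
      (c : ∀ i, DTree P (k i)) : DTree P m

/-- The decorated tree given by a tree and a decoration of its beads. -/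
def PTree.decorate {P : NSOperad.{0}} : {m : ℕ} → (T : PTree m) → T.Lam P →
    (T.Bead → unitInterval) → DTree P m
  | _, .leaf h, _, _ => .leaf h
  | _, .node k hn h c, x, t =>
    .node k hn h (t (rootBead k hn h c)) (x (rootBead k hn h c))
      (fun i => (c i).decorate (fun b => x (branchBead k hn h c i b))
        (fun b => t (branchBead k hn h c i b)))

/-- The decorated tree obtained by grafting the trees `c i` to the leaves of a tree `R`. -/
def DTree.graft {P : NSOperad.{0}} : {n m : ℕ} → (R : DTree P n) → (k : Fin n → ℕ) →
    ∑ i, k i = m → (∀ i, DTree P (k i)) → DTree P m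
  | n, m, .leaf hn, k, h, c =>
    (show k ⟨0, by omega⟩ = m by subst hn; simpa using h) ▸ c ⟨0, by omega⟩
  | _, _, .node k' hn h' t x d, k, h, c =>
    .node (fun i => ∑ j, k (blk k' h' ⟨i, j⟩)) hn (sum_blk k' h' k h) t x
      (fun i => (d i).graft (fun j => k (blk k' h' ⟨i, j⟩)) rfl (fun j => c (blk k' h' ⟨i, j⟩)))

/-- The composition in the operad `P` of the elements `x_b` according to the tree. -/
def DTree.compose {P : NSOperad.{0}} : {m : ℕ} → DTree P m → P.X m
  | _, .leaf h => h ▸ P.one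
  | _, .node k _ h _ x c => P.comp k h x (fun i => (c i).compose)

/-- All beads of the tree are decorated with the number `t`. -/
def DTree.IsConst {P : NSOperad.{0}} (t : unitInterval) : {m : ℕ} → DTree P m → Prop
  | _, .leaf _ => True
  | _, .node _ _ _ t' _ c => t' = t ∧ ∀ i, (c i).IsConst t

/-- The corolla with `k` leaves whose bead is decorated with `t` and `y`; for `k = 1` it is the
trivial tree. -/
def DTree.corolla {P : NSOperad.{0}} {k : ℕ} (hk : 1 ≤ k) (t : unitInterval) (y : P.X k) :
    DTree P k :=
  if h : k = 1 then .leaf h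
  else .node (fun _ : Fin k => 1) (by omega) (by simp) t y (fun _ => .leaf rfl)

/-- The relation of the coend. A morphism `α : T₁ ⟶ T₂` of planar trees contracts edges of `T₁`:
`T₁` is obtained from `T₂` by replacing each bead `b` of `T₂` by a nontrivial tree `R` with `|b|`
leaves. For `x` in `∏ P(|b|)` over the beads of `T₁` and an order preserving map `t` on the beads of
`T₂`, the relation identifies `(T₁, x, t ∘ α)` with `(T₂, α x, t)`, where `α x` is obtained by
composing the decorations of each of the subtrees `R`. -/
inductive DTree.Contraction {P : NSOperad.{0}} : {m : ℕ} → DTree P m → DTree P m → Prop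
  | leaf {m : ℕ} (h : m = 1) : DTree.Contraction (m := m) (.leaf h) (.leaf h)
  | node {n m : ℕ} (k : Fin n → ℕ) (hn : 2 ≤ n) (h : ∑ i, k i = m) (t : unitInterval)
      (R : DTree P n) (hR : R.IsConst t) (c c' : ∀ i, DTree P (k i))
      (hc : ∀ i, DTree.Contraction (c i) (c' i)) :
      DTree.Contraction (R.graft k h c) (.node k hn h t R.compose c')

/-! ### The bimodule `B P` -/

/-- The disjoint union of the spaces `PTree.Cell P T` over the planar trees `T` with `m` leaves. -/
abbrev BRaw (P : NSOperad.{0}) (m : ℕ) : Type := Σ T : PTree m, T.Cell P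

/-- The decorated tree of a point. -/
def BRaw.tree {P : NSOperad.{0}} {m : ℕ} (p : BRaw P m) : DTree P m :=
  p.1.decorate p.2.1 p.2.2.1

/-- The coend of the functors `PTree.Lam P` and `PTree.Chi` over the category of planar trees with
`m` leaves. -/
abbrev BBar (P : NSOperad.{0}) (m : ℕ) : Type :=
  Quot (fun p q : BRaw P m => DTree.Contraction p.tree q.tree)

/-- Two points over the same tree are identified if for each bead `b` either both their coordinates
at `b` agree, or their numbers `t_b` are both `0` or both `1`. -/
def PTree.Collapse {P : NSOperad.{0}} {m : ℕ} (T : PTree m) (p q : T.Cell P) : Prop :=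
  ∀ b : T.Bead, (p.2.1 b = q.2.1 b ∧ p.1 b = q.1 b) ∨ (p.2.1 b = 0 ∧ q.2.1 b = 0) ∨
    (p.2.1 b = 1 ∧ q.2.1 b = 1)

/-- The quotient of the coend by the relation `PTree.Collapse`. -/
abbrev BSpace (P : NSOperad.{0}) (m : ℕ) : Type :=
  Quot (fun u v : BBar P m => ∃ (T : PTree m) (p q : T.Cell P), T.Collapse p q ∧
    u = Quot.mk _ ⟨T, p⟩ ∧ v = Quot.mk _ ⟨T, q⟩)

/-- The class of a point. -/
def BSpace.mk {P : NSOperad.{0}} {m : ℕ} (p : BRaw P m) : BSpace P m := Quot.mk _ (Quot.mk _ p)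

/-- The bimodule structure `S` on the spaces `BSpace P` is given by grafting. The left action of the
point of `assocPos` in arity `n ≥ 2` grafts `n` trees to a corolla whose bead is decorated with `0` and
any element `x` of `P(n)`; the right action grafts corollas, whose beads are decorated with `1` and
any elements of `P`, to the leaves of a tree. -/
structure BSpace.IsGrafting {P : NSOperad.{0}} (S : BimodStr assocPos (BSpace P)) : Prop where
  left : ∀ {n m : ℕ} (k : Fin n → ℕ) (hn : 2 ≤ n) (h : ∑ i, k i = m) (a : assocPos.X n)
    (x : P.X n) (p : ∀ i, BRaw P (k i)), ∃ q : BRaw P m,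
      q.tree = DTree.node k hn h 0 x (fun i => (p i).tree) ∧
      S.left k h a (fun i => BSpace.mk (p i)) = BSpace.mk q
  right : ∀ {n m : ℕ} (k : Fin n → ℕ) (hk : ∀ i, 1 ≤ k i) (h : ∑ i, k i = m) (p : BRaw P n)
    (y : ∀ i, P.X (k i)) (a : ∀ i, assocPos.X (k i)), ∃ q : BRaw P m,
      q.tree = p.tree.graft k h (fun i => DTree.corolla (hk i) 1 (y i)) ∧
      S.right k h (BSpace.mk p) a = BSpace.mk q

/-! ### Loops of operad maps -/

/-- A loop in the space of operad morphisms from `P` to `O` with base point `f`. -/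
structure OperadLoop {P : NSOperad.{0}} {O : NSOperad.{u}} (f : P.Hom O) where
  hom : unitInterval → P.Hom O
  cont : ∀ n, Continuous (fun q : unitInterval × P.X n => (hom q.1).toFun n q.2)
  zero : hom 0 = f
  one : hom 1 = f

/-- The composition in `O` of the elements `h(t_b, x_b)` according to the tree. -/
def DTree.eval {P : NSOperad.{0}} {O : NSOperad.{u}} {f : P.Hom O} (l : OperadLoop f) :
    {m : ℕ} → DTree P m → O.X m
  | _, .leaf h => h ▸ O.one
  | _, .node (n := n) k _ h t x c => O.comp k h ((l.hom t).toFun n x) (fun i => (c i).eval l)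

/-!
The proof identifies `B K` with the bimodule of cubes by explicit coordinates, and derives everything
else from this identification.

*Coordinates.* A planar tree with decorated beads has, for each gap `j` between consecutive leaves, the
parameter `τ j` of the bead at which the two leaves separate, and, for each interval `{a, …, b}` of
leaves, the length `X a b` of the edge below it in the composition of all decorations (`1` for the edges
that connect beads, `0` if there is no such edge). The parameter of the bead at the lower end of this
edge is `M a b = max (τ a) (τ (b + 1))`, where `τ 0` and `τ m` are `0`. The coordinate at `j` is
`(1 - τ j) * ∏ (1 - M a b * X a b / 2)`, the product being over the proper intervals that contain
`j - 1` and `j`, i.e. over the edges on the path from the root to the bead at `j`.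

The numbers `τ` and `X` are invariant under contractions of edges. The lengths of edges whose lower
bead has a parameter `0` do not matter, and neither do those with parameter `1`, since then all
coordinates above this edge are `0`. Hence the coordinates are well defined on `B K`. They determine the
point: the largest coordinate is `1 - t`, where `t` is the lowest parameter, it occurs exactly at the
positions that belong to the root (up to irrelevant lengths), and for each branch at the root the
length of the edge below it can be recovered from the largest coordinate in the branch, because an
edge has a length less than `1` only if the parameter `t` also occurs above it
(`IsTreeData.eq_of_coordOn`, `BSpace.mk_eq_of_rel`). The same recursion constructs a tree with
prescribed coordinates (`DTree.exists_coord_eq`). As `B K` is compact, the coordinates are a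
homeomorphism to the cube (`BSpace.cubeHomeo`). Grafting to a corolla with parameter `0` concatenates
coordinates with `1` in between, and grafting corollas with parameter `1` inserts coordinates `0`, so
the bimodule structure of the cube corresponds to grafting (`BSpace.isGrafting_bimodStr`).
Contractibility is then clear.

*Evaluation* along a loop is invariant under contractions because each `h t` is a morphism of operads,
and under collapses because `h 0` and `h 1` factor through the projection to `assocPos`
(`BSpace.exists_evalHom`).

*Cofibrancy.* Every point of a cube is obtained in a unique way from interior points of cubes by the
left action, which introduces the coordinates `1`, followed by the right action, which introduces the
coordinates `0`. Hence a map that is defined on the cubes of arities at most `N`, compatible with the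
actions as far as they stay in these arities, extends uniquely to the sub-bimodule `filtration N` generated
by these cubes (`CubeSpace.PartialHom.extend`, `CubeSpace.filtration_hom_ext`). The extension is
continuous as `filtration N` is a quotient of a compact space of products of cubes. It follows that
`filtration (N + 1)` is obtained from `filtration N` by the free attachment of the cube of arity `N + 1`
along its boundary (`CubeSpace.cellAttachment_filtration`); the cube bimodule is the colimit of
this sequence, which starts with the empty bimodule.
-/

open CategoryTheory

/-! ### Decorated trees -/

theorem blk_of_unique {m : ℕ} (k : Fin 1 → ℕ) (h : ∑ i, k i = m) (i : Fin 1) (r : Fin (k i)) :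
    (blk k h ⟨i, r⟩).val = r.val := by
  rw [blk_val]
  have : Finset.univ.filter (· < i) = ∅ := by
    ext a; simp
  simp

theorem lt_of_sum_eq {n m : ℕ} {k : Fin n → ℕ} (h : ∑ i, k i = m) (hn : 2 ≤ n)
    (hk : ∀ i, 1 ≤ k i) (i : Fin n) : k i < m := by
  have hne : ∃ j : Fin n, j ≠ i := by
    by_contra hall
    push Not at hall
    have h0 := hall ⟨0, by omega⟩
    have h1 := hall ⟨1, by omega⟩
    exact absurd (congrArg Fin.val (h0.trans h1.symm)) (by simp)
  obtain ⟨j, hj⟩ := hne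
  have := Finset.sum_le_sum_of_subset (f := k) (Finset.subset_univ {i, j})
  rw [Finset.sum_pair hj.symm, h] at this
  have := hk j
  omega

theorem le_of_sum_eq {n m : ℕ} {k : Fin n → ℕ} (h : ∑ i, k i = m) (hk : ∀ i, 1 ≤ k i) :
    n ≤ m := by
  have : ∑ _i : Fin n, 1 ≤ ∑ i, k i := Finset.sum_le_sum fun i _ => hk i
  simpa [h] using this

namespace DTree

variable {P : NSOperad.{0}}

theorem pos : ∀ {m : ℕ}, DTree P m → 1 ≤ m
  | _, .leaf h => h.ge
  | _, .node k hn h _ _ c => one_le_of_sum k h (by omega) (fun i => (c i).pos)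

theorem node_congr {n m : ℕ} {k k' : Fin n → ℕ} {hn hn' : 2 ≤ n} {h : ∑ i, k i = m}
    {h' : ∑ i, k' i = m} {t : unitInterval} {x : P.X n} {c : ∀ i, DTree P (k i)}
    {c' : ∀ i, DTree P (k' i)}
    (e : ∀ i, (⟨k i, c i⟩ : Σ j, DTree P j) = ⟨k' i, c' i⟩) :
    node k hn h t x c = node k' hn' h' t x c' := by
  obtain rfl : k = k' := funext fun i => congrArg Sigma.fst (e i)
  obtain rfl : c = c' := funext fun i => eq_of_heq (Sigma.mk.inj (e i)).2
  rfl

theorem sigma_graft {n m m' : ℕ} (R : DTree P n) {k k' : Fin n → ℕ} (h : ∑ i, k i = m)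
    (h' : ∑ i, k' i = m') {c : ∀ i, DTree P (k i)} {c' : ∀ i, DTree P (k' i)}
    (e : ∀ i, (⟨k i, c i⟩ : Σ j, DTree P j) = ⟨k' i, c' i⟩) :
    (⟨m, R.graft k h c⟩ : Σ j, DTree P j) = ⟨m', R.graft k' h' c'⟩ := by
  obtain rfl : k = k' := funext fun i => congrArg Sigma.fst (e i)
  obtain rfl : c = c' := funext fun i => eq_of_heq (Sigma.mk.inj (e i)).2
  subst h h'
  rfl

theorem sigma_cast {m m' : ℕ} (e : m = m') (c : DTree P m) :
    (⟨m', e ▸ c⟩ : Σ j, DTree P j) = ⟨m, c⟩ := by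
  subst e; rfl

theorem sigma_graft_leaf {n m : ℕ} (hn : n = 1) (k : Fin n → ℕ) (h : ∑ i, k i = m)
    (c : ∀ i, DTree P (k i)) (i : Fin n) :
    (⟨m, (leaf hn).graft k h c⟩ : Σ j, DTree P j) = ⟨k i, c i⟩ := by
  subst hn
  obtain rfl : i = 0 := Subsingleton.elim _ _
  exact sigma_cast _ _

/-- The parameter of the bead at which the leaves `j - 1` and `j` separate; the value at `j = 0` is
`0` by convention. -/
def cutTime : {m : ℕ} → DTree P m → Fin m → unitInterval
  | _, .leaf _, _ => 0
  | _, .node k _ h t _ c, j =>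
    if ((blk k h).symm j).2.val = 0 then (if ((blk k h).symm j).1.val = 0 then 0 else t)
    else (c ((blk k h).symm j).1).cutTime ((blk k h).symm j).2

theorem cutTime_node {n m : ℕ} (k : Fin n → ℕ) (hn : 2 ≤ n) (h : ∑ i, k i = m) (t : unitInterval)
    (x : P.X n) (c : ∀ i, DTree P (k i)) (i : Fin n) (r : Fin (k i)) :
    (node k hn h t x c).cutTime (blk k h ⟨i, r⟩) =
      if r.val = 0 then (if i.val = 0 then 0 else t) else (c i).cutTime r := by
  rw [cutTime, Equiv.symm_apply_apply]

theorem cutTime_zero {m : ℕ} (D : DTree P m) (j : Fin m) (hj : j.val = 0) : D.cutTime j = 0 := by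
  cases D with
  | leaf h => rfl
  | node k hn h t x c =>
    obtain ⟨⟨i, r⟩, rfl⟩ := (blk k h).surjective j
    rw [blk_zero_iff k h (fun i => (c i).pos)] at hj
    rw [cutTime_node, if_pos hj.2, if_pos hj.1]

theorem cutTime_eq_of_sigma_eq {m m' : ℕ} {D : DTree P m} {D' : DTree P m'}
    (e : (⟨m, D⟩ : Σ j, DTree P j) = ⟨m', D'⟩) (j : Fin m) (j' : Fin m') (hj : j.val = j'.val) :
    D.cutTime j = D'.cutTime j' := by
  cases e
  rw [Fin.ext hj]

/-- A position inside a block separates leaves of a grafted tree, a position between two blocks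
separates leaves of the tree `R`. -/
theorem cutTime_graft {n : ℕ} (R : DTree P n) : ∀ {m : ℕ} (k : Fin n → ℕ) (h : ∑ i, k i = m)
    (c : ∀ i, DTree P (k i)) (i : Fin n) (r : Fin (k i)),
    (R.graft k h c).cutTime (blk k h ⟨i, r⟩) =
      if r.val = 0 then R.cutTime i else (c i).cutTime r := by
  induction R with
  | leaf hn =>
    intro m k h c i r
    have e := sigma_graft_leaf hn k h c i
    subst hn
    rw [cutTime_eq_of_sigma_eq e _ r (blk_of_unique k h i r)]
    split_ifs with hr
    · exact cutTime_zero _ _ hr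
    · rfl
  | node k' hn h' t x d ih =>
    intro m k h c i r
    obtain ⟨⟨i, j⟩, rfl⟩ := (blk k' h').surjective i
    rw [graft, blk_blk k' h' k h (fun i => ∑ j, k (blk k' h' ⟨i, j⟩)) (fun _ => rfl)
      (sum_blk k' h' k h), cutTime_node, cutTime_node, ih]
    have h0 := blk_zero_iff (fun j => k (blk k' h' ⟨i, j⟩)) rfl
      (fun j => (c (blk k' h' ⟨i, j⟩)).pos) j r
    by_cases hr : r.val = 0 <;> by_cases hj : j.val = 0 <;> simp [h0, hr, hj]

theorem cutTime_of_isConst {n : ℕ} {t : unitInterval} {R : DTree P n} (hR : R.IsConst t)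
    (i : Fin n) : R.cutTime i = if i.val = 0 then 0 else t := by
  induction R with
  | leaf h => subst h; simp [cutTime]
  | node k hn h t' x d ih =>
    obtain ⟨⟨i, r⟩, rfl⟩ := (blk k h).surjective i
    rw [cutTime_node, ih i (hR.2 i), hR.1]
    have h0 := blk_zero_iff k h (fun i => (d i).pos) i r
    by_cases hr : r.val = 0 <;> by_cases hj : i.val = 0 <;> simp [h0, hr, hj]

theorem Contraction.cutTime_eq {m : ℕ} {p q : DTree P m} (hpq : Contraction p q) :
    p.cutTime = q.cutTime := by
  induction hpq with
  | leaf h => rfl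
  | node k hn h t R hR c c' hc ih =>
    funext j
    obtain ⟨⟨i, r⟩, rfl⟩ := (blk k h).surjective j
    rw [cutTime_graft, cutTime_node, cutTime_of_isConst hR, ih]

theorem comp_congr {Q : NSOperad.{u}} {n m : ℕ} {k k' : Fin n → ℕ} (h : ∑ i, k i = m)
    (h' : ∑ i, k' i = m) (x : Q.X n)
    {c : ∀ i, Q.X (k i)} {c' : ∀ i, Q.X (k' i)}
    (e : ∀ i, (⟨k i, c i⟩ : Σ j, Q.X j) = ⟨k' i, c' i⟩) : Q.comp k h x c = Q.comp k' h' x c' := by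
  obtain rfl : k = k' := funext fun i => congrArg Sigma.fst (e i)
  obtain rfl : c = c' := funext fun i => eq_of_heq (Sigma.mk.inj (e i)).2
  rfl

theorem comp_cast_one {Q : NSOperad.{u}} {n m : ℕ} (hn : n = 1) (k : Fin n → ℕ)
    (h : ∑ i, k i = m) (c : ∀ i, Q.X (k i)) (i : Fin n) :
    (⟨m, Q.comp k h (hn ▸ Q.one) c⟩ : Σ j, Q.X j) = ⟨k i, c i⟩ := by
  subst hn
  obtain rfl : i = 0 := Subsingleton.elim _ _
  obtain rfl : m = k 0 := by simpa using h.symm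
  congr 1
  rw [← Q.one_comp (by simp) (c 0)]
  refine comp_congr _ _ _ fun i => ?_
  obtain rfl : i = 0 := Subsingleton.elim _ _
  rfl

/-- Composition of trees is compatible with grafting, so it is invariant under contractions. -/
theorem compose_graft {n : ℕ} (R : DTree P n) : ∀ {m : ℕ} (k : Fin n → ℕ) (h : ∑ i, k i = m)
    (c : ∀ i, DTree P (k i)),
    (R.graft k h c).compose = P.comp k h R.compose (fun i => (c i).compose) := by
  induction R with
  | leaf hn =>
    intro m k h c
    have i : Fin _ := ⟨0, hn ▸ one_pos⟩
    have e := sigma_graft_leaf hn k h c i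
    have e' := comp_cast_one hn k h (fun i => (c i).compose) i
    have e'' := congrArg (fun s : Σ j, DTree P j => (⟨s.1, s.2.compose⟩ : Σ j, P.X j)) e
    exact eq_of_heq (Sigma.mk.inj (e''.trans e'.symm)).2
  | node k' hn h' t x d ih =>
    intro m k h c
    rw [graft, compose, compose, P.assoc k' h' k h (fun i => ∑ j, k (blk k' h' ⟨i, j⟩))
      (fun _ => rfl) (sum_blk k' h' k h)]
    simp only [ih]

theorem Contraction.compose_eq {m : ℕ} {p q : DTree P m} (hpq : Contraction p q) :
    p.compose = q.compose := by
  induction hpq with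
  | leaf h => rfl
  | node k hn h t R hR c c' hc ih =>
    rw [compose_graft, compose]
    simp only [ih]

section Eval

variable {O : NSOperad.{u}} {f : P.Hom O} (l : OperadLoop f)

theorem eval_graft {n : ℕ} (R : DTree P n) : ∀ {m : ℕ} (k : Fin n → ℕ) (h : ∑ i, k i = m)
    (c : ∀ i, DTree P (k i)),
    (R.graft k h c).eval l = O.comp k h (R.eval l) (fun i => (c i).eval l) := by
  induction R with
  | leaf hn =>
    intro m k h c
    have i : Fin _ := ⟨0, hn ▸ one_pos⟩
    have e := sigma_graft_leaf hn k h c i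
    have e' := comp_cast_one hn k h (fun i => (c i).eval l) i
    have e'' := congrArg (fun s : Σ j, DTree P j => (⟨s.1, s.2.eval l⟩ : Σ j, O.X j)) e
    exact eq_of_heq (Sigma.mk.inj (e''.trans e'.symm)).2
  | node k' hn h' t x d ih =>
    intro m k h c
    rw [graft, eval, eval, O.assoc k' h' k h (fun i => ∑ j, k (blk k' h' ⟨i, j⟩))
      (fun _ => rfl) (sum_blk k' h' k h)]
    simp only [ih]

theorem eval_of_isConst {n : ℕ} {t : unitInterval} {R : DTree P n} (hR : R.IsConst t) :
    R.eval l = (l.hom t).toFun n R.compose := by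
  induction R with
  | leaf h => subst h; exact (l.hom t).map_one.symm
  | node k hn h t' x d ih =>
    rw [eval, compose, (l.hom t).map_comp, hR.1]
    congr 1
    funext i
    exact ih i (hR.2 i)

theorem Contraction.eval_eq {m : ℕ} {p q : DTree P m} (hpq : Contraction p q) :
    p.eval l = q.eval l := by
  induction hpq with
  | leaf h => rfl
  | node k hn h t R hR c c' hc ih =>
    rw [eval_graft, eval, eval_of_isConst l hR]
    simp only [ih]

theorem eval_corolla {k : ℕ} (hk : 1 ≤ k) (t : unitInterval) (y : P.X k) (hy : k = 1 → HEq y P.one) :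
    (corolla hk t y).eval l = (l.hom t).toFun k y := by
  rw [corolla]
  split_ifs with h
  · subst h
    rw [eq_of_heq (hy rfl), (l.hom t).map_one]
    rfl
  · rw [eval]
    exact O.comp_one _ _

end Eval

/-- Contractions of the branches of a tree give a contraction of the tree. -/
theorem Contraction.branches {n m : ℕ} (k : Fin n → ℕ) (hn : 2 ≤ n) (h : ∑ i, k i = m)
    (t : unitInterval) (x : P.X n) (c c' : ∀ i, DTree P (k i))
    (hc : ∀ i, Contraction (c i) (c' i)) :
    Contraction (DTree.node k hn h t x c) (DTree.node k hn h t x c') := by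
  have hk : ∑ _i : Fin n, 1 = n := by simp
  have key := Contraction.node k hn h t
    (.node (fun _ : Fin n => 1) hn hk t x (fun _ => .leaf rfl)) ⟨rfl, fun _ => trivial⟩ c c' hc
  have e1 : (DTree.node (fun _ : Fin n => 1) hn hk t x (fun _ => DTree.leaf rfl)).compose = x := by
    rw [compose]
    exact P.comp_one hk x
  have e2 : (DTree.node (fun _ : Fin n => 1) hn hk t x (fun _ => DTree.leaf rfl)).graft k h c =
      .node k hn h t x c := by
    rw [graft]
    refine node_congr fun i => ?_
    rw [sigma_graft_leaf rfl _ _ _ (0 : Fin 1)]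
    have : ∀ a : Fin n, a = i → (⟨k a, c a⟩ : Σ j, DTree P j) = ⟨k i, c i⟩ := by
      rintro _ rfl; rfl
    exact this _ (blk_ones hk i 0)
  rwa [e1, e2] at key

/-- A contraction that contracts nothing. -/
theorem Contraction.refl : ∀ {m : ℕ} (D : DTree P m), Contraction D D
  | _, .leaf h => .leaf h
  | _, .node k hn h t x c => .branches k hn h t x c c (fun i => Contraction.refl (c i))

/-- The parameter of the lowest bead, if any, is at least `s`. -/
def RootGe (s : unitInterval) : {m : ℕ} → DTree P m → Prop
  | _, .leaf _ => True
  | _, .node _ _ _ t _ _ => s ≤ t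

/-- The parameter of the lowest bead, if any, is greater than `s`. -/
def RootGt (s : unitInterval) : {m : ℕ} → DTree P m → Prop
  | _, .leaf _ => True
  | _, .node _ _ _ t _ _ => s < t

/-- The parameters of the beads do not decrease along the tree. -/
def Mono : {m : ℕ} → DTree P m → Prop
  | _, .leaf _ => True
  | _, .node _ _ _ t _ c => ∀ i, (c i).RootGe t ∧ (c i).Mono

theorem RootGt.rootGe {s : unitInterval} {m : ℕ} {D : DTree P m} (h : D.RootGt s) :
    D.RootGe s := by
  cases D with
  | leaf => trivial
  | node => exact le_of_lt h

theorem Contraction.rootGe_iff {m : ℕ} {p q : DTree P m} (hpq : Contraction p q)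
    (s : unitInterval) : p.RootGe s ↔ q.RootGe s := by
  cases hpq with
  | leaf h => rfl
  | node k hn h t R hR c c' hc =>
    cases R with
    | leaf h => omega
    | node k' hn' h' t' x d => rw [← hR.1]; rfl

theorem le_cutTime {m : ℕ} {D : DTree P m} (hD : D.Mono) {s : unitInterval} (hs : D.RootGe s)
    (j : Fin m) (hj : j.val ≠ 0) : s ≤ D.cutTime j := by
  induction D generalizing s with
  | leaf h => omega
  | node k hn h t x c ih =>
    obtain ⟨⟨i, r⟩, rfl⟩ := (blk k h).surjective j
    rw [Ne, blk_zero_iff k h (fun i => (c i).pos)] at hj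
    rw [cutTime_node]
    split_ifs with h1 h2
    · exact absurd ⟨h2, h1⟩ hj
    · exact hs
    · exact le_trans hs (ih i (hD i).2 (hD i).1 r h1)

theorem lt_cutTime {m : ℕ} {D : DTree P m} (hD : D.Mono) {s : unitInterval} (hs : D.RootGt s)
    (j : Fin m) (hj : j.val ≠ 0) : s < D.cutTime j := by
  cases D with
  | leaf h => omega
  | node k hn h t x c => exact lt_of_lt_of_le hs (le_cutTime hD (le_refl t) j hj)

theorem RootGe.graft {n m : ℕ} {s : unitInterval} {R : DTree P n} (hR : R.RootGe s)
    (k : Fin n → ℕ) (h : ∑ i, k i = m) (c : ∀ i, DTree P (k i)) (hc : ∀ i, (c i).RootGe s) :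
    (R.graft k h c).RootGe s := by
  cases R with
  | leaf hn =>
    have e := sigma_graft_leaf hn k h c ⟨0, by omega⟩
    have : ∀ {a b : ℕ} {D : DTree P a} {D' : DTree P b}, (⟨a, D⟩ : Σ j, DTree P j) = ⟨b, D'⟩ →
        D'.RootGe s → D.RootGe s := by
      intro a b D D' e h
      cases e
      exact h
    exact this e (hc _)
  | node => exact hR

theorem Mono.graft {n : ℕ} {R : DTree P n} (hR : R.Mono) : ∀ {m : ℕ} (k : Fin n → ℕ)
    (h : ∑ i, k i = m) (c : ∀ i, DTree P (k i)), (∀ i, (c i).Mono) →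
    (∀ i s, (c i).RootGe s) → (R.graft k h c).Mono := by
  induction R with
  | leaf hn =>
    intro m k h c hc _
    have e := sigma_graft_leaf hn k h c ⟨0, by omega⟩
    have : ∀ {a b : ℕ} {D : DTree P a} {D' : DTree P b}, (⟨a, D⟩ : Σ j, DTree P j) = ⟨b, D'⟩ →
        D'.Mono → D.Mono := by
      intro a b D D' e h
      cases e
      exact h
    exact this e (hc _)
  | node k' hn h' t x d ih =>
    intro m k h c hc hs i
    exact ⟨(hR i).1.graft _ _ _ (fun j => hs _ _), ih i (hR i).2 _ _ _ (fun j => hc _)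
      (fun j => hs _)⟩

theorem mono_corolla {k : ℕ} (hk : 1 ≤ k) (t : unitInterval) (y : P.X k) :
    (corolla hk t y).Mono := by
  rw [corolla]
  split_ifs with h
  · trivial
  · exact fun i => ⟨trivial, trivial⟩

theorem rootGe_corolla_one {k : ℕ} (hk : 1 ≤ k) (y : P.X k) (s : unitInterval) :
    (corolla hk 1 y).RootGe s := by
  rw [corolla]
  split_ifs with h
  · trivial
  · exact unitInterval.le_one'

theorem cutTime_corolla {k : ℕ} (hk : 1 ≤ k) (t : unitInterval) (y : P.X k) (j : Fin k)
    (hj : j.val ≠ 0) : (corolla hk t y).cutTime j = t := by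
  rw [corolla]
  split_ifs with h
  · omega
  · have hs : ∑ _i : Fin k, 1 = k := by simp
    have := cutTime_node (fun _ : Fin k => 1) (by omega) hs t y (fun _ => .leaf rfl) j 0
    rw [blk_ones] at this
    rw [this]
    simp [hj]

/-- Every tree with monotone parameters is obtained by grafting trees, whose lowest beads have
parameters greater than `t`, to a tree all of whose beads have parameter `t`. -/
theorem exists_eq_graft {m : ℕ} (D : DTree P m) (hD : D.Mono) (t : unitInterval)
    (ht : D.RootGe t) : ∃ (n : ℕ) (R : DTree P n) (g : Fin n → Σ j, DTree P j)
      (h : ∑ i, (g i).1 = m), R.IsConst t ∧ D = R.graft (fun i => (g i).1) h (fun i => (g i).2) ∧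
      (∀ i, (g i).2.RootGt t) ∧ ∀ i, (g i).2.Mono := by
  induction D with
  | @leaf m hm => exact ⟨1, .leaf rfl, fun _ => ⟨m, .leaf hm⟩, by simp, trivial, rfl,
      fun _ => trivial, fun _ => trivial⟩
  | @node n m k hn h t' x c ih =>
    rcases lt_or_eq_of_le (show t ≤ t' from ht) with hlt | rfl
    · exact ⟨1, .leaf rfl, fun _ => ⟨m, .node k hn h t' x c⟩, by simp, trivial, rfl,
        fun _ => hlt, fun _ => hD⟩
    · choose N R g hg hR e hgt hmono using fun i => ih i (hD i).2 (hD i).1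
      have hf : ∀ i j, (fun a => g ((blk N rfl).symm a).1 ((blk N rfl).symm a).2)
          (blk N rfl ⟨i, j⟩) = g i j := by
        exact fun i j => congrArg (fun s : Σ i, Fin (N i) => g s.1 s.2)
          ((blk N rfl).symm_apply_apply ⟨i, j⟩)
      have hsum : ∑ a, ((fun a => g ((blk N rfl).symm a).1 ((blk N rfl).symm a).2) a).1 = m := by
        rw [← Equiv.sum_comp (blk N rfl), Fintype.sum_sigma, ← h]
        refine Finset.sum_congr rfl fun i _ => ?_
        rw [← hg i]
        refine Finset.sum_congr rfl fun j _ => ?_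
        rw [hf]
      refine ⟨∑ i, N i, .node N hn rfl t x R,
        fun a => g ((blk N rfl).symm a).1 ((blk N rfl).symm a).2, hsum, ⟨rfl, hR⟩, ?_,
        fun a => hgt _ _, fun a => hmono _ _⟩
      rw [graft]
      refine node_congr fun i => ?_
      conv_lhs => rw [e i]
      exact sigma_graft _ _ _ fun j => (hf i j).symm

/-- The class of a tree has a representative in which all edges between beads with the lowest
parameter are contracted, so that the lowest bead is the only one with this parameter. -/
theorem exists_contraction_strict {n m : ℕ} (k : Fin n → ℕ) (hn : 2 ≤ n) (h : ∑ i, k i = m)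
    (t : unitInterval) (x : P.X n) (c : ∀ i, DTree P (k i)) (hD : (node k hn h t x c).Mono) :
    ∃ (n' : ℕ) (k' : Fin n' → ℕ) (hn' : 2 ≤ n') (h' : ∑ i, k' i = m) (x' : P.X n')
      (c' : ∀ i, DTree P (k' i)), Contraction (node k hn h t x c) (node k' hn' h' t x' c') ∧
      (∀ i, (c' i).RootGt t) ∧ (node k' hn' h' t x' c').Mono := by
  obtain ⟨n', R, g, h', hR, e, hgt, hmono⟩ := exists_eq_graft _ hD t (le_refl t)
  have hn' : 2 ≤ n' := by
    cases R with
    | leaf hl =>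
      exfalso
      have e' := sigma_graft_leaf hl _ h' (fun i => (g i).2) ⟨0, by omega⟩
      have : ∀ {a b : ℕ} {D : DTree P a} {D' : DTree P b}, (⟨a, D⟩ : Σ j, DTree P j) = ⟨b, D'⟩ →
          D'.RootGt t → D.RootGt t := by
        intro a b D D' e h
        cases e
        exact h
      have := this e' (hgt _)
      rw [← e] at this
      exact lt_irrefl _ this
    | node k'' hn'' h'' t' x' d =>
      exact le_trans hn'' (le_of_sum_eq h'' fun i => (d i).pos)
  refine ⟨n', fun i => (g i).1, hn', h', R.compose, fun i => (g i).2, ?_, hgt,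
    fun i => ⟨(hgt i).rootGe, hmono i⟩⟩
  have key := Contraction.node (fun i => (g i).1) hn' h' t R hR (fun i => (g i).2)
    (fun i => (g i).2) (fun i => .refl _)
  rwa [← e] at key

end DTree

/-! ### Points of `B P` as decorated trees -/

namespace PTree

variable {P : NSOperad.{0}} {n m : ℕ} {k : Fin n → ℕ} {hn : 2 ≤ n} {h : ∑ i, k i = m}

theorem bead_cases {c : ∀ i, PTree (k i)} (b : (PTree.node k hn h c).Bead) :
    b = rootBead k hn h c ∨ ∃ i b', b = branchBead k hn h c i b' := by
  change WithBot (Σ i, (c i).Bead) at b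
  induction b using WithBot.recBotCoe with
  | bot => exact Or.inl rfl
  | coe b => exact Or.inr ⟨b.1, b.2, rfl⟩

theorem monotone_node_iff {c : ∀ i, PTree (k i)} {s : (PTree.node k hn h c).Bead → unitInterval} :
    Monotone s ↔ (∀ i b, s (rootBead k hn h c) ≤ s (branchBead k hn h c i b)) ∧
      ∀ i, Monotone (fun b => s (branchBead k hn h c i b)) := by
  constructor
  · intro hs
    refine ⟨fun i b => hs ?_, fun i b b' hb => hs ?_⟩
    · exact (bot_le : (⊥ : WithBot (Σ i, (c i).Bead)) ≤ _)
    · have : (⟨i, b⟩ : Σ i, (c i).Bead) ≤ ⟨i, b'⟩ := Sigma.mk_le_mk_iff.2 hb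
      exact (WithBot.coe_le_coe.2 this :)
  · rintro ⟨h1, h2⟩ a b hab
    rcases bead_cases a with rfl | ⟨i, a, rfl⟩
    · rcases bead_cases b with rfl | ⟨j, b, rfl⟩
      · exact le_refl _
      · exact h1 j b
    · rcases bead_cases b with rfl | ⟨j, b, rfl⟩
      · exact absurd (show ((⟨i, a⟩ : Σ i, (c i).Bead) : WithBot (Σ i, (c i).Bead)) ≤ ⊥ from hab)
          (by simp)
      · have : (⟨i, a⟩ : Σ i, (c i).Bead) ≤ ⟨j, b⟩ := WithBot.coe_le_coe.1 hab
        cases this with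
        | fiber i a b hab' => exact h2 i hab'

/-- The decoration of a tree with decorated branches and a decorated lowest bead. -/
def lamNode (c : ∀ i, PTree (k i)) (x : P.X n) (X : ∀ i, (c i).Lam P) :
    (PTree.node k hn h c).Lam P :=
  WithBot.recBotCoe (C := fun b => P.X ((PTree.node k hn h c).arity b)) x (fun b => X b.1 b.2)

/-- The parameters of a tree given those of its branches and of its lowest bead. -/
def timeNode (c : ∀ i, PTree (k i)) (t : unitInterval) (s : ∀ i, (c i).Bead → unitInterval) :
    (PTree.node k hn h c).Bead → unitInterval :=
  WithBot.recBotCoe (C := fun _ => unitInterval) t (fun b => s b.1 b.2)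

theorem rootGe_decorate_iff {T : PTree m} {x : T.Lam P} {s : T.Bead → unitInterval}
    (hs : Monotone s) (t : unitInterval) : (T.decorate x s).RootGe t ↔ ∀ b, t ≤ s b := by
  cases T with
  | leaf h => exact ⟨fun _ b => Empty.elim b, fun _ => trivial⟩
  | node k hn h c =>
    rw [monotone_node_iff] at hs
    constructor
    · intro ht b
      rcases bead_cases b with rfl | ⟨i, b, rfl⟩
      · exact ht
      · exact le_trans ht (hs.1 i b)
    · intro ht
      exact ht _

theorem mono_decorate {T : PTree m} {x : T.Lam P} {s : T.Bead → unitInterval}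
    (hs : Monotone s) : (T.decorate x s).Mono := by
  induction T with
  | leaf h => trivial
  | node k hn h c ih =>
    have hs' := monotone_node_iff.1 hs
    exact fun i => ⟨(rootGe_decorate_iff (hs'.2 i) _).2 (hs'.1 i), ih i (hs'.2 i)⟩

theorem Collapse.refl {T : PTree m} (p : T.Cell P) : T.Collapse p p :=
  fun _ => Or.inl ⟨rfl, rfl⟩

theorem Collapse.time_eq {T : PTree m} {p q : T.Cell P} (hpq : T.Collapse p q) (b : T.Bead) :
    p.2.1 b = q.2.1 b := by
  rcases hpq b with h | h | h
  · exact h.1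
  · rw [h.1, h.2]
  · rw [h.1, h.2]

theorem pos {m : ℕ} (T : PTree m) : 1 ≤ m := by
  induction T with
  | leaf h => exact h.ge
  | node k hn h c ih => exact one_le_of_sum k h (by omega) ih

end PTree

instance PTree.finite (m : ℕ) : Finite (PTree m) := by
  induction m using Nat.strong_induction_on with
  | _ m ih =>
    have hfin : ∀ (n : Fin (m + 1)) (k : Fin n → Fin m), Finite (∀ i, PTree (k i)) := fun n k =>
      have := fun i => ih (k i) (k i).2
      inferInstance
    have hsub : (Set.univ : Set (PTree m)) ⊆ Set.range (fun h : m = 1 => PTree.leaf h) ∪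
        ⋃ (n : Fin (m + 1)) (k : Fin n → Fin m) (hn : 2 ≤ n.val) (h : ∑ i, (k i).val = m),
          Set.range (PTree.node (fun i => (k i).val) hn h) := by
      rintro T -
      cases T with
      | leaf h => exact Or.inl ⟨h, rfl⟩
      | @node n _ k hn h c =>
        right
        simp only [Set.mem_iUnion]
        exact ⟨⟨n, Nat.lt_succ_of_le (le_of_sum_eq h fun i => (c i).pos)⟩,
          fun i => ⟨k i, lt_of_sum_eq h hn (fun i => (c i).pos) i⟩, hn, h, c, rfl⟩
    rw [← Set.finite_univ_iff]
    refine Set.Finite.subset ?_ hsub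
    refine (Set.finite_range _).union ?_
    refine Set.finite_iUnion fun n => Set.finite_iUnion fun k => Set.finite_iUnion fun hn =>
      Set.finite_iUnion fun h => ?_
    have := hfin n k
    exact Set.finite_range _

variable {P : NSOperad.{0}}

namespace BRaw

theorem mono {m : ℕ} (p : BRaw P m) : p.tree.Mono := PTree.mono_decorate p.2.2.2

/-- The point given by a decorated lowest bead and points for the branches. -/
def node {n m : ℕ} (k : Fin n → ℕ) (hn : 2 ≤ n) (h : ∑ i, k i = m) (t : unitInterval) (x : P.X n)
    (p : ∀ i, BRaw P (k i)) (hp : ∀ i, (p i).tree.RootGe t) : BRaw P m :=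
  ⟨.node k hn h (fun i => (p i).1), PTree.lamNode _ x fun i => (p i).2.1,
    ⟨PTree.timeNode _ t fun i => (p i).2.2.1, PTree.monotone_node_iff.2
      ⟨fun i b => (PTree.rootGe_decorate_iff (p i).2.2.2 t).1 (hp i) b,
        fun i => (p i).2.2.2⟩⟩⟩

theorem tree_node {n m : ℕ} (k : Fin n → ℕ) (hn : 2 ≤ n) (h : ∑ i, k i = m) (t : unitInterval)
    (x : P.X n) (p : ∀ i, BRaw P (k i)) (hp : ∀ i, (p i).tree.RootGe t) :
    (node k hn h t x p hp).tree = .node k hn h t x (fun i => (p i).tree) := rfl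

theorem exists_tree_eq {m : ℕ} (D : DTree P m) (hD : D.Mono) : ∃ p : BRaw P m, p.tree = D := by
  induction D with
  | leaf h => exact ⟨⟨.leaf h, fun b => Empty.elim b, fun b => Empty.elim b, fun b => Empty.elim b⟩,
      rfl⟩
  | node k hn h t x c ih =>
    choose p hp using fun i => ih i (hD i).2
    refine ⟨node k hn h t x p fun i => hp i ▸ (hD i).1, ?_⟩
    rw [tree_node]
    simp only [hp]

end BRaw

namespace BSpace

theorem mk_eq_of_contraction {m : ℕ} {p q : BRaw P m} (h : DTree.Contraction p.tree q.tree) :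
    mk p = mk q := congrArg (Quot.mk _) (Quot.sound h)

theorem mk_eq_of_collapse {m : ℕ} {T : PTree m} {p q : T.Cell P} (h : T.Collapse p q) :
    mk ⟨T, p⟩ = mk ⟨T, q⟩ := Quot.sound ⟨T, p, q, h, rfl, rfl⟩

theorem mk_eq_of_tree_eq {m : ℕ} {p q : BRaw P m} (h : p.tree = q.tree) : mk p = mk q :=
  mk_eq_of_contraction (h ▸ DTree.Contraction.refl _)

theorem mk_surjective {m : ℕ} : Function.Surjective (mk (P := P) (m := m)) := by
  rintro ⟨⟨p⟩⟩
  exact ⟨p, rfl⟩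

/-- A function on points descends to `B P` if it is invariant under contractions and collapses. -/
def lift {m : ℕ} {Y : Type*} (f : BRaw P m → Y)
    (h1 : ∀ p q, DTree.Contraction p.tree q.tree → f p = f q)
    (h2 : ∀ (T : PTree m) (p q : T.Cell P), T.Collapse p q → f ⟨T, p⟩ = f ⟨T, q⟩) :
    BSpace P m → Y :=
  Quot.lift (Quot.lift f h1) (by rintro _ _ ⟨T, p, q, h, rfl, rfl⟩; exact h2 T p q h)

theorem continuous_lift {m : ℕ} {Y : Type*} [TopologicalSpace Y] {f : BRaw P m → Y}
    (h1 : ∀ p q, DTree.Contraction p.tree q.tree → f p = f q)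
    (h2 : ∀ (T : PTree m) (p q : T.Cell P), T.Collapse p q → f ⟨T, p⟩ = f ⟨T, q⟩)
    (hf : ∀ T : PTree m, Continuous fun p : T.Cell P => f ⟨T, p⟩) : Continuous (lift f h1 h2) :=
  continuous_quot_lift _ (continuous_quot_lift _ (continuous_sigma hf))

/-- Collapses of the branches and of the lowest bead give a collapse of the tree. -/
theorem mk_node_eq_of_collapse {n m : ℕ} (k : Fin n → ℕ) (hn : 2 ≤ n) (h : ∑ i, k i = m)
    (t : unitInterval) (x x' : P.X n) (hx : x = x' ∨ t = 0 ∨ t = 1) (p p' : ∀ i, BRaw P (k i))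
    (hp : ∀ i, (p i).tree.RootGe t) (hp' : ∀ i, (p' i).tree.RootGe t)
    (e : ∀ i, ∃ (T : PTree (k i)) (a b : T.Cell P), p i = ⟨T, a⟩ ∧ p' i = ⟨T, b⟩ ∧
      T.Collapse a b) : mk (.node k hn h t x p hp) = mk (.node k hn h t x' p' hp') := by
  choose T a b hpa hpb hab using e
  obtain rfl : p = fun i => ⟨T i, a i⟩ := funext hpa
  obtain rfl : p' = fun i => ⟨T i, b i⟩ := funext hpb
  refine mk_eq_of_collapse fun c => ?_
  rcases PTree.bead_cases c with rfl | ⟨i, c, rfl⟩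
  · rcases hx with rfl | rfl | rfl
    · exact Or.inl ⟨rfl, rfl⟩
    · exact Or.inr (Or.inl ⟨rfl, rfl⟩)
    · exact Or.inr (Or.inr ⟨rfl, rfl⟩)
  · exact hab i c

open Classical in
/-- A branch may be replaced by another branch that represents the same class. -/
theorem mk_node_update {n m : ℕ} (k : Fin n → ℕ) (hn : 2 ≤ n) (h : ∑ i, k i = m)
    (t : unitInterval) (x : P.X n) (p : ∀ i, BRaw P (k i)) (i : Fin n) (q q' : BRaw P (k i))
    (hq : ∀ j, (Function.update p i q j).tree.RootGe t)
    (hq' : ∀ j, (Function.update p i q' j).tree.RootGe t) (e : mk q = mk q') :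
    mk (.node k hn h t x (Function.update p i q) hq) =
      mk (.node k hn h t x (Function.update p i q') hq') := by
  have hupd : ∀ q : BRaw P (k i), q.tree.RootGe t →
      ∀ j, (Function.update p i q j).tree.RootGe t := by
    intro r hr j
    rcases eq_or_ne j i with rfl | hj
    · rwa [Function.update_self]
    · have := hq j
      rwa [Function.update_of_ne hj] at this ⊢
  let f : BRaw P (k i) → Option (BSpace P m) := fun r =>
    if hr : r.tree.RootGe t then some (mk (.node k hn h t x (Function.update p i r) (hupd r hr)))
    else none
  have h1 : ∀ r s, DTree.Contraction r.tree s.tree → f r = f s := by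
    intro r s hrs
    by_cases hr : r.tree.RootGe t
    · have hs := (hrs.rootGe_iff t).1 hr
      simp only [f, dif_pos hr, dif_pos hs, Option.some.injEq]
      apply mk_eq_of_contraction
      rw [BRaw.tree_node, BRaw.tree_node]
      refine DTree.Contraction.branches _ _ _ _ _ _ _ fun j => ?_
      rcases eq_or_ne j i with rfl | hj
      · simpa only [Function.update_self] using hrs
      · simpa only [Function.update_of_ne hj] using .refl _
    · have hs := fun h => hr ((hrs.rootGe_iff t).2 h)
      simp only [f, dif_neg hr, dif_neg hs]
  have h2 : ∀ (T : PTree (k i)) (a b : T.Cell P), T.Collapse a b → f ⟨T, a⟩ = f ⟨T, b⟩ := by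
    intro T a b hab
    have hiff : (BRaw.tree ⟨T, a⟩).RootGe t ↔ (BRaw.tree ⟨T, b⟩).RootGe t := by
      rw [BRaw.tree, BRaw.tree, PTree.rootGe_decorate_iff a.2.2, PTree.rootGe_decorate_iff b.2.2]
      exact forall_congr' fun c => by rw [hab.time_eq c]
    by_cases hr : (BRaw.tree ⟨T, a⟩).RootGe t
    · have hs := hiff.1 hr
      simp only [f, dif_pos hr, dif_pos hs, Option.some.injEq]
      apply mk_node_eq_of_collapse _ _ _ _ _ _ (Or.inl rfl)
      intro j
      rcases eq_or_ne j i with rfl | hj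
      · exact ⟨T, a, b, by rw [Function.update_self], by rw [Function.update_self], hab⟩
      · exact ⟨(p j).1, (p j).2, (p j).2, by rw [Function.update_of_ne hj],
          by rw [Function.update_of_ne hj], .refl _⟩
    · have hs := fun h => hr (hiff.2 h)
      simp only [f, dif_neg hr, dif_neg hs]
  have key : f q = f q' := congrArg (lift f h1 h2) e
  have h3 := hq i
  have h4 := hq' i
  rw [Function.update_self] at h3 h4
  simpa only [f, dif_pos h3, dif_pos h4, Option.some.injEq] using key

/-- The class of a tree depends only on the classes of its branches, and not on the decoration of its
lowest bead if the parameter of this bead is `0` or `1`. -/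
theorem mk_node_eq {n m : ℕ} (k : Fin n → ℕ) (hn : 2 ≤ n) (h : ∑ i, k i = m)
    (t : unitInterval) (x x' : P.X n) (hx : x = x' ∨ t = 0 ∨ t = 1) (p p' : ∀ i, BRaw P (k i))
    (hp : ∀ i, (p i).tree.RootGe t) (hp' : ∀ i, (p' i).tree.RootGe t)
    (e : ∀ i, mk (p i) = mk (p' i)) :
    mk (.node k hn h t x p hp) = mk (.node k hn h t x' p' hp') := by
  classical
  have hs : ∀ (s : Finset (Fin n)) (i : Fin n),
      ((fun i => if i ∈ s then p' i else p i) i).tree.RootGe t := by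
    intro s i
    by_cases hi : i ∈ s <;> simp only [hi, if_true, if_false]
    · exact hp' i
    · exact hp i
  have key : ∀ s : Finset (Fin n), mk (.node k hn h t x p hp) =
      mk (.node k hn h t x (fun i => if i ∈ s then p' i else p i) (hs s)) := by
    intro s
    induction s using Finset.induction_on with
    | empty => simp
    | insert a s ha ih =>
      rw [ih]
      have e1 : (fun i => if i ∈ s then p' i else p i) =
          Function.update (fun i => if i ∈ s then p' i else p i) a (p a) := by
        rw [eq_comm, Function.update_eq_self_iff, if_neg ha]
      have e2 : (fun i => if i ∈ insert a s then p' i else p i) =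
          Function.update (fun i => if i ∈ s then p' i else p i) a (p' a) := by
        funext i
        rcases eq_or_ne i a with rfl | hi
        · simp
        · simp [hi, Finset.mem_insert]
      have h1 := hs s
      have h2 := hs (insert a s)
      have := mk_node_update k hn h t x (fun i => if i ∈ s then p' i else p i) a (p a) (p' a)
        (by rw [← e1]; exact h1) (by rw [← e2]; exact h2) (e a)
      convert this
  rw [key Finset.univ]
  simp only [Finset.mem_univ, if_true]
  exact mk_node_eq_of_collapse k hn h t x x' hx p' p' _ hp' fun i =>
    ⟨(p' i).1, (p' i).2, (p' i).2, rfl, rfl, .refl _⟩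

end BSpace

/-! ### Continuity of the composition of decorated trees -/

section Continuity

theorem continuous_comp_of_kContinuous {X : Type u} {Y : Type u} [TopologicalSpace X]
    [TopologicalSpace Y] {f : X → Y} (hf : KContinuous f) {Z : Type} [TopologicalSpace Z]
    [CompactSpace Z] [T2Space Z] {g : Z → X} (hg : Continuous g) : Continuous fun z => f (g z) :=
  (hf (ULift.{u} Z) (fun z => g z.down) (hg.comp continuous_uliftDown)).comp continuous_uliftUp

variable {n m : ℕ} (k : Fin n → ℕ) (hn : 2 ≤ n) (h : ∑ i, k i = m) (c : ∀ i, PTree (k i))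

theorem continuous_rootLam :
    Continuous fun q : (PTree.node k hn h c).Lam P × ((PTree.node k hn h c).Bead → unitInterval) =>
      (q.1 (PTree.rootBead k hn h c) : P.X n) :=
  (continuous_apply (PTree.rootBead k hn h c)).comp continuous_fst

theorem continuous_rootTime :
    Continuous fun q : (PTree.node k hn h c).Lam P × ((PTree.node k hn h c).Bead → unitInterval) =>
      q.2 (PTree.rootBead k hn h c) :=
  (continuous_apply (PTree.rootBead k hn h c)).comp continuous_snd

theorem continuous_branch (i : Fin n) :
    Continuous fun q : (PTree.node k hn h c).Lam P × ((PTree.node k hn h c).Bead → unitInterval) =>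
      ((fun b => q.1 (PTree.branchBead k hn h c i b), fun b => q.2 (PTree.branchBead k hn h c i b)) :
        (c i).Lam P × ((c i).Bead → unitInterval)) := by
  refine Continuous.prodMk (continuous_pi fun b => ?_) (continuous_pi fun b => ?_)
  · exact (continuous_apply (PTree.branchBead k hn h c i b)).comp continuous_fst
  · exact (continuous_apply (PTree.branchBead k hn h c i b)).comp continuous_snd

theorem continuous_decorate_cutTime {m : ℕ} (T : PTree m) (j : Fin m) :
    Continuous fun q : T.Lam P × (T.Bead → unitInterval) => (T.decorate q.1 q.2).cutTime j := by
  induction T with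
  | leaf h => exact continuous_const
  | node k hn h c ih =>
    obtain ⟨⟨i, r⟩, rfl⟩ := (blk k h).surjective j
    refine (continuous_congr fun q => DTree.cutTime_node _ _ _ _ _ _ i r).2 ?_
    split_ifs
    · exact continuous_const
    · exact continuous_rootTime k hn h c
    · exact Continuous.comp (ih i r) (continuous_branch k hn h c i)

variable {O : NSOperad.{u}} [∀ n, CompactSpace (P.X n)] [∀ n, T2Space (P.X n)]

theorem continuous_decorate_eval {f : P.Hom O} (l : OperadLoop f) {m : ℕ} (T : PTree m) :
    Continuous fun q : T.Lam P × (T.Bead → unitInterval) => (T.decorate q.1 q.2).eval l := by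
  induction T with
  | leaf h => exact continuous_const
  | node k hn h c ih =>
    refine continuous_comp_of_kContinuous (O.comp_cont k h)
      (g := fun q : (PTree.node k hn h c).Lam P × ((PTree.node k hn h c).Bead → unitInterval) =>
        ((l.hom (q.2 (PTree.rootBead k hn h c))).toFun _ (q.1 (PTree.rootBead k hn h c)),
        fun i => ((c i).decorate (fun b => q.1 (PTree.branchBead k hn h c i b))
        (fun b => q.2 (PTree.branchBead k hn h c i b))).eval l)) ?_
    refine Continuous.prodMk ?_ (continuous_pi fun i => ?_)
    · exact Continuous.comp (l.cont _)
        ((continuous_rootTime k hn h c).prodMk (continuous_rootLam k hn h c))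
    · exact ((ih i).comp (continuous_branch k hn h c i) :)

theorem continuous_decorate_compose {m : ℕ} (T : PTree m) :
    Continuous fun q : T.Lam P × (T.Bead → unitInterval) => (T.decorate q.1 q.2).compose := by
  induction T with
  | leaf h => exact continuous_const
  | node k hn h c ih =>
    refine continuous_comp_of_kContinuous (P.comp_cont k h)
      (g := fun q : (PTree.node k hn h c).Lam P × ((PTree.node k hn h c).Bead → unitInterval) =>
        (q.1 (PTree.rootBead k hn h c),
        fun i => ((c i).decorate (fun b => q.1 (PTree.branchBead k hn h c i b))
        (fun b => q.2 (PTree.branchBead k hn h c i b))).compose)) ?_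
    refine Continuous.prodMk (continuous_rootLam k hn h c) (continuous_pi fun i => ?_)
    exact ((ih i).comp (continuous_branch k hn h c i) :)

end Continuity

/-! ### The coordinates of a tree with edge lengths and parameters -/

/-- The contribution of the edge below the set of leaves `{p.1, …, p.2}` to the coordinates. The
maximum is the parameter of the bead at the lower end of this edge, since the parameters do not
decrease along the tree. Because of the factor `1 / 2` the contribution is never `0`. -/
noncomputable def edgeFactor (X : ℕ → ℕ → ℝ) (τ : ℕ → ℝ) (p : ℕ × ℕ) : ℝ :=
  1 - max (τ p.1) (τ (p.2 + 1)) * X p.1 p.2 / 2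

/-- The proper subintervals `{a, …, b}` of the interval `{lo, …, hi - 1}` that contain both `j - 1`
and `j`. -/
def pairsAt (lo hi j : ℕ) : Finset (ℕ × ℕ) :=
  (Finset.Ico lo j ×ˢ Finset.Ico j hi).erase (lo, hi - 1)

theorem mem_pairsAt {lo hi j a b : ℕ} : (a, b) ∈ pairsAt lo hi j ↔
    ¬(a = lo ∧ b + 1 = hi) ∧ lo ≤ a ∧ a < j ∧ j ≤ b ∧ b < hi := by
  simp only [pairsAt, Finset.mem_erase, Finset.mem_product, Finset.mem_Ico, ne_eq, Prod.mk.injEq]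
  constructor <;> intro h <;> refine ⟨fun h' => h.1 ⟨h'.1, by omega⟩, by tauto⟩

/-- The coordinate at `j` of the subtree with set of leaves `{lo, …, hi - 1}`: the product of the
number `1 - τ j` and of the contributions of the edges on the path from the root of this subtree to
the vertex at which the leaves `j - 1` and `j` separate. -/
noncomputable def coordOn (X : ℕ → ℕ → ℝ) (τ : ℕ → ℝ) (lo hi j : ℕ) : ℝ :=
  (1 - τ j) * ∏ p ∈ pairsAt lo hi j, edgeFactor X τ p

/-- If the subtree with set of leaves `{lo', …, hi' - 1}` is a branch, then its coordinates are those
of the whole tree up to the contribution of the edge below it. -/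
theorem coordOn_eq_mul {X : ℕ → ℕ → ℝ} {τ : ℕ → ℝ} {lo hi lo' hi' j : ℕ} (hlo : lo ≤ lo')
    (h1 : lo' < j) (h2 : j < hi') (hhi : hi' ≤ hi) (hp : ¬(lo' = lo ∧ hi' = hi))
    (hone : ∀ a b, (a, b) ∈ pairsAt lo hi j → ¬(lo' ≤ a ∧ b < hi') → edgeFactor X τ (a, b) = 1) :
    coordOn X τ lo hi j = edgeFactor X τ (lo', hi' - 1) * coordOn X τ lo' hi' j := by
  have hmem : (lo', hi' - 1) ∈ pairsAt lo hi j :=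
    mem_pairsAt.2 ⟨fun h => hp ⟨h.1, by omega⟩, hlo, h1, by omega, by omega⟩
  rw [coordOn, coordOn, ← Finset.mul_prod_erase _ _ hmem, mul_left_comm]
  congr 2
  symm
  apply Finset.prod_subset
  · rintro ⟨a, b⟩ hab
    rw [mem_pairsAt] at hab
    rw [Finset.mem_erase, mem_pairsAt, Ne, Prod.mk.injEq]
    omega
  · rintro ⟨a, b⟩ hab hnot
    rw [Finset.mem_erase, Ne, Prod.mk.injEq] at hab
    rw [mem_pairsAt] at hnot
    have hab' := mem_pairsAt.1 hab.2
    exact hone a b hab.2 (by omega)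

/-- The conditions satisfied by the edge lengths `X` and the parameters `τ` of a subtree with set of
leaves `{lo, …, hi - 1}`: `X a b` is the length of the edge below the set of leaves `{a, …, b}`, and
`τ j` is the parameter of the bead at which the leaves `j - 1` and `j` separate. By `cross` the sets of
leaves are nested or disjoint. By `lowest` the bead with parameter `τ j` is the lowest one in a
subtree. By `short` an edge of length between `0` and `1` does not connect two beads but is part of
the decoration of one bead, whose parameter `max (τ a) (τ (b + 1))` thus also occurs above this
edge. -/
structure IsTreeData (X : ℕ → ℕ → ℝ) (τ : ℕ → ℝ) (lo hi : ℕ) : Prop where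
  nonneg : ∀ a b, 0 ≤ X a b
  le_one : ∀ a b, X a b ≤ 1
  time_nonneg : ∀ j, 0 ≤ τ j
  time_le_one : ∀ j, τ j ≤ 1
  cross : ∀ a b c e, lo ≤ a → a < c → c ≤ b → b < e → e < hi → X a b = 0 ∨ X c e = 0
  lowest : ∀ j, lo < j → j < hi → ∃ a b, lo ≤ a ∧ a < j ∧ j ≤ b ∧ b < hi ∧
    (0 < X a b ∨ (a = lo ∧ b + 1 = hi)) ∧ ∀ j', a < j' → j' ≤ b → τ j ≤ τ j'
  short : ∀ a b, lo ≤ a → a < b → b < hi → ¬(a = lo ∧ b + 1 = hi) → 0 < X a b → X a b < 1 →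
    ∃ j, a < j ∧ j ≤ b ∧ τ j ≤ max (τ a) (τ (b + 1))
  left : ∀ j, lo < j → j < hi → τ lo ≤ τ j
  right : ∀ j, lo < j → j < hi → τ hi ≤ τ j

/-- Some position is not separated from the root by an edge, since edges with nested or disjoint sets
of leaves cannot cover all positions. -/
theorem exists_not_mem_edge {X : ℕ → ℕ → ℝ} {lo hi : ℕ} (h : lo + 1 < hi)
    (cross : ∀ a b c e, lo ≤ a → a < c → c ≤ b → b < e → e < hi → X a b = 0 ∨ X c e = 0) :
    ∃ j, lo < j ∧ j < hi ∧ ∀ a b, (a, b) ∈ pairsAt lo hi j → X a b = 0 := by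
  classical
  by_contra hcon
  push Not at hcon
  have hcon' : ∀ j, lo < j → j < hi → ∃ a b, (¬(a = lo ∧ b + 1 = hi) ∧ lo ≤ a ∧ a < j ∧ j ≤ b ∧
      b < hi) ∧ X a b ≠ 0 := by
    intro j h1 h2
    obtain ⟨a, b, hab, hX⟩ := hcon j h1 h2
    exact ⟨a, b, mem_pairsAt.1 hab, hX⟩
  obtain ⟨a, b, ⟨h1, h2, h3, h4, h5⟩, hX⟩ := hcon' (lo + 1) (by omega) h
  obtain rfl : a = lo := by omega
  let s := (Finset.Ico (a + 1) (hi - 1)).filter fun b => X a b ≠ 0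
  have hs : s.Nonempty := ⟨b, by
    simp only [s, Finset.mem_filter, Finset.mem_Ico]; exact ⟨by omega, hX⟩⟩
  obtain ⟨b0, hb0, hmax⟩ := Finset.exists_max_image s id hs
  simp only [s, Finset.mem_filter, Finset.mem_Ico, id] at hb0 hmax
  obtain ⟨a1, b1, ⟨h1', h2', h3', h4', h5'⟩, hX'⟩ := hcon' (b0 + 1) (by omega) (by omega)
  rcases eq_or_lt_of_le h2' with rfl | hlt
  · have := hmax b1 ⟨by omega, hX'⟩
    omega
  · rcases cross a b0 a1 b1 (le_refl _) hlt (by omega) (by omega) h5' with h | h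
    · exact hb0.2 h
    · exact hX' h

/-- A position `j` that does not satisfy `R` lies in a maximal interval of such positions. -/
theorem exists_interval (R : ℕ → Prop) {lo j hi : ℕ} (h1 : lo < j) (h2 : j < hi) (hj : ¬R j) :
    ∃ lo' hi', lo ≤ lo' ∧ lo' < j ∧ j < hi' ∧ hi' ≤ hi ∧ (lo' = lo ∨ (lo < lo' ∧ R lo')) ∧
      (hi' = hi ∨ (hi' < hi ∧ R hi')) ∧ ∀ c, lo' < c → c < hi' → ¬R c := by
  classical
  obtain ⟨l, hl, hlmax⟩ := Finset.exists_max_image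
    ((Finset.Ico lo j).filter fun c => c = lo ∨ R c) id ⟨lo, by simp [h1]⟩
  obtain ⟨r, hr, hrmin⟩ := Finset.exists_min_image
    ((Finset.Ioc j hi).filter fun c => c = hi ∨ R c) id ⟨hi, by simp [h2]⟩
  simp only [Finset.mem_filter, Finset.mem_Ico, Finset.mem_Ioc, id] at hl hlmax hr hrmin
  refine ⟨l, r, hl.1.1, hl.1.2, hr.1.1, hr.1.2, ?_, ?_, ?_⟩
  · rcases eq_or_lt_of_le hl.1.1 with h | h
    · exact Or.inl h.symm
    · exact Or.inr ⟨h, hl.2.resolve_left h.ne'⟩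
  · rcases eq_or_lt_of_le hr.1.2 with h | h
    · exact Or.inl h
    · exact Or.inr ⟨h, hr.2.resolve_left h.ne⟩
  · intro c hc1 hc2 hR
    rcases lt_trichotomy c j with h | rfl | h
    · have := hlmax c ⟨⟨by omega, h⟩, Or.inr hR⟩
      omega
    · exact hj hR
    · have := hrmin c ⟨⟨h, by omega⟩, Or.inr hR⟩
      omega

namespace IsTreeData

variable {X : ℕ → ℕ → ℝ} {τ : ℕ → ℝ} {lo hi : ℕ}

theorem max_mul_nonneg (D : IsTreeData X τ lo hi) (a b : ℕ) :
    0 ≤ max (τ a) (τ (b + 1)) * X a b :=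
  mul_nonneg (le_max_of_le_left (D.time_nonneg a)) (D.nonneg a b)

theorem edgeFactor_le_one (D : IsTreeData X τ lo hi) (p : ℕ × ℕ) : edgeFactor X τ p ≤ 1 := by
  have := D.max_mul_nonneg p.1 p.2
  rw [edgeFactor]
  linarith

theorem half_le_edgeFactor (D : IsTreeData X τ lo hi) (p : ℕ × ℕ) : 1 / 2 ≤ edgeFactor X τ p := by
  have h1 : max (τ p.1) (τ (p.2 + 1)) ≤ 1 := max_le (D.time_le_one _) (D.time_le_one _)
  have h2 := mul_le_one₀ h1 (D.nonneg p.1 p.2) (D.le_one p.1 p.2)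
  rw [edgeFactor]
  linarith

theorem prod_le_one (D : IsTreeData X τ lo hi) (s : Finset (ℕ × ℕ)) :
    ∏ p ∈ s, edgeFactor X τ p ≤ 1 :=
  Finset.prod_le_one (fun p _ => le_trans (by norm_num) (D.half_le_edgeFactor p))
    (fun p _ => D.edgeFactor_le_one p)

theorem prod_pos (D : IsTreeData X τ lo hi) (s : Finset (ℕ × ℕ)) :
    0 < ∏ p ∈ s, edgeFactor X τ p :=
  Finset.prod_pos fun p _ => lt_of_lt_of_le (by norm_num) (D.half_le_edgeFactor p)

theorem coordOn_le (D : IsTreeData X τ lo hi) (l r j : ℕ) : coordOn X τ l r j ≤ 1 - τ j :=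
  mul_le_of_le_one_right (sub_nonneg.2 (D.time_le_one j)) (D.prod_le_one _)

theorem coordOn_nonneg (D : IsTreeData X τ lo hi) (l r j : ℕ) : 0 ≤ coordOn X τ l r j :=
  mul_nonneg (sub_nonneg.2 (D.time_le_one j)) (D.prod_pos _).le

/-- The parameters do not decrease from the lower end of an edge to the vertices above it. -/
theorem max_le_of_edge (D : IsTreeData X τ lo hi) {a b j : ℕ} (hX : X a b ≠ 0) (ha : lo ≤ a)
    (haj : a < j) (hjb : j ≤ b) (hb : b < hi) : max (τ a) (τ (b + 1)) ≤ τ j := by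
  have hX' := lt_of_le_of_ne (D.nonneg a b) (Ne.symm hX)
  apply max_le
  · rcases eq_or_lt_of_le ha with rfl | ha'
    · exact D.left j haj (by omega)
    · obtain ⟨c, e, hc, hca, hae, he, hor, hle⟩ := D.lowest a ha' (by omega)
      refine hle j (by omega) ?_
      by_contra hcon
      rcases hor with h | h
      · rcases D.cross c e a b hc hca hae (by omega) hb with h' | h'
        · exact h.ne' h'
        · exact hX h'
      · omega
  · rcases eq_or_lt_of_le (show b + 1 ≤ hi from hb) with rfl | hb'
    · exact D.right j (by omega) (by omega)
    · obtain ⟨c, e, hc, hcb, hbe, he, hor, hle⟩ := D.lowest (b + 1) (by omega) hb'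
      refine hle j ?_ (by omega)
      by_contra hcon
      rcases hor with h | h
      · rcases D.cross a b c e ha (by omega) (by omega) (by omega) he with h' | h'
        · exact hX h'
        · exact h.ne' h'
      · omega

/-- The largest coordinate is `1 - t`, where `t` is the lowest parameter. -/
theorem exists_lowest (D : IsTreeData X τ lo hi) (h : lo + 1 < hi) :
    ∃ j, lo < j ∧ j < hi ∧ (∀ j', lo < j' → j' < hi → τ j ≤ τ j') ∧
      coordOn X τ lo hi j = 1 - τ j := by
  obtain ⟨j, h1, h2, hj⟩ := exists_not_mem_edge h D.cross
  refine ⟨j, h1, h2, ?_, ?_⟩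
  · obtain ⟨a, b, ha, haj, hjb, hb, hor, hle⟩ := D.lowest j h1 h2
    have : a = lo ∧ b + 1 = hi := by
      by_contra hne
      have := hj a b (mem_pairsAt.2 ⟨hne, ha, haj, hjb, hb⟩)
      rcases hor with h | h
      · exact absurd this h.ne'
      · exact hne h
    intro j' h1' h2'
    exact hle j' (by omega) (by omega)
  · rw [coordOn, Finset.prod_eq_one, mul_one]
    rintro ⟨a, b⟩ hab
    simp [edgeFactor, hj a b hab]

/-- Only the positions that belong to the root have the largest coordinate. -/
theorem eq_of_coordOn_eq (D : IsTreeData X τ lo hi) {t : ℝ} (ht : t < 1) {j : ℕ} (htj : t ≤ τ j)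
    (h : coordOn X τ lo hi j = 1 - t) : τ j = t ∧
      ∀ a b, (a, b) ∈ pairsAt lo hi j → max (τ a) (τ (b + 1)) * X a b = 0 := by
  have h1 : τ j = t := le_antisymm (by linarith [D.coordOn_le lo hi j]) htj
  refine ⟨h1, fun a b hab => ?_⟩
  rw [coordOn, h1] at h
  have h2 : ∏ p ∈ pairsAt lo hi j, edgeFactor X τ p = 1 :=
    mul_left_cancel₀ (sub_pos.2 ht).ne' (by rw [h, mul_one])
  rw [← Finset.mul_prod_erase _ _ hab] at h2
  have h3 := D.prod_le_one ((pairsAt lo hi j).erase (a, b))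
  have h4 := D.prod_pos ((pairsAt lo hi j).erase (a, b))
  have h5 := D.edgeFactor_le_one (a, b)
  have h6 := D.half_le_edgeFactor (a, b)
  have h7 : edgeFactor X τ (a, b) = 1 := by nlinarith
  rw [edgeFactor] at h7
  linarith

/-- The maximal intervals on which the coordinates are smaller than their maximum correspond to the
branches of the tree at its root. -/
structure IsBranch (X : ℕ → ℕ → ℝ) (τ : ℕ → ℝ) (lo hi : ℕ) (t : ℝ) (lo' hi' : ℕ) : Prop where
  le : lo ≤ lo'
  lt : lo' + 1 < hi'
  ge : hi' ≤ hi
  left : lo' = lo ∨ (lo < lo' ∧ coordOn X τ lo hi lo' = 1 - t)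
  right : hi' = hi ∨ (hi' < hi ∧ coordOn X τ lo hi hi' = 1 - t)
  ne : ∀ c, lo' < c → c < hi' → coordOn X τ lo hi c ≠ 1 - t
  proper : ¬(lo' = lo ∧ hi' = hi)

section Branch

variable {t : ℝ} {lo' hi' : ℕ}

/-- An edge that is above a position in a branch but not contained in the branch is also above a
position at the root. -/
theorem IsBranch.exists_mem (B : IsBranch X τ lo hi t lo' hi') {a b j : ℕ} (ha : lo ≤ a)
    (haj : a < j) (hjb : j ≤ b) (hb : b < hi) (h1 : lo' < j) (h2 : j < hi')
    (hnot : ¬(lo' ≤ a ∧ b < hi')) : ∃ c, a < c ∧ c ≤ b ∧ coordOn X τ lo hi c = 1 - t := by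
  by_cases h : lo' ≤ a
  · refine ⟨hi', by omega, by omega, ?_⟩
    rcases B.right with h3 | h3
    · omega
    · exact h3.2
  · refine ⟨lo', by omega, by omega, ?_⟩
    rcases B.left with h3 | h3
    · omega
    · exact h3.2

variable (D : IsTreeData X τ lo hi) (ht : t < 1) (hmin : ∀ j, lo < j → j < hi → t ≤ τ j)
  (B : IsBranch X τ lo hi t lo' hi')

include D ht hmin B

/-- The edge below a branch starts at the root. -/
theorem IsBranch.max_eq (hlo : τ lo ≤ t) (hhi : τ hi ≤ t) :
    max (τ lo') (τ (hi' - 1 + 1)) = t := by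
  have e : hi' - 1 + 1 = hi' := by have := B.lt; omega
  rw [e]
  have h1 : τ lo' ≤ t ∧ (lo' = lo ∨ τ lo' = t) := by
    rcases B.left with rfl | h
    · exact ⟨hlo, Or.inl rfl⟩
    · have := (D.eq_of_coordOn_eq ht (hmin lo' h.1 (by have := B.lt; have := B.ge; omega)) h.2).1
      exact ⟨this.le, Or.inr this⟩
  have h2 : τ hi' ≤ t ∧ (hi' = hi ∨ τ hi' = t) := by
    rcases B.right with rfl | h
    · exact ⟨hhi, Or.inl rfl⟩
    · have := (D.eq_of_coordOn_eq ht (hmin hi' (by have := B.lt; have := B.le; omega) h.1) h.2).1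
      exact ⟨this.le, Or.inr this⟩
  apply le_antisymm (max_le h1.1 h2.1)
  rcases h1.2 with h3 | h3
  · rcases h2.2 with h4 | h4
    · exact absurd ⟨h3, h4⟩ B.proper
    · exact h4 ▸ le_max_right _ _
  · exact h3 ▸ le_max_left _ _

theorem IsBranch.coordOn_eq (hlo : τ lo ≤ t) (hhi : τ hi ≤ t) {j : ℕ} (h1 : lo' < j)
    (h2 : j < hi') :
    coordOn X τ lo hi j = (1 - t * X lo' (hi' - 1) / 2) * coordOn X τ lo' hi' j := by
  have hle := B.le
  have hge := B.ge
  rw [coordOn_eq_mul hle h1 h2 hge B.proper, edgeFactor, B.max_eq D ht hmin hlo hhi]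
  intro a b hab hnot
  have hab' := mem_pairsAt.1 hab
  obtain ⟨c, hc1, hc2, hc⟩ := B.exists_mem hab'.2.1 hab'.2.2.1 hab'.2.2.2.1 hab'.2.2.2.2 h1 h2 hnot
  have := (D.eq_of_coordOn_eq ht (hmin c (by omega) (by omega)) hc).2 a b
    (mem_pairsAt.2 ⟨hab'.1, by omega, hc1, hc2, by omega⟩)
  rw [edgeFactor, this]
  norm_num

theorem IsBranch.isTreeData : IsTreeData X τ lo' hi' where
  nonneg := D.nonneg
  le_one := D.le_one
  time_nonneg := D.time_nonneg
  time_le_one := D.time_le_one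
  cross a b c e h1 h2 h3 h4 h5 := D.cross a b c e (B.le.trans h1) h2 h3 h4 (by
    have := B.ge; omega)
  lowest j h1 h2 := by
    have hle := B.le
    have hge := B.ge
    obtain ⟨a, b, ha, haj, hjb, hb, hor, hmn⟩ := D.lowest j (by omega) (by omega)
    by_cases hin : lo' ≤ a ∧ b < hi'
    · exact ⟨a, b, hin.1, haj, hjb, hin.2, hor.imp_right (by omega), hmn⟩
    · obtain ⟨c, hc1, hc2, hc⟩ := B.exists_mem ha haj hjb hb h1 h2 hin
      have h3 := (D.eq_of_coordOn_eq ht (hmin c (by omega) (by omega)) hc).1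
      have h4 := hmn c hc1 hc2
      exact ⟨lo', hi' - 1, le_refl _, h1, by omega, by omega, Or.inr ⟨rfl, by omega⟩,
        fun j' h5 h6 => (h4.trans h3.le).trans (hmin j' (by omega) (by omega))⟩
  short a b h1 h2 h3 h4 h5 h6 := D.short a b (B.le.trans h1) h2 (by have := B.ge; omega) (by
    have := B.le; have := B.ge; omega) h5 h6
  left j h1 h2 := by
    have hle := B.le
    have hge := B.ge
    rcases B.left with rfl | h
    · exact D.left j h1 (by omega)
    · rw [(D.eq_of_coordOn_eq ht (hmin lo' (by omega) (by omega)) h.2).1]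
      exact hmin j (by omega) (by omega)
  right j h1 h2 := by
    have hle := B.le
    have hge := B.ge
    rcases B.right with rfl | h
    · exact D.right j (by omega) h2
    · rw [(D.eq_of_coordOn_eq ht (hmin hi' (by omega) (by omega)) h.2).1]
      exact hmin j (by omega) (by omega)

/-- There is an edge below a branch: otherwise the largest coordinate would occur in the branch. -/
theorem IsBranch.edge_pos : 0 < X lo' (hi' - 1) := by
  have hle := B.le
  have hge := B.ge
  have hlt := B.lt
  have D' := B.isTreeData D ht hmin
  obtain ⟨j, h1, h2, hj⟩ := exists_not_mem_edge hlt D'.cross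
  have key : ∃ a b, lo' ≤ a ∧ a < j ∧ j ≤ b ∧ b < hi' ∧ X a b ≠ 0 := by
    obtain ⟨a, b, ha, haj, hjb, hb, hor, hmn⟩ := D.lowest j (by omega) (by omega)
    by_cases hin : lo' ≤ a ∧ b < hi'
    · refine ⟨a, b, hin.1, haj, hjb, hin.2, ?_⟩
      rcases hor with h | h
      · exact h.ne'
      · have := B.proper
        omega
    · obtain ⟨c, hc1, hc2, hc⟩ := B.exists_mem ha haj hjb hb h1 h2 hin
      have h3 := (D.eq_of_coordOn_eq ht (hmin c (by omega) (by omega)) hc).1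
      have h4 : τ j = t := le_antisymm ((hmn c hc1 hc2).trans h3.le) (hmin j (by omega) (by omega))
      by_contra hno
      push Not at hno
      apply B.ne j h1 h2
      rw [coordOn, h4, Finset.prod_eq_one, mul_one]
      rintro ⟨a, b⟩ hab
      have hab' := mem_pairsAt.1 hab
      by_cases hin : lo' ≤ a ∧ b < hi'
      · simp [edgeFactor, hno a b hin.1 hab'.2.2.1 hab'.2.2.2.1 hin.2]
      · obtain ⟨c, hc1, hc2, hc⟩ := B.exists_mem hab'.2.1 hab'.2.2.1 hab'.2.2.2.1 hab'.2.2.2.2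
          h1 h2 hin
        have := (D.eq_of_coordOn_eq ht (hmin c (by omega) (by omega)) hc).2 a b
          (mem_pairsAt.2 ⟨hab'.1, by omega, hc1, hc2, by omega⟩)
        rw [edgeFactor, this]
        norm_num
  obtain ⟨a, b, ha, haj, hjb, hb, hne⟩ := key
  have hwhole : a = lo' ∧ b + 1 = hi' := by
    by_contra hcon
    exact hne (hj a b (mem_pairsAt.2 ⟨hcon, ha, haj, hjb, hb⟩))
  obtain ⟨rfl, rfl⟩ := hwhole
  exact lt_of_le_of_ne (D.nonneg _ _) (Ne.symm hne)

/-- If the edge below a branch has length less than `1`, then the parameter of the root occurs in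
the branch. -/
theorem IsBranch.short (hlo : τ lo ≤ t) (hhi : τ hi ≤ t) (h1 : X lo' (hi' - 1) < 1) :
    ∃ j, lo' < j ∧ j < hi' ∧ τ j = t := by
  have hle := B.le
  have hge := B.ge
  have hlt := B.lt
  obtain ⟨j, hj1, hj2, hj⟩ := D.short lo' (hi' - 1) hle (by omega) (by omega)
    (by have := B.proper; omega) (B.edge_pos D ht hmin) h1
  rw [B.max_eq D ht hmin hlo hhi] at hj
  exact ⟨j, hj1, by omega, le_antisymm hj (hmin j (by omega) (by omega))⟩

end Branch

/-- The length `l` of an edge with lower parameter `t` and its upper parameter `s` can be recovered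
from the product of their contributions, as `s = t` if `l < 1`. -/
theorem length_eq_of_mul_eq {t s s' l l' : ℝ} (h0 : 0 < t) (h1 : t < 1) (hs : t ≤ s)
    (hs' : t ≤ s') (hl : l ≤ 1) (hl' : l' ≤ 1) (hls : l < 1 → s = t)
    (hls' : l' < 1 → s' = t) (e : (1 - t * l / 2) * (1 - s) = (1 - t * l' / 2) * (1 - s')) :
    l = l' := by
  rcases eq_or_lt_of_le hl with rfl | hlt
  · rcases eq_or_lt_of_le hl' with rfl | hlt'
    · rfl
    · exfalso
      rw [hls' hlt'] at e
      nlinarith [mul_pos h0 (sub_pos.2 hlt'), mul_pos (mul_pos h0 (sub_pos.2 hlt')) (sub_pos.2 h1)]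
  · rcases eq_or_lt_of_le hl' with rfl | hlt'
    · exfalso
      rw [hls hlt] at e
      nlinarith [mul_pos h0 (sub_pos.2 hlt), mul_pos (mul_pos h0 (sub_pos.2 hlt)) (sub_pos.2 h1)]
    · rw [hls hlt, hls' hlt'] at e
      have := mul_right_cancel₀ (sub_pos.2 h1).ne' e
      have h2 : t * l = t * l' := by linarith
      exact mul_left_cancel₀ h0.ne' h2

/-- The coordinates determine the parameters, and the lengths of all edges whose lower parameter is
neither `0` nor `1`. -/
theorem eq_of_coordOn (n : ℕ) : ∀ {X X' : ℕ → ℕ → ℝ} {τ τ' : ℕ → ℝ} {lo hi : ℕ}, hi - lo = n →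
    IsTreeData X τ lo hi → IsTreeData X' τ' lo hi → τ lo = τ' lo → τ hi = τ' hi →
    (∀ j, lo < j → j < hi → coordOn X τ lo hi j = coordOn X' τ' lo hi j) →
    (∀ j, lo < j → j < hi → τ j = τ' j) ∧
      ∀ a b, lo ≤ a → a < b → b < hi → ¬(a = lo ∧ b + 1 = hi) →
        X a b = X' a b ∨ max (τ a) (τ (b + 1)) = 0 ∨ max (τ a) (τ (b + 1)) = 1 := by
  induction n using Nat.strong_induction_on with
  | _ n ih =>
    intro X X' τ τ' lo hi hn D D' hlo hhi heq
    by_cases hsize : lo + 1 < hi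
    swap
    · exact ⟨fun j h1 h2 => by omega, fun a b h1 h2 h3 => by omega⟩
    obtain ⟨j0, hj1, hj2, hjmin, hj0⟩ := D.exists_lowest hsize
    obtain ⟨j0', hj1', hj2', hjmin', hj0'⟩ := D'.exists_lowest hsize
    have htt : τ j0 = τ' j0' := by
      have e1 := heq j0 hj1 hj2
      have e2 := heq j0' hj1' hj2'
      have h3 := D.coordOn_le lo hi j0'
      have h4 := D'.coordOn_le lo hi j0
      have h5 := hjmin j0' hj1' hj2'
      have h6 := hjmin' j0 hj1 hj2
      linarith
    obtain ⟨t, ht⟩ : ∃ t, t = τ j0 := ⟨_, rfl⟩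
    rw [← ht] at hjmin htt hj0
    rw [← htt] at hjmin' hj0'
    have hlo' : τ lo ≤ t := ht ▸ D.left j0 hj1 hj2
    have hhi' : τ hi ≤ t := ht ▸ D.right j0 hj1 hj2
    have ht0 : 0 ≤ t := ht ▸ D.time_nonneg j0
    -- if the lowest parameter is `1`, then all parameters are `1` and there is nothing to determine
    rcases eq_or_lt_of_le (ht ▸ D.time_le_one j0 : t ≤ 1) with ht1 | ht1
    · rw [ht1] at hjmin hjmin'
      have e1 : ∀ j, lo < j → j < hi → τ j = 1 := fun j h1 h2 =>
        le_antisymm (D.time_le_one j) (hjmin j h1 h2)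
      refine ⟨fun j h1 h2 => (e1 j h1 h2).trans
        (le_antisymm (hjmin' j h1 h2) (D'.time_le_one j)), fun a b h1 h2 h3 h4 => ?_⟩
      right; right
      apply le_antisymm (max_le (D.time_le_one _) (D.time_le_one _))
      rcases eq_or_lt_of_le h1 with rfl | h5
      · exact le_max_of_le_right (e1 (b + 1) (by omega) (by omega)).ge
      · exact le_max_of_le_left (e1 a h5 (by omega)).ge
    -- the positions that belong to the lowest vertex are those with the largest coordinate
    have hroot : ∀ j, lo < j → j < hi → coordOn X τ lo hi j = 1 - t → τ j = t ∧ τ' j = t ∧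
        ∀ a b, (a, b) ∈ pairsAt lo hi j → max (τ a) (τ (b + 1)) * X a b = 0 ∧
          max (τ' a) (τ' (b + 1)) * X' a b = 0 := by
      intro j h1 h2 h3
      have h4 := D.eq_of_coordOn_eq ht1 (hjmin j h1 h2) h3
      have h5 := D'.eq_of_coordOn_eq ht1 (hjmin' j h1 h2) (heq j h1 h2 ▸ h3)
      exact ⟨h4.1, h5.1, fun a b hab => ⟨h4.2 a b hab, h5.2 a b hab⟩⟩
    have hbranch : ∀ j, lo < j → j < hi → coordOn X τ lo hi j ≠ 1 - t → ∃ lo' hi',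
        lo' < j ∧ j < hi' ∧ IsBranch X τ lo hi t lo' hi' ∧ IsBranch X' τ' lo hi t lo' hi' := by
      intro j h1 h2 h3
      obtain ⟨lo', hi', h4, h5, h6, h7, h8, h9, h10⟩ :=
        exists_interval (fun c => coordOn X τ lo hi c = 1 - t) h1 h2 h3
      have hp : ¬(lo' = lo ∧ hi' = hi) := by
        rintro ⟨rfl, rfl⟩
        exact h10 j0 hj1 hj2 hj0
      refine ⟨lo', hi', h5, h6, ⟨h4, by omega, h7, h8, h9, h10, hp⟩, ⟨h4, by omega, h7, ?_, ?_,
        fun c hc1 hc2 => ?_, hp⟩⟩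
      · rcases h8 with h | h
        · exact Or.inl h
        · exact Or.inr ⟨h.1, (heq lo' h.1 (by omega)).symm.trans h.2⟩
      · rcases h9 with h | h
        · exact Or.inl h
        · exact Or.inr ⟨h.1, (heq hi' (by omega) h.1).symm.trans h.2⟩
      · rw [← heq c (by omega) (by omega)]
        exact h10 c hc1 hc2
    -- the branches have the same edge below and, by induction, the same data
    have hrec : ∀ lo' hi', IsBranch X τ lo hi t lo' hi' → IsBranch X' τ' lo hi t lo' hi' →
        (X lo' (hi' - 1) = X' lo' (hi' - 1) ∨ t = 0) ∧
        (∀ j, lo' < j → j < hi' → τ j = τ' j) ∧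
        ∀ a b, lo' ≤ a → a < b → b < hi' → ¬(a = lo' ∧ b + 1 = hi') →
          X a b = X' a b ∨ max (τ a) (τ (b + 1)) = 0 ∨ max (τ a) (τ (b + 1)) = 1 := by
      intro lo' hi' B B'
      have hle := B.le
      have hge := B.ge
      have hlt := B.lt
      have hprop := B.proper
      have E := B.isTreeData D ht1 hjmin
      have E' := B'.isTreeData D' ht1 hjmin'
      have hc : ∀ j, lo' < j → j < hi' →
          (1 - t * X lo' (hi' - 1) / 2) * coordOn X τ lo' hi' j =
            (1 - t * X' lo' (hi' - 1) / 2) * coordOn X' τ' lo' hi' j := by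
        intro j h1 h2
        rw [← B.coordOn_eq D ht1 hjmin hlo' hhi' h1 h2,
          ← B'.coordOn_eq D' ht1 hjmin' (hlo ▸ hlo') (hhi ▸ hhi') h1 h2]
        exact heq j (by omega) (by omega)
      have hpos : ∀ {Y : ℕ → ℕ → ℝ}, Y lo' (hi' - 1) ≤ 1 → 0 < 1 - t * Y lo' (hi' - 1) / 2 := by
        intro Y hY
        nlinarith
      have hlen : X lo' (hi' - 1) = X' lo' (hi' - 1) ∨ t = 0 := by
        rcases eq_or_lt_of_le ht0 with h0 | h0
        · exact Or.inr h0.symm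
        left
        -- compare the largest coordinates in the branch
        obtain ⟨i, hi1, hi2, himin, hi0⟩ := E.exists_lowest hlt
        obtain ⟨i', hi1', hi2', himin', hi0'⟩ := E'.exists_lowest hlt
        refine length_eq_of_mul_eq (s := τ i) (s' := τ' i') h0 ht1 (hjmin i (by omega) (by omega))
          (hjmin' i' (by omega) (by omega)) (D.le_one _ _) (D'.le_one _ _) ?_ ?_ ?_
        · intro h
          obtain ⟨j, h1, h2, h3⟩ := B.short D ht1 hjmin hlo' hhi' h
          exact le_antisymm (h3 ▸ himin j h1 h2) (hjmin i (by omega) (by omega))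
        · intro h
          obtain ⟨j, h1, h2, h3⟩ := B'.short D' ht1 hjmin' (hlo ▸ hlo') (hhi ▸ hhi') h
          exact le_antisymm (h3 ▸ himin' j h1 h2) (hjmin' i' (by omega) (by omega))
        · apply le_antisymm
          · rw [← hi0, hc i hi1 hi2]
            exact mul_le_mul_of_nonneg_left ((E'.coordOn_le lo' hi' i).trans
              (by linarith [himin' i hi1 hi2])) (hpos (D'.le_one _ _)).le
          · rw [← hi0', ← hc i' hi1' hi2']
            exact mul_le_mul_of_nonneg_left ((E.coordOn_le lo' hi' i').trans
              (by linarith [himin i' hi1' hi2'])) (hpos (D.le_one _ _)).le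
      refine ⟨hlen, ih (hi' - lo') (by omega) rfl E E' ?_ ?_ ?_⟩
      · rcases B.left with rfl | h
        · exact hlo
        · have := hroot lo' h.1 (by omega) h.2
          rw [this.1, this.2.1]
      · rcases B.right with rfl | h
        · exact hhi
        · have := hroot hi' (by omega) h.1 h.2
          rw [this.1, this.2.1]
      · intro j h1 h2
        have h3 := hc j h1 h2
        have h4 : 1 - t * X lo' (hi' - 1) / 2 = 1 - t * X' lo' (hi' - 1) / 2 := by
          rcases hlen with h | h
          · rw [h]
          · rw [h]; ring
        rw [h4] at h3
        exact mul_left_cancel₀ (hpos (D'.le_one _ _)).ne' h3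
    have htime : ∀ j, lo < j → j < hi → τ j = τ' j := by
      intro j h1 h2
      by_cases h3 : coordOn X τ lo hi j = 1 - t
      · have := hroot j h1 h2 h3
        rw [this.1, this.2.1]
      · obtain ⟨lo', hi', h4, h5, B, B'⟩ := hbranch j h1 h2 h3
        exact (hrec lo' hi' B B').2.1 j h4 h5
    refine ⟨htime, fun a b h1 h2 h3 h4 => ?_⟩
    have htime' : ∀ j, lo ≤ j → j ≤ hi → τ j = τ' j := by
      intro j h5 h6
      rcases eq_or_lt_of_le h5 with rfl | h7
      · exact hlo
      · rcases eq_or_lt_of_le h6 with rfl | h8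
        · exact hhi
        · exact htime j h7 h8
    -- an edge above a position at the root has length `0` or lower parameter `0`; the others lie in
    -- branches
    by_cases hc : ∃ c, a < c ∧ c ≤ b ∧ coordOn X τ lo hi c = 1 - t
    · obtain ⟨c, hc1, hc2, hc⟩ := hc
      obtain ⟨-, -, h5⟩ := hroot c (by omega) (by omega) hc
      have h6 := h5 a b (mem_pairsAt.2 ⟨h4, h1, hc1, hc2, h3⟩)
      rw [← htime' a h1 (by omega), ← htime' (b + 1) (by omega) (by omega)] at h6
      by_cases hz : max (τ a) (τ (b + 1)) = 0
      · exact Or.inr (Or.inl hz)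
      · left
        rw [(mul_eq_zero.1 h6.1).resolve_left hz, (mul_eq_zero.1 h6.2).resolve_left hz]
    · push Not at hc
      obtain ⟨lo', hi', h5, h6, B, B'⟩ := hbranch b (by omega) h3 (hc b h2 (le_refl b))
      have hla : lo' ≤ a := by
        by_contra hcon
        rcases B.left with h | h
        · omega
        · exact hc lo' (by omega) (by omega) h.2
      obtain ⟨h7, -, h8⟩ := hrec lo' hi' B B'
      by_cases hb : a = lo' ∧ b + 1 = hi'
      · obtain ⟨rfl, rfl⟩ := hb
        rcases h7 with h | h
        · exact Or.inl h
        · right; left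
          rw [← h]
          exact B.max_eq D ht1 hjmin hlo' hhi'
      · exact h8 a b hla h2 h6 hb

end IsTreeData

/-! ### The edge lengths and parameters of decorated trees -/

/-- The number of positions in the first `i` blocks. -/
def blockStart {n : ℕ} (k : Fin n → ℕ) (i : ℕ) : ℕ :=
  ∑ i' ∈ Finset.univ.filter (fun i' : Fin n => i'.val < i), k i'

section BlockStart

variable {n m : ℕ} (k : Fin n → ℕ)

theorem blk_val_eq (h : ∑ i, k i = m) (i : Fin n) (r : Fin (k i)) :
    (blk k h ⟨i, r⟩).val = blockStart k i + r.val := blk_val k h i r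

theorem blockStart_zero : blockStart k 0 = 0 := by simp [blockStart]

theorem blockStart_succ (i : Fin n) : blockStart k (i.val + 1) = blockStart k i + k i := by
  have : (Finset.univ.filter fun i' : Fin n => i'.val < i.val + 1) =
      insert i (Finset.univ.filter fun i' : Fin n => i'.val < i.val) := by
    ext a
    simp only [Finset.mem_filter, Finset.mem_univ, true_and, Finset.mem_insert, Fin.ext_iff]
    omega
  rw [blockStart, this, Finset.sum_insert (by simp), add_comm, blockStart]

theorem blockStart_last (h : ∑ i, k i = m) : blockStart k n = m := by
  simp [blockStart, h]

theorem blockStart_mono {i j : ℕ} (hij : i ≤ j) : blockStart k i ≤ blockStart k j := by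
  apply Finset.sum_le_sum_of_subset
  intro a ha
  simp only [Finset.mem_filter, Finset.mem_univ, true_and] at ha ⊢
  omega

theorem blockStart_add_le {i : Fin n} {j : ℕ} (hij : i.val < j) :
    blockStart k i + k i ≤ blockStart k j := by
  rw [← blockStart_succ]
  exact blockStart_mono k hij

theorem blockStart_add_le_sum (h : ∑ i, k i = m) (i : Fin n) : blockStart k i + k i ≤ m := by
  rw [← blockStart_last k h]
  exact blockStart_add_le k i.2

variable {k}

theorem exists_eq_blockStart_add (h : ∑ i, k i = m) {a : ℕ} (ha : a < m) :
    ∃ (i : Fin n) (r : ℕ), r < k i ∧ a = blockStart k i + r := by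
  obtain ⟨⟨i, r⟩, e⟩ := (blk k h).surjective ⟨a, ha⟩
  exact ⟨i, r, r.2, by rw [← blk_val_eq k h, e]⟩

theorem blockStart_add_inj {i j : Fin n} {r s : ℕ} (hr : r < k i) (hs : s < k j)
    (e : blockStart k i + r = blockStart k j + s) : i = j ∧ r = s := by
  rcases lt_trichotomy i j with h | rfl | h
  · have := blockStart_add_le k (i := i) (j := j) h
    omega
  · exact ⟨rfl, by omega⟩
  · have := blockStart_add_le k (i := j) (j := i) h
    omega

theorem le_of_blockStart_add_le {i j : Fin n} {r s : ℕ} (hs : s < k j)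
    (e : blockStart k i + r ≤ blockStart k j + s) : i ≤ j := by
  by_contra hcon
  have := blockStart_add_le k (i := j) (j := i) (not_le.1 hcon)
  omega

/-- The blocks are determined by their starting points. -/
theorem blocks_eq {n' : ℕ} {k' : Fin n' → ℕ} (h : ∑ i, k i = m) (h' : ∑ i, k' i = m)
    (hk : ∀ i, 1 ≤ k i) (hk' : ∀ i, 1 ≤ k' i)
    (e : ∀ a, (∃ i : Fin n, a = blockStart k i) ↔ ∃ i : Fin n', a = blockStart k' i) :
    ∃ hn : n = n', ∀ i : Fin n, k i = k' (Fin.cast hn i) := by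
  have hmono : ∀ {n : ℕ} {k : Fin n → ℕ}, (∀ i, 1 ≤ k i) →
      StrictMono fun i : Fin n => blockStart k i := by
    intro n k hk i j hij
    have := blockStart_add_le k (i := i) (j := j) hij
    have := hk i
    show blockStart k i < blockStart k j
    omega
  have hr : Set.range (fun i : Fin n => blockStart k i) =
      Set.range (fun i : Fin n' => blockStart k' i) := by
    ext a
    simp only [Set.mem_range, eq_comm (b := a)]
    exact e a
  have hn : n = n' := by
    have h1 := Set.ncard_range_of_injective (hmono hk).injective
    have h2 := Set.ncard_range_of_injective (hmono hk').injective
    rw [hr, h2] at h1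
    simpa using h1.symm
  subst hn
  refine ⟨rfl, fun i => ?_⟩
  have key : ∀ i : Fin n, blockStart k i = blockStart k' i :=
    fun i => congrFun (((hmono hk).range_inj (hmono hk')).1 hr) i
  have h1 := blockStart_succ k i
  have h2 := blockStart_succ k' i
  have h3 : blockStart k (i.val + 1) = blockStart k' (i.val + 1) := by
    by_cases hi : i.val + 1 < n
    · exact key ⟨i.val + 1, hi⟩
    · have : i.val + 1 = n := by omega
      rw [this, blockStart_last k h, blockStart_last k' h']
  have h4 := key i
  show k i = k' i
  omega

end BlockStart

/-- The edge lengths of a point of the Stasheff operad, extended by `0`. -/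
noncomputable def natLength {m : ℕ} (x : StasheffSpace m) (a b : ℕ) : ℝ :=
  if h : a < m ∧ b < m then (x.1 ⟨a, h.1⟩ ⟨b, h.2⟩ : ℝ) else 0

section NatLength

variable {n m : ℕ}

theorem natLength_of_lt (x : StasheffSpace m) {a b : ℕ} (ha : a < m) (hb : b < m) :
    natLength x a b = (x.1 ⟨a, ha⟩ ⟨b, hb⟩ : ℝ) := dif_pos ⟨ha, hb⟩

theorem natLength_nonneg (x : StasheffSpace m) (a b : ℕ) : 0 ≤ natLength x a b := by
  rw [natLength]
  split_ifs
  · exact unitInterval.nonneg _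
  · exact le_refl _

theorem natLength_le_one (x : StasheffSpace m) (a b : ℕ) : natLength x a b ≤ 1 := by
  rw [natLength]
  split_ifs
  · exact unitInterval.le_one _
  · exact zero_le_one

theorem natLength_cross (x : StasheffSpace m) {a b c e : ℕ} (h1 : a < c) (h2 : c ≤ b)
    (h3 : b < e) : natLength x a b = 0 ∨ natLength x c e = 0 := by
  by_cases he : e < m
  · rw [natLength_of_lt x (by omega) (by omega), natLength_of_lt x (by omega) he]
    exact (x.2.cross ⟨a, by omega⟩ ⟨b, by omega⟩ ⟨c, by omega⟩ ⟨e, he⟩ h1 h2 h3).imp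
      (fun h => by rw [h]; rfl) (fun h => by rw [h]; rfl)
  · right
    rw [natLength, dif_neg (by omega)]

theorem natLength_whole (x : StasheffSpace m) {a b : ℕ} (ha : a = 0) (hb : b + 1 = m) :
    natLength x a b = 1 := by
  rw [natLength_of_lt x (by omega) (by omega), x.2.whole _ _ ha hb]
  rfl

theorem natLength_comp_same (k : Fin n → ℕ) (h : ∑ i, k i = m) (x : StasheffSpace n)
    (y : ∀ i, StasheffSpace (k i)) (i : Fin n) {r s : ℕ} (hr : r < k i) (hs : s < k i) :
    natLength (stasheff.comp k h x y : StasheffSpace m) (blockStart k i + r) (blockStart k i + s) =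
      natLength (y i) r s := by
  have hle := blockStart_add_le_sum k h i
  refine (natLength_of_lt _ (by omega) (by omega)).trans
    (Eq.trans ?_ (natLength_of_lt _ hr hs).symm)
  have := stasheffComp_same k h x.1 (fun i => (y i).1) i ⟨r, hr⟩ ⟨s, hs⟩
  have e1 : (⟨blockStart k i + r, by omega⟩ : Fin m) = blk k h ⟨i, ⟨r, hr⟩⟩ :=
    Fin.ext (blk_val_eq k h i ⟨r, hr⟩).symm
  have e2 : (⟨blockStart k i + s, by omega⟩ : Fin m) = blk k h ⟨i, ⟨s, hs⟩⟩ :=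
    Fin.ext (blk_val_eq k h i ⟨s, hs⟩).symm
  rw [e1, e2]
  exact congrArg Subtype.val this

theorem natLength_comp_ne (k : Fin n → ℕ) (h : ∑ i, k i = m) (x : StasheffSpace n)
    (y : ∀ i, StasheffSpace (k i)) {i j : Fin n} (hij : i ≠ j) {r s : ℕ} (hr : r < k i)
    (hs : s < k j) :
    natLength (stasheff.comp k h x y : StasheffSpace m) (blockStart k i + r) (blockStart k j + s) =
      if r = 0 ∧ s + 1 = k j then natLength x i j else 0 := by
  have hle := blockStart_add_le_sum k h i
  have hle' := blockStart_add_le_sum k h j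
  refine (natLength_of_lt _ (by omega) (by omega)).trans ?_
  rw [natLength_of_lt x i.2 j.2]
  have := stasheffComp_ne k h x.1 (fun i => (y i).1) i j ⟨r, hr⟩ ⟨s, hs⟩ hij
  have e1 : (⟨blockStart k i + r, by omega⟩ : Fin m) = blk k h ⟨i, ⟨r, hr⟩⟩ :=
    Fin.ext (blk_val_eq k h i ⟨r, hr⟩).symm
  have e2 : (⟨blockStart k j + s, by omega⟩ : Fin m) = blk k h ⟨j, ⟨s, hs⟩⟩ :=
    Fin.ext (blk_val_eq k h j ⟨s, hs⟩).symm
  rw [e1, e2]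
  change ((stasheffComp k h x.1 (fun i => (y i).1) _ _ : unitInterval) : ℝ) = _
  rw [this]
  split_ifs <;> rfl

end NatLength

namespace DTree

section Time

variable {P : NSOperad.{0}}

/-- The function `DTree.cutTime`, extended by `0`. -/
noncomputable def time {m : ℕ} (D : DTree P m) (j : ℕ) : ℝ :=
  if h : j < m then (D.cutTime ⟨j, h⟩ : ℝ) else 0

variable {n m : ℕ}

theorem time_of_lt (D : DTree P m) {j : ℕ} (hj : j < m) : D.time j = (D.cutTime ⟨j, hj⟩ : ℝ) :=
  dif_pos hj

theorem time_of_le (D : DTree P m) {j : ℕ} (hj : m ≤ j) : D.time j = 0 :=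
  dif_neg (not_lt.2 hj)

theorem time_zero (D : DTree P m) : D.time 0 = 0 := by
  rw [time]
  split_ifs
  · rw [cutTime_zero _ _ rfl]; rfl
  · rfl

theorem time_nonneg (D : DTree P m) (j : ℕ) : 0 ≤ D.time j := by
  rw [time]
  split_ifs
  · exact unitInterval.nonneg _
  · exact le_refl _

theorem time_le_one (D : DTree P m) (j : ℕ) : D.time j ≤ 1 := by
  rw [time]
  split_ifs
  · exact unitInterval.le_one _
  · exact zero_le_one

theorem le_time {D : DTree P m} (hD : D.Mono) {s : unitInterval} (hs : D.RootGe s) {j : ℕ}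
    (h0 : 0 < j) (hj : j < m) : (s : ℝ) ≤ D.time j := by
  rw [time_of_lt D hj]
  exact le_cutTime hD hs _ h0.ne'

theorem lt_time {D : DTree P m} (hD : D.Mono) {s : unitInterval} (hs : D.RootGt s) {j : ℕ}
    (h0 : 0 < j) (hj : j < m) : (s : ℝ) < D.time j := by
  rw [time_of_lt D hj]
  exact lt_cutTime hD hs _ h0.ne'

variable (k : Fin n → ℕ) (hn : 2 ≤ n) (h : ∑ i, k i = m) (t : unitInterval) (x : P.X n)
  (c : ∀ i, DTree P (k i))

theorem time_node (i : Fin n) {r : ℕ} (hr : r < k i) :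
    (node k hn h t x c).time (blockStart k i + r) =
      if r = 0 then (if i.val = 0 then 0 else (t : ℝ)) else (c i).time r := by
  have hle := blockStart_add_le_sum k h i
  rw [time_of_lt _ (by omega)]
  have e : (⟨blockStart k i + r, by omega⟩ : Fin m) = blk k h ⟨i, ⟨r, hr⟩⟩ :=
    Fin.ext (blk_val_eq k h i ⟨r, hr⟩).symm
  rw [e, cutTime_node, time_of_lt _ hr]
  split_ifs <;> rfl

theorem time_node_start {i : ℕ} (hi : 0 < i) (hin : i < n) :
    (node k hn h t x c).time (blockStart k i) = t := by
  have := time_node k hn h t x c ⟨i, hin⟩ (r := 0) (c ⟨i, hin⟩).pos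
  rw [if_pos rfl, if_neg hi.ne'] at this
  exact this

theorem time_node_boundary {i : ℕ} (hin : i ≤ n) :
    (node k hn h t x c).time (blockStart k i) = if 0 < i ∧ i < n then (t : ℝ) else 0 := by
  split_ifs with hi
  · exact time_node_start k hn h t x c hi.1 hi.2
  · rcases Nat.eq_zero_or_pos i with rfl | h0
    · rw [blockStart_zero, time_zero]
    · obtain rfl : i = n := by omega
      rw [blockStart_last k h, time_of_le _ (le_refl _)]

theorem time_node_in (i : Fin n) {r : ℕ} (h0 : 0 < r) (hr : r < k i) :
    (node k hn h t x c).time (blockStart k i + r) = (c i).time r := by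
  rw [time_node k hn h t x c i hr, if_neg h0.ne']

theorem time_graft_start (R : DTree P n) (i : ℕ) (hi : i ≤ n) :
    (R.graft k h c).time (blockStart k i) = R.time i := by
  rcases eq_or_lt_of_le hi with rfl | hi
  · rw [blockStart_last k h, time_of_le _ (le_refl _), time_of_le _ (le_refl _)]
  · have h1 := (c ⟨i, hi⟩).pos
    have hle := blockStart_add_le_sum k h ⟨i, hi⟩
    simp only at hle
    rw [time_of_lt _ (by omega), time_of_lt _ hi]
    have e : (⟨blockStart k i, by omega⟩ : Fin m) = blk k h ⟨⟨i, hi⟩, ⟨0, h1⟩⟩ :=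
      Fin.ext (blk_val_eq k h ⟨i, hi⟩ ⟨0, h1⟩).symm
    rw [e, cutTime_graft, if_pos rfl]

theorem time_graft_in (R : DTree P n) (i : Fin n) {r : ℕ} (h0 : 0 < r) (hr : r < k i) :
    (R.graft k h c).time (blockStart k i + r) = (c i).time r := by
  have hle := blockStart_add_le_sum k h i
  rw [time_of_lt _ (by omega)]
  have e : (⟨blockStart k i + r, by omega⟩ : Fin m) = blk k h ⟨i, ⟨r, hr⟩⟩ :=
    Fin.ext (blk_val_eq k h i ⟨r, hr⟩).symm
  rw [e, cutTime_graft, if_neg h0.ne', time_of_lt _ hr]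

variable {k hn h t x c}

/-- The parameter of the bead at the lower end of an edge in a branch is the same in the branch and
in the whole tree. -/
theorem max_time_node_in (hD : (node k hn h t x c).Mono) (i : Fin n) {r s : ℕ} (hrs : r < s)
    (hs : s < k i) (hp : ¬(r = 0 ∧ s + 1 = k i)) :
    max ((node k hn h t x c).time (blockStart k i + r))
      ((node k hn h t x c).time (blockStart k i + s + 1)) =
      max ((c i).time r) ((c i).time (s + 1)) := by
  have hge : ∀ j, 0 < j → j < k i → (t : ℝ) ≤ (c i).time j := fun j =>
    le_time (hD i).2 (hD i).1
  have ht : (0 : ℝ) ≤ t := unitInterval.nonneg t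
  by_cases h1 : r = 0
  · subst h1
    have h2 : s + 1 < k i := by omega
    have h3 := hge (s + 1) (by omega) h2
    rw [add_assoc, time_node_in k hn h t x c i (by omega) h2, time_zero,
      time_node k hn h t x c i (by omega), if_pos rfl, max_eq_right (ht.trans h3)]
    apply max_eq_right
    split_ifs
    · exact ht.trans h3
    · exact h3
  · rw [time_node_in k hn h t x c i (by omega) (by omega)]
    rcases eq_or_lt_of_le (show s + 1 ≤ k i from hs) with h2 | h2
    · rw [add_assoc, h2, ← blockStart_succ, time_node_boundary _ _ _ _ _ _ i.2,
        time_of_le (c i) (le_refl _), max_eq_left (time_nonneg _ _)]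
      apply max_eq_left
      have := hge r (by omega) (by omega)
      split_ifs
      · exact this
      · exact ht.trans this
    · rw [add_assoc, time_node_in k hn h t x c i (by omega) h2]

/-- The lower end of an edge below a union of at least two, but not all, branches is the lowest
bead. -/
theorem max_time_node_cross {i j : ℕ} (hij : i < j) (hj : j ≤ n) (hp : ¬(i = 0 ∧ j = n)) :
    max ((node k hn h t x c).time (blockStart k i)) ((node k hn h t x c).time (blockStart k j)) =
      t := by
  have ht : (0 : ℝ) ≤ t := unitInterval.nonneg t
  rw [time_node_boundary _ _ _ _ _ _ hj, time_node_boundary _ _ _ _ _ _ (by omega)]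
  by_cases h1 : 0 < i
  · rw [if_pos ⟨h1, by omega⟩]
    apply max_eq_left
    split_ifs
    · exact le_refl _
    · exact ht
  · rw [if_neg (by omega), if_pos ⟨by omega, by omega⟩, max_eq_right ht]

end Time

/-- The edge lengths of the composition of a decorated tree. -/
noncomputable def edge {m : ℕ} (D : DTree stasheff m) : ℕ → ℕ → ℝ :=
  natLength (m := m) D.compose

theorem edge_whole {m : ℕ} (D : DTree stasheff m) {a b : ℕ} (ha : a = 0) (hb : b + 1 = m) :
    D.edge a b = 1 := natLength_whole (m := m) D.compose ha hb

/-- The coordinates of a decorated tree. -/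
noncomputable def coord {m : ℕ} (D : DTree stasheff m) (j : ℕ) : ℝ :=
  coordOn D.edge D.time 0 m j

variable {n m : ℕ} {k : Fin n → ℕ} {hn : 2 ≤ n} {h : ∑ i, k i = m} {t : unitInterval}
  {x : stasheff.X n} {c : ∀ i, DTree stasheff (k i)}

theorem edge_node_in (i : Fin n) {r s : ℕ} (hr : r < k i) (hs : s < k i) :
    (node k hn h t x c).edge (blockStart k i + r) (blockStart k i + s) = (c i).edge r s :=
  natLength_comp_same k h x (fun i => (c i).compose) i hr hs

theorem edge_node_cross {i j : Fin n} (hij : i ≠ j) {r s : ℕ} (hr : r < k i) (hs : s < k j) :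
    (node k hn h t x c).edge (blockStart k i + r) (blockStart k j + s) =
      if r = 0 ∧ s + 1 = k j then natLength (m := n) x i j else 0 :=
  natLength_comp_ne k h x (fun i => (c i).compose) hij hr hs

theorem edge_graft_cross (R : DTree stasheff n) {i j : Fin n} (hij : i ≠ j) {r s : ℕ}
    (hr : r < k i) (hs : s < k j) :
    (R.graft k h c).edge (blockStart k i + r) (blockStart k j + s) =
      if r = 0 ∧ s + 1 = k j then R.edge i j else 0 := by
  rw [edge, compose_graft]
  exact natLength_comp_ne k h R.compose (fun i => (c i).compose) hij hr hs

theorem isTreeData {m : ℕ} (D : DTree stasheff m) (hD : D.Mono) :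
    IsTreeData D.edge D.time 0 m where
  nonneg := natLength_nonneg _
  le_one := natLength_le_one _
  time_nonneg := D.time_nonneg
  time_le_one := D.time_le_one
  cross a b c e _ h1 h2 h3 _ := natLength_cross _ h1 h2 h3
  lowest := by
    induction D with
    | leaf h => intro j h1 h2; omega
    | @node n m k hn h t x c ih =>
      intro j h1 h2
      obtain ⟨i, r, hr, rfl⟩ := exists_eq_blockStart_add h h2
      have hle := blockStart_add_le_sum k h i
      by_cases hr0 : r = 0
      · refine ⟨0, m - 1, le_refl _, h1, by omega, by omega, Or.inr ⟨rfl, by omega⟩, ?_⟩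
        intro j' h3 h4
        rw [time_node k hn h t x c i hr, if_pos hr0]
        have h5 := le_time hD (le_refl t) (j := j') (by omega) (by omega)
        split_ifs
        · exact time_nonneg _ _
        · exact h5
      · obtain ⟨a, b, ha, har, hrb, hb, hor, hle'⟩ := ih i (hD i).2 r (by omega) hr
        refine ⟨blockStart k i + a, blockStart k i + b, Nat.zero_le _, by omega, by omega, by omega,
          Or.inl ?_, ?_⟩
        · rw [edge_node_in i (by omega) hb]
          rcases hor with h | h
          · exact h
          · rw [edge_whole _ h.1 h.2]
            exact one_pos
        · intro j' h3 h4
          obtain ⟨s, rfl⟩ := Nat.exists_eq_add_of_le (show blockStart k i ≤ j' by omega)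
          rw [time_node_in k hn h t x c i (by omega) (by omega),
            time_node_in k hn h t x c i (by omega) (by omega)]
          exact hle' s (by omega) (by omega)
  short := by
    induction D with
    | leaf h => intro a b h1 h2; omega
    | @node n m k hn h t x c ih =>
      intro a b _ hab hb hp h1 h2
      obtain ⟨i, r, hr, rfl⟩ := exists_eq_blockStart_add h (hab.trans hb)
      obtain ⟨j, s, hs, rfl⟩ := exists_eq_blockStart_add h hb
      have hij : i ≤ j := le_of_blockStart_add_le hs hab.le
      rcases eq_or_lt_of_le hij with rfl | hij
      · rw [edge_node_in i hr hs] at h1 h2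
        have hp' : ¬(r = 0 ∧ s + 1 = k i) := by
          rintro ⟨h3, h4⟩
          rw [edge_whole _ h3 h4] at h2
          exact lt_irrefl _ h2
        obtain ⟨q, hq1, hq2, hq3⟩ := ih i (hD i).2 r s (Nat.zero_le _) (by omega) hs hp' h1 h2
        refine ⟨blockStart k i + q, by omega, by omega, ?_⟩
        rw [time_node_in k hn h t x c i (by omega) (by omega), max_time_node_in hD i (by omega) hs hp']
        exact hq3
      · rw [edge_node_cross hij.ne hr hs] at h1 h2
        split_ifs at h1 h2 with h3
        · obtain ⟨rfl, h4⟩ := h3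
          have e : blockStart k j + s + 1 = blockStart k (j.val + 1) := by
            rw [blockStart_succ]; omega
          refine ⟨blockStart k (i.val + 1), ?_, ?_, ?_⟩
          · rw [blockStart_succ]; omega
          · have := blockStart_mono k (show i.val + 1 ≤ j from hij)
            omega
          · rw [add_zero, e, max_time_node_cross (by omega) j.2,
              time_node_start _ _ _ _ _ _ (by omega) (by omega)]
            rintro ⟨h5, h6⟩
            exact h2.ne (natLength_whole (m := n) x h5 h6)
        · exact absurd h1 (lt_irrefl _)
  left j _ _ := by rw [time_zero]; exact D.time_nonneg j
  right j _ _ := by rw [time_of_le D (le_refl _)]; exact D.time_nonneg j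

/-- The relation between two trees that have the same parameters, and the same lengths of all edges
whose lower bead has a parameter different from `0` and `1`. Having the same coordinates, being related
by `Rel`, and representing the same point of `B K` are equivalent. -/
def Rel {m : ℕ} (D D' : DTree stasheff m) : Prop :=
  (∀ j, j < m → D.time j = D'.time j) ∧ ∀ a b, a < b → b < m → ¬(a = 0 ∧ b + 1 = m) →
    D.edge a b = D'.edge a b ∨ max (D.time a) (D.time (b + 1)) = 0 ∨
      max (D.time a) (D.time (b + 1)) = 1

theorem Rel.time_eq {D D' : DTree stasheff m} (hr : Rel D D') : D.time = D'.time := by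
  funext j
  by_cases hj : j < m
  · exact hr.1 j hj
  · rw [time_of_le _ (not_lt.1 hj), time_of_le _ (not_lt.1 hj)]

theorem Rel.coord_eq {D D' : DTree stasheff m} (hD : D.Mono) (hD' : D'.Mono) (hr : Rel D D')
    {j : ℕ} (hj : j < m) : D.coord j = D'.coord j := by
  by_cases h1 : D.time j = 1
  · rw [coord, coord, coordOn, coordOn, ← hr.1 j hj, h1]
    ring
  rw [coord, coord, coordOn, coordOn, ← hr.1 j hj]
  congr 1
  refine Finset.prod_congr rfl ?_
  rintro ⟨a, b⟩ hab
  obtain ⟨h2, h3, h4, h5, h6⟩ := mem_pairsAt.1 hab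
  have h7 := hr.2 a b (by omega) h6 (by omega)
  rw [edgeFactor, edgeFactor, ← hr.time_eq]
  rcases h7 with h | h | h
  · rw [h]
  · simp only [h, zero_mul]
  · have key : ∀ E : DTree stasheff m, E.Mono → E.time = D.time → E.edge a b = 0 := by
      intro E hE hEt
      by_contra hne
      have := (E.isTreeData hE).max_le_of_edge hne h3 h4 h5 h6
      rw [hEt, h] at this
      exact h1 (le_antisymm (D.time_le_one j) this)
    simp only [key D hD rfl, key D' hD' hr.time_eq.symm]

theorem rel_of_coord_eq {D D' : DTree stasheff m} (hD : D.Mono) (hD' : D'.Mono)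
    (e : ∀ j, 0 < j → j < m → D.coord j = D'.coord j) : Rel D D' := by
  obtain ⟨h1, h2⟩ := IsTreeData.eq_of_coordOn m (Nat.sub_zero m) (D.isTreeData hD)
    (D'.isTreeData hD') (by rw [time_zero, time_zero])
    (by rw [time_of_le _ (le_refl _), time_of_le _ (le_refl _)]) e
  refine ⟨fun j hj => ?_, fun a b => h2 a b (Nat.zero_le a)⟩
  rcases Nat.eq_zero_or_pos j with rfl | h0
  · rw [time_zero, time_zero]
  · exact h1 j h0 hj

theorem Contraction.rel {D D' : DTree stasheff m} (hc : Contraction D D') : Rel D D' := by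
  refine ⟨fun j hj => ?_, fun a b _ _ _ => Or.inl ?_⟩
  · rw [time_of_lt _ hj, time_of_lt _ hj, hc.cutTime_eq]
  · rw [edge, edge, hc.compose_eq]

theorem Rel.refl (D : DTree stasheff m) : Rel D D :=
  ⟨fun _ _ => rfl, fun _ _ _ _ _ => Or.inl rfl⟩

theorem Rel.symm {D D' : DTree stasheff m} (hr : Rel D D') : Rel D' D := by
  refine ⟨fun j hj => (hr.1 j hj).symm, fun a b h1 h2 h3 => ?_⟩
  rw [← hr.time_eq]
  exact (hr.2 a b h1 h2 h3).imp_left Eq.symm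

theorem Contraction.rel_trans {D D' E : DTree stasheff m} (hc : Contraction D D')
    (hr : Rel D E) : Rel D' E := by
  have h1 : D.time = D'.time := hc.rel.time_eq
  have h2 : D.edge = D'.edge := by rw [edge, edge, hc.compose_eq]
  rw [Rel, ← h1, ← h2]
  exact hr

/-- The relation can be checked on the branches and on the lowest bead; the converse is
`Rel.branches`. -/
theorem rel_node {x' : stasheff.X n} {c' : ∀ i, DTree stasheff (k i)}
    (hD : (node k hn h t x c).Mono) (hx : x = x' ∨ t = 0 ∨ t = 1)
    (hc : ∀ i, Rel (c i) (c' i)) : Rel (node k hn h t x c) (node k hn h t x' c') := by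
  constructor
  · intro j hj
    obtain ⟨i, r, hr, rfl⟩ := exists_eq_blockStart_add h hj
    rw [time_node _ _ _ _ _ _ i hr, time_node _ _ _ _ _ _ i hr, (hc i).1 r hr]
  · intro a b hab hb hp
    obtain ⟨i, r, hr, rfl⟩ := exists_eq_blockStart_add h (hab.trans hb)
    obtain ⟨j, s, hs, rfl⟩ := exists_eq_blockStart_add h hb
    have hij : i ≤ j := le_of_blockStart_add_le hs hab.le
    rcases eq_or_lt_of_le hij with rfl | hij
    · rw [edge_node_in i hr hs, edge_node_in i hr hs]
      by_cases hp' : r = 0 ∧ s + 1 = k i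
      · left
        rw [edge_whole _ hp'.1 hp'.2, edge_whole _ hp'.1 hp'.2]
      · rw [max_time_node_in hD i (by omega) hs hp']
        exact (hc i).2 r s (by omega) hs hp'
    · rw [edge_node_cross hij.ne hr hs, edge_node_cross hij.ne hr hs]
      by_cases h3 : r = 0 ∧ s + 1 = k j
      · obtain ⟨rfl, h4⟩ := h3
        have e : blockStart k j + s + 1 = blockStart k (j.val + 1) := by
          rw [blockStart_succ]; omega
        rw [add_zero, e, max_time_node_cross (by omega) j.2]
        · rcases hx with rfl | rfl | rfl
          · exact Or.inl rfl
          · exact Or.inr (Or.inl rfl)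
          · exact Or.inr (Or.inr rfl)
        · rintro ⟨h5, h6⟩
          apply hp
          rw [h5, blockStart_zero, e, show j.val + 1 = n from h6, blockStart_last k h]
          exact ⟨rfl, rfl⟩
      · left
        rw [if_neg h3, if_neg h3]

theorem Rel.branches {x' : stasheff.X n} {c' : ∀ i, DTree stasheff (k i)}
    (hD : (node k hn h t x c).Mono) (hr : Rel (node k hn h t x c) (node k hn h t x' c')) :
    (x = x' ∨ t = 0 ∨ t = 1) ∧ ∀ i, Rel (c i) (c' i) := by
  have hk : ∀ i, 1 ≤ k i := fun i => (c i).pos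
  constructor
  · by_cases ht : t = 0 ∨ t = 1
    · exact Or.inr ht
    left
    push Not at ht
    have key : ∀ i j : Fin n, i < j → ¬(i.val = 0 ∧ j.val + 1 = n) →
        natLength (m := n) x i j = natLength (m := n) x' i j := by
      intro i j hij hp
      have h1 := blockStart_add_le k (i := i) (j := j) hij
      have h2 := hk i
      have h3 := hk j
      have h4 := blockStart_add_le_sum k h j
      have h5 := hr.2 (blockStart k i + 0) (blockStart k j + (k j - 1)) (by omega) (by omega) (by
        rintro ⟨h6, h7⟩
        apply hp
        constructor
        · by_contra h8
          have := blockStart_add_le k (i := ⟨0, by omega⟩) (j := i) (Nat.pos_of_ne_zero h8)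
          have := hk ⟨0, by omega⟩
          omega
        · by_contra h8
          have h9 := blockStart_add_le_sum k h ⟨j.val + 1, by omega⟩
          have := hk ⟨j.val + 1, by omega⟩
          simp only [blockStart_succ] at h9
          omega)
      rw [edge_node_cross hij.ne (by omega) (by omega), if_pos ⟨rfl, by omega⟩,
        edge_node_cross hij.ne (by omega) (by omega), if_pos ⟨rfl, by omega⟩] at h5
      have e : blockStart k j + (k j - 1) + 1 = blockStart k (j.val + 1) := by
        rw [blockStart_succ]; omega
      rw [e, add_zero, max_time_node_cross (by omega) j.2 hp] at h5
      rcases h5 with h5 | h5 | h5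
      · exact h5
      · exact absurd (Subtype.ext h5) ht.1
      · exact absurd (Subtype.ext h5) ht.2
    change StasheffSpace n at x x'
    apply Subtype.ext
    funext i j
    rcases lt_trichotomy i j with hij | rfl | hij
    · by_cases hp : i.val = 0 ∧ j.val + 1 = n
      · rw [x.2.whole i j hp.1 hp.2, x'.2.whole i j hp.1 hp.2]
      · have := key i j hij hp
        rw [natLength_of_lt _ i.2 j.2, natLength_of_lt _ i.2 j.2] at this
        exact Subtype.ext this
    · rw [x.2.leaf, x'.2.leaf]
    · rw [x.2.off _ _ hij, x'.2.off _ _ hij]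
  · intro i
    have hle := blockStart_add_le_sum k h i
    constructor
    · intro r hri
      rcases Nat.eq_zero_or_pos r with rfl | h0
      · rw [time_zero, time_zero]
      · have := hr.1 (blockStart k i + r) (by omega)
        rwa [time_node_in _ _ _ _ _ _ i h0 hri, time_node_in _ _ _ _ _ _ i h0 hri] at this
    · intro r s hrs hs hp
      have := hr.2 (blockStart k i + r) (blockStart k i + s) (by omega) (by omega) (by
        rintro ⟨h6, h7⟩
        have h8 := lt_of_sum_eq h hn hk i
        omega)
      rwa [edge_node_in i (by omega) hs, edge_node_in i (by omega) hs,
        max_time_node_in hD i hrs hs hp] at this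

end DTree

theorem PTree.Collapse.rel {m : ℕ} {T : PTree m} {p q : T.Cell stasheff} (hpq : T.Collapse p q) :
    DTree.Rel (BRaw.tree ⟨T, p⟩) (BRaw.tree ⟨T, q⟩) := by
  induction T with
  | leaf h => exact .refl _
  | node k hn h c ih =>
    have hmono := (BRaw.mono (⟨.node k hn h c, p⟩ : BRaw stasheff _))
    have e := hpq.time_eq (PTree.rootBead k hn h c)
    have hp := (PTree.monotone_node_iff.1 p.2.2).2
    have hq := (PTree.monotone_node_iff.1 q.2.2).2
    have key := DTree.rel_node (x' := q.1 (PTree.rootBead k hn h c))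
      (c' := fun i => BRaw.tree ⟨c i, fun b => q.1 (PTree.branchBead k hn h c i b),
        ⟨fun b => q.2.1 (PTree.branchBead k hn h c i b), hq i⟩⟩) hmono ?_
      (fun i => ih i (p := ⟨fun b => p.1 (PTree.branchBead k hn h c i b),
        ⟨fun b => p.2.1 (PTree.branchBead k hn h c i b), hp i⟩⟩)
        (fun b => hpq (PTree.branchBead k hn h c i b)))
    · change DTree.Rel _ (DTree.node k hn h (q.2.1 (PTree.rootBead k hn h c)) _ _)
      rw [← e]
      exact key
    · rcases hpq (PTree.rootBead k hn h c) with h | h | h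
      · exact Or.inl h.2
      · exact Or.inr (Or.inl h.1)
      · exact Or.inr (Or.inr h.1)

/-! ### Trees with the same coordinates represent the same point -/

namespace DTree

variable {n m : ℕ} {k : Fin n → ℕ} {hn : 2 ≤ n} {h : ∑ i, k i = m} {t : unitInterval}

/-- If all other beads have larger parameters than the lowest bead, then its blocks are separated by
the positions with the smallest parameter. -/
theorem time_node_of_start {P : NSOperad.{0}} {x : P.X n} {c : ∀ i, DTree P (k i)}
    (hD : (node k hn h t x c).Mono) (hc : ∀ i, (c i).RootGt t) (a : ℕ) :
    (∃ i : Fin n, a = blockStart k i) ↔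
      a = 0 ∨ (0 < a ∧ a < m ∧ (node k hn h t x c).time a = t) := by
  constructor
  · rintro ⟨i, rfl⟩
    have h1 := (c i).pos
    have h2 := blockStart_add_le_sum k h i
    rcases Nat.eq_zero_or_pos i.val with h0 | h0
    · left
      rw [h0, blockStart_zero]
    · right
      have h3 := blockStart_add_le k (i := ⟨0, by omega⟩) (j := i) h0
      have h4 := (c ⟨0, by omega⟩).pos
      exact ⟨by omega, by omega, time_node_start _ _ _ _ _ _ h0 i.2⟩
  · rintro (rfl | ⟨h0, ha, e⟩)
    · exact ⟨⟨0, by omega⟩, (blockStart_zero k).symm⟩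
    · obtain ⟨i, r, hr, rfl⟩ := exists_eq_blockStart_add h ha
      rcases Nat.eq_zero_or_pos r with rfl | hr0
      · exact ⟨i, rfl⟩
      · rw [time_node_in _ _ _ _ _ _ i hr0 hr] at e
        exact absurd e (lt_time (hD i).2 (hc i) hr0 hr).ne'

theorem le_of_time_eq {P : NSOperad.{0}} {x : P.X n} {c : ∀ i, DTree P (k i)}
    {D : DTree P m} (hD : D.Mono) {s : unitInterval} (hs : D.RootGe s)
    (e : D.time = (node k hn h t x c).time) : s ≤ t := by
  have h1 := (c ⟨1, hn⟩).pos
  have h2 := blockStart_add_le_sum k h ⟨1, hn⟩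
  have h3 := blockStart_add_le k (i := ⟨0, by omega⟩) (j := 1) one_pos
  have h4 := (c ⟨0, by omega⟩).pos
  have h5 := le_time hD hs (j := blockStart k 1) (by omega) (by simp only at h2; omega)
  rw [e, time_node_start _ _ _ _ _ _ one_pos hn] at h5
  exact h5

end DTree

/-- Trees with the same parameters and the same relevant lengths represent the same point: after the
contraction of all edges between beads with the lowest parameter, the parameters determine the blocks
of the lowest bead, and the relation passes to the branches. -/
theorem BSpace.mk_eq_of_rel {m : ℕ} {p q : BRaw stasheff m} (hr : DTree.Rel p.tree q.tree) :
    mk p = mk q := by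
  induction m using Nat.strong_induction_on with
  | _ m ih =>
    obtain ⟨D, eD⟩ : ∃ D, D = p.tree := ⟨_, rfl⟩
    obtain ⟨D', eD'⟩ : ∃ D, D = q.tree := ⟨_, rfl⟩
    have hD : D.Mono := eD ▸ p.mono
    have hD' : D'.Mono := eD' ▸ q.mono
    rw [← eD, ← eD'] at hr
    cases D with
    | leaf h1 =>
      cases D' with
      | leaf h1 => exact mk_eq_of_tree_eq (eD ▸ eD')
      | node k hn h t x c =>
        have := le_of_sum_eq h (fun i => (c i).pos)
        omega
    | @node n _ k hn h t x c =>
      cases D' with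
      | leaf h1 =>
        have := le_of_sum_eq h (fun i => (c i).pos)
        omega
      | @node n' _ k' hn' h' t' x' c' =>
        obtain ⟨n, k, hn, h, x, c, hcon, hgt, hmono⟩ := DTree.exists_contraction_strict k hn h t x c hD
        obtain ⟨n', k', hn', h', x', c', hcon', hgt', hmono'⟩ :=
          DTree.exists_contraction_strict k' hn' h' t' x' c' hD'
        have hr' := (hcon'.rel_trans (hcon.rel_trans hr).symm).symm
        obtain rfl : t = t' := le_antisymm
          (DTree.le_of_time_eq hmono (le_refl t) hr'.time_eq)
          (DTree.le_of_time_eq hmono' (le_refl t') hr'.time_eq.symm)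
        obtain ⟨rfl, hk⟩ := blocks_eq h h' (fun i => (c i).pos) (fun i => (c' i).pos) fun a => by
          rw [DTree.time_node_of_start hmono hgt, DTree.time_node_of_start hmono' hgt', hr'.time_eq]
        obtain rfl : k = k' := funext hk
        obtain ⟨hx, hc⟩ := hr'.branches hmono
        choose r hr using fun i => BRaw.exists_tree_eq (c i) (hmono i).2
        choose r' hr'' using fun i => BRaw.exists_tree_eq (c' i) (hmono' i).2
        have e1 : mk p = mk (.node k hn h t x r fun i => (hr i).symm ▸ (hmono i).1) := by
          apply mk_eq_of_contraction
          rw [← eD, BRaw.tree_node]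
          simpa only [hr] using hcon
        have e2 : mk q = mk (.node k hn' h' t x' r' fun i => (hr'' i).symm ▸ (hmono' i).1) := by
          apply mk_eq_of_contraction
          rw [← eD', BRaw.tree_node]
          simpa only [hr''] using hcon'
        rw [e1, e2]
        refine mk_node_eq k hn h t x x' hx r r' _ _ fun i =>
          ih (k i) (lt_of_sum_eq h hn (fun i => (c i).pos) i) ?_
        rw [hr, hr'']
        exact hc i

/-! ### The coordinates of graftings -/

theorem coordOn_shift {X X' : ℕ → ℕ → ℝ} {τ τ' : ℕ → ℝ} {s L j : ℕ} (hτ : τ (s + j) = τ' j)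
    (hf : ∀ a b, (a, b) ∈ pairsAt 0 L j →
      edgeFactor X τ (s + a, s + b) = edgeFactor X' τ' (a, b)) :
    coordOn X τ s (s + L) (s + j) = coordOn X' τ' 0 L j := by
  rw [coordOn, coordOn, hτ]
  congr 1
  symm
  refine Finset.prod_of_injOn (fun p : ℕ × ℕ => (s + p.1, s + p.2)) ?_ ?_ ?_ ?_
  · rintro ⟨a, b⟩ - ⟨a', b'⟩ - e
    simp only [Prod.mk.injEq] at e ⊢
    omega
  · rintro ⟨a, b⟩ hab
    have := mem_pairsAt.1 (Finset.mem_coe.1 hab)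
    exact Finset.mem_coe.2 (mem_pairsAt.2 (by omega))
  · rintro ⟨a, b⟩ hab hnot
    have := mem_pairsAt.1 hab
    refine absurd ⟨(a - s, b - s), Finset.mem_coe.2 (mem_pairsAt.2 (by omega)), ?_⟩ hnot
    simp only [Prod.mk.injEq]
    omega
  · rintro ⟨a, b⟩ hab
    exact (hf a b hab).symm

namespace DTree

theorem coord_nonneg {m : ℕ} {D : DTree stasheff m} (hD : D.Mono) (j : ℕ) : 0 ≤ D.coord j :=
  (D.isTreeData hD).coordOn_nonneg 0 m j

theorem coord_le {m : ℕ} {D : DTree stasheff m} (hD : D.Mono) (j : ℕ) :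
    D.coord j ≤ 1 - D.time j := (D.isTreeData hD).coordOn_le 0 m j

theorem coord_le_one {m : ℕ} {D : DTree stasheff m} (hD : D.Mono) (j : ℕ) : D.coord j ≤ 1 :=
  (coord_le hD j).trans (sub_le_self _ (D.time_nonneg j))

section Node

variable {n m : ℕ} {k : Fin n → ℕ} {hn : 2 ≤ n} {h : ∑ i, k i = m} {t : unitInterval}
  {x : stasheff.X n} {c : ∀ i, DTree stasheff (k i)}

/-- An edge that does not belong to a branch has its lower end at the lowest bead, if its parameter
is minimal. -/
theorem max_time_of_cross {i j : Fin n} (hij : i < j) {r s : ℕ} (hr : r < k i) (hs : s < k j)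
    (hp : ¬(blockStart k i + r = 0 ∧ blockStart k j + s + 1 = m))
    (hne : (node k hn h t x c).edge (blockStart k i + r) (blockStart k j + s) ≠ 0) :
    max ((node k hn h t x c).time (blockStart k i + r))
      ((node k hn h t x c).time (blockStart k j + s + 1)) = t := by
  rw [edge_node_cross hij.ne hr hs] at hne
  split_ifs at hne with h3
  · obtain ⟨rfl, h4⟩ := h3
    have e : blockStart k j + s + 1 = blockStart k (j.val + 1) := by
      rw [blockStart_succ]; omega
    rw [add_zero, e, max_time_node_cross (by omega) j.2]
    rintro ⟨h5, h6⟩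
    apply hp
    rw [h5, blockStart_zero, e, show j.val + 1 = n from h6, blockStart_last k h]
    exact ⟨rfl, rfl⟩
  · exact absurd rfl hne

/-- The coordinates inside a block are those of the branch, up to a common factor. -/
theorem coordOn_node_block (hD : (node k hn h t x c).Mono) (i : Fin n) {r : ℕ} (h0 : 0 < r)
    (hr : r < k i) :
    coordOn (node k hn h t x c).edge (node k hn h t x c).time (blockStart k i)
      (blockStart k i + k i) (blockStart k i + r) = (c i).coord r := by
  apply coordOn_shift
  · exact time_node_in _ _ _ _ _ _ i h0 hr
  · intro a b hab
    have hab' := mem_pairsAt.1 hab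
    rw [edgeFactor, edgeFactor]
    simp only
    rw [max_time_node_in hD i (by omega) hab'.2.2.2.2 hab'.1, edge_node_in i (by omega)
      hab'.2.2.2.2]

theorem edgeFactor_cross_zero {a b : ℕ} (hn : 2 ≤ n) (h : ∑ i, k i = m) {i j : Fin n}
    (hij : i < j) {r s : ℕ} (hr : r < k i)
    (hs : s < k j) (ha : a = blockStart k i + r) (hb : b = blockStart k j + s)
    (hp : ¬(a = 0 ∧ b + 1 = m)) :
    edgeFactor (node k hn h 0 x c).edge (node k hn h 0 x c).time (a, b) = 1 := by
  subst ha hb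
  rw [edgeFactor]
  by_cases hne : (node k hn h 0 x c).edge (blockStart k i + r) (blockStart k j + s) = 0
  · simp only [hne]
    norm_num
  · have := max_time_of_cross hij hr hs hp hne
    simp only [this]
    norm_num

/-- Grafting to a corolla with parameter `0` gives coordinates `1` between the blocks. Together with
`coord_node_zero_in` this is the left action on cubes. -/
theorem coord_node_zero_start {i : ℕ} (hi : 0 < i) (hin : i < n) :
    (node k hn h 0 x c).coord (blockStart k i) = 1 := by
  rw [coord, coordOn, time_node_start _ _ _ _ _ _ hi hin, Finset.prod_eq_one]
  · simp
  · rintro ⟨a, b⟩ hab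
    obtain ⟨h1, -, h2, h3, h4⟩ := mem_pairsAt.1 hab
    obtain ⟨i', r, hr, rfl⟩ := exists_eq_blockStart_add h (show a < m by omega)
    obtain ⟨j', s, hs, rfl⟩ := exists_eq_blockStart_add h h4
    refine edgeFactor_cross_zero hn h ?_ hr hs rfl rfl h1
    have h5 : i'.val < i := by
      by_contra hcon
      have := blockStart_mono k (not_lt.1 hcon)
      omega
    have h6 : i ≤ j'.val := by
      by_contra hcon
      have := blockStart_add_le k (not_le.1 hcon)
      omega
    exact Fin.lt_def.2 (lt_of_lt_of_le h5 h6)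

theorem coord_node_zero_in (hD : (node k hn h 0 x c).Mono) (i : Fin n) {r : ℕ} (h0 : 0 < r)
    (hr : r < k i) : (node k hn h 0 x c).coord (blockStart k i + r) = (c i).coord r := by
  have hlt := lt_of_sum_eq h hn (fun i => (c i).pos) i
  have hle := blockStart_add_le_sum k h i
  have key : ∀ a b, (a, b) ∈ pairsAt 0 m (blockStart k i + r) →
      ¬(blockStart k i ≤ a ∧ b + 1 < blockStart k i + k i) →
      ¬(blockStart k i < a ∧ b < blockStart k i + k i) →
      edgeFactor (node k hn h 0 x c).edge (node k hn h 0 x c).time (a, b) = 1 := by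
    intro a b hab hnot hnot'
    obtain ⟨h1, -, h2, h3, h4⟩ := mem_pairsAt.1 hab
    by_cases hb : a = blockStart k i ∧ b + 1 = blockStart k i + k i
    · rw [edgeFactor]
      simp only
      rw [hb.2, hb.1, ← blockStart_succ, max_time_node_cross (by omega) i.2 (by
        rintro ⟨h5, h6⟩
        have h7 := blockStart_succ k i
        rw [show i.val + 1 = n from h6, blockStart_last k h] at h7
        exact h1 ⟨by rw [hb.1, h5, blockStart_zero], hb.2.trans h7.symm⟩)]
      norm_num
    · obtain ⟨i', r', hr', rfl⟩ := exists_eq_blockStart_add h (show a < m by omega)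
      obtain ⟨j', s, hs, rfl⟩ := exists_eq_blockStart_add h h4
      have h5 : i' ≤ j' := le_of_blockStart_add_le (r := r') hs (by omega)
      rcases eq_or_lt_of_le h5 with rfl | h5
      · have h6 : i' ≤ i := le_of_blockStart_add_le (s := r) hr h2.le
        have h7 : i ≤ i' := le_of_blockStart_add_le (r := r) hs h3
        obtain rfl := le_antisymm h6 h7
        omega
      · exact edgeFactor_cross_zero hn h h5 hr' hs rfl rfl h1
  rw [coord, coordOn_eq_mul (lo' := blockStart k i) (hi' := blockStart k i + k i) (Nat.zero_le _)
    (by omega) (by omega) hle (by omega), coordOn_node_block hD i h0 hr, key, one_mul]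
  · exact mem_pairsAt.2 (by omega)
  · omega
  · omega
  · intro a b hab hnot
    exact key a b hab (by omega) (by omega)

end Node

section Graft

variable {n m : ℕ} {k : Fin n → ℕ} {h : ∑ i, k i = m} (R : DTree stasheff n)
  (c : ∀ i, DTree stasheff (k i))

/-- Between the blocks, grafting does not change the coordinates. Together with `coord_graft_in` this is
the right action on cubes if the corollas with parameter `1` are grafted. -/
theorem coord_graft_start {i : ℕ} (hin : i < n) :
    (R.graft k h c).coord (blockStart k i) = R.coord i := by
  have hpos : ∀ i, 1 ≤ k i := fun i => (c i).pos
  rw [coord, coord, coordOn, coordOn, time_graft_start _ _ _ _ _ hin.le]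
  congr 1
  symm
  have hlast : ∀ j : Fin n, blockStart k j + (k j - 1) + 1 = blockStart k (j.val + 1) := by
    intro j
    have := hpos j
    rw [blockStart_succ]; omega
  have hmono : ∀ {a b : ℕ}, b ≤ n → a < b → blockStart k a < blockStart k b := by
    intro a b hb hab
    have := blockStart_add_le k (i := ⟨a, by omega⟩) (j := b) hab
    have := hpos ⟨a, by omega⟩
    simp only at *
    omega
  have hmono' : ∀ {a b : ℕ}, a ≤ n → blockStart k a < blockStart k b → a < b := by
    intro a b ha hab
    by_contra hcon
    have := blockStart_mono k (not_lt.1 hcon)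
    omega
  -- the edges above a position between two blocks are edges of `R`: their sets of leaves are unions of
  -- blocks
  refine Finset.prod_of_injOn
    (fun p : ℕ × ℕ => (blockStart k p.1, blockStart k (p.2 + 1) - 1)) ?_ ?_ ?_ ?_
  · rintro ⟨a, b⟩ hab ⟨a', b'⟩ hab' e
    have h1 := mem_pairsAt.1 (Finset.mem_coe.1 hab)
    have h2 := mem_pairsAt.1 (Finset.mem_coe.1 hab')
    simp only [Prod.mk.injEq] at e ⊢
    have h3 := hlast ⟨b, by omega⟩
    have h4 := hlast ⟨b', by omega⟩
    simp only at h3 h4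
    constructor
    · rcases lt_trichotomy a a' with h5 | h5 | h5
      · have := hmono (by omega) h5
        omega
      · exact h5
      · have := hmono (by omega) h5
        omega
    · rcases lt_trichotomy b b' with h5 | h5 | h5
      · have := hmono (a := b + 1) (b := b' + 1) (by omega) (by omega)
        omega
      · exact h5
      · have := hmono (a := b' + 1) (b := b + 1) (by omega) (by omega)
        omega
  · rintro ⟨a, b⟩ hab
    obtain ⟨h1, -, h2, h3, h4⟩ := mem_pairsAt.1 (Finset.mem_coe.1 hab)
    have h5 := hlast ⟨b, by omega⟩
    simp only at h5
    have h6 := hmono (a := i) (b := b + 1) (by omega) (by omega)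
    have h7 := hmono (by omega) h2
    have h8 := blockStart_mono k (show b + 1 ≤ n by omega)
    rw [blockStart_last k h] at h8
    refine Finset.mem_coe.2 (mem_pairsAt.2 ⟨?_, Nat.zero_le _, h7, by simp only; omega,
      by simp only; omega⟩)
    rintro ⟨h9, h10⟩
    apply h1
    constructor
    · by_contra h11
      have := hmono (a := 0) (b := a) (by omega) (by omega)
      simp only at h9
      omega
    · by_contra h11
      have := hmono (a := b + 1) (b := n) (le_refl _) (by omega)
      rw [blockStart_last k h] at this
      simp only at h10
      omega
  · rintro ⟨a, b⟩ hab hnot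
    obtain ⟨h1, -, h2, h3, h4⟩ := mem_pairsAt.1 hab
    obtain ⟨i', r, hr, rfl⟩ := exists_eq_blockStart_add h (show a < m by omega)
    obtain ⟨j', s, hs, rfl⟩ := exists_eq_blockStart_add h h4
    have h5 : i'.val < i := hmono' (by omega) (by omega)
    have h6 : i ≤ j'.val := by
      by_contra hcon
      have := blockStart_add_le k (not_le.1 hcon)
      omega
    have hij : i' ≠ j' := by rintro rfl; omega
    rw [edgeFactor]
    simp only
    rw [edge_graft_cross R hij hr hs, if_neg]
    · norm_num
    · rintro ⟨rfl, h7⟩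
      have h8 := hlast j'
      refine hnot ⟨(i'.val, j'.val), Finset.mem_coe.2 (mem_pairsAt.2 ⟨?_, Nat.zero_le _, h5, h6,
        j'.2⟩), ?_⟩
      · rintro ⟨h9, h10⟩
        apply h1
        rw [h9, blockStart_zero]
        rw [h10, blockStart_last k h] at h8
        omega
      · simp only [Prod.mk.injEq]
        omega
  · rintro ⟨a, b⟩ hab
    obtain ⟨h1, -, h2, h3, h4⟩ := mem_pairsAt.1 hab
    have h5 := hlast ⟨b, h4⟩
    simp only at h5
    have h6 := hpos ⟨b, h4⟩
    have e1 : blockStart k (b + 1) - 1 = blockStart k b + (k ⟨b, h4⟩ - 1) := by omega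
    have e2 : blockStart k b + (k ⟨b, h4⟩ - 1) + 1 = blockStart k (b + 1) := by omega
    rw [edgeFactor, edgeFactor]
    simp only
    rw [e1, e2, time_graft_start _ _ _ _ _ (show b + 1 ≤ n from h4),
      time_graft_start _ _ _ _ _ (show a ≤ n by omega)]
    have := edge_graft_cross (h := h) (c := c) R (i := ⟨a, by omega⟩) (j := ⟨b, h4⟩)
      (by intro e; have := Fin.mk.inj e; omega) (r := 0) (s := k ⟨b, h4⟩ - 1)
      (hpos _) (by omega)
    rw [if_pos ⟨rfl, by omega⟩] at this
    simp only [add_zero] at this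
    rw [this]

theorem coord_graft_in {i : Fin n} {r : ℕ} (h0 : 0 < r) (hr : r < k i) (hc : (c i).time r = 1) :
    (R.graft k h c).coord (blockStart k i + r) = 0 := by
  rw [coord, coordOn, time_graft_in _ _ _ _ _ h0 hr, hc, sub_self, zero_mul]

end Graft

theorem time_corolla_one {P : NSOperad.{0}} {k : ℕ} (hk : 1 ≤ k) (y : P.X k) {r : ℕ} (h0 : 0 < r)
    (hr : r < k) : (corolla hk 1 y).time r = 1 := by
  rw [time_of_lt _ hr, cutTime_corolla hk 1 y _ h0.ne']
  rfl

end DTree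

/-! ### Trees with prescribed coordinates -/

/-- The corolla with `n` leaves as a point of the Stasheff operad. -/
def StasheffSpace.corolla (n : ℕ) (hn : 1 ≤ n) : StasheffSpace n :=
  ⟨fun a b => if a = b ∨ (a.val = 0 ∧ b.val + 1 = n) then 1 else 0, hn, fun a b hab => by
      rw [if_neg]; omega, fun a => if_pos (Or.inl rfl), fun a b ha hb => if_pos (Or.inr ⟨ha, hb⟩),
    fun a b c e h1 h2 h3 => Or.inl (if_neg (by omega))⟩

/-- Edge lengths may be decreased. -/
def StasheffSpace.scale {n : ℕ} (x : StasheffSpace n) (s : Fin n → Fin n → unitInterval)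
    (h1 : ∀ a, s a a = 1) (h2 : ∀ a b, a.val = 0 → b.val + 1 = n → s a b = 1) :
    StasheffSpace n :=
  ⟨fun a b => x.1 a b * s a b, x.2.pos, fun a b hab => by rw [x.2.off a b hab, zero_mul],
    fun a => by rw [x.2.leaf, h1, one_mul], fun a b ha hb => by
      rw [x.2.whole a b ha hb, h2 a b ha hb, one_mul], fun a b c e hac hcb hbe =>
      (x.2.cross a b c e hac hcb hbe).imp (fun h => by rw [h, zero_mul])
        (fun h => by rw [h, zero_mul])⟩

theorem StasheffSpace.natLength_scale {n : ℕ} (x : StasheffSpace n)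
    (s : Fin n → Fin n → unitInterval) (h1 : ∀ a, s a a = 1)
    (h2 : ∀ a b, a.val = 0 → b.val + 1 = n → s a b = 1) (a b : Fin n) :
    natLength (x.scale s h1 h2) a b = natLength x a b * s a b := by
  rw [natLength_of_lt _ a.2 b.2, natLength_of_lt _ a.2 b.2]
  rfl

namespace DTree

/-- The parameter of the lowest bead is determined by the largest coordinate. -/
theorem rootGe_of_coord_le {m : ℕ} {D : DTree stasheff m} (hD : D.Mono) {s : unitInterval}
    (hs : ∀ j, 0 < j → j < m → D.coord j ≤ 1 - s) : D.RootGe s := by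
  cases D with
  | leaf h => trivial
  | node k hn h t x c =>
    have h1 := (c ⟨1, hn⟩).pos
    have h2 := blockStart_add_le_sum k h ⟨1, hn⟩
    have h3 := blockStart_add_le k (i := ⟨0, by omega⟩) (j := 1) one_pos
    have h4 := (c ⟨0, by omega⟩).pos
    simp only at h2
    obtain ⟨j, hj0, hj, hmin, e⟩ := ((node k hn h t x c).isTreeData hD).exists_lowest (by omega)
    have h5 := hmin (blockStart k 1) (by omega) (by omega)
    rw [time_node_start _ _ _ _ _ _ one_pos hn] at h5
    have h6 := hs j hj0 hj
    rw [coord, e] at h6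
    exact Subtype.coe_le_coe.1 (by linarith)

/-- The lengths of the edges that start at the lowest bead may be decreased, if each of the branches
concerned contains another bead with the same parameter. -/
theorem exists_scale {n m : ℕ} {k : Fin n → ℕ} {hn : 2 ≤ n} {h : ∑ i, k i = m}
    {t : unitInterval} {x : stasheff.X n} {c : ∀ i, DTree stasheff (k i)}
    (hD : (node k hn h t x c).Mono) (s : ℕ → ℕ → unitInterval) (hs : s 0 (m - 1) = 1)
    (hst : ∀ a b, a ≤ b → b < m → s a b ≠ 1 →
      ∃ j, a < j ∧ j ≤ b ∧ (node k hn h t x c).time j = t) :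
    ∃ D : DTree stasheff m, D.Mono ∧ D.time = (node k hn h t x c).time ∧
      ∀ a b, a < b → b < m → D.edge a b = (node k hn h t x c).edge a b * s a b := by
  obtain ⟨n', k', hn', h', x', c', hcon, hgt, hmono⟩ := exists_contraction_strict k hn h t x c hD
  have etime := hcon.rel.time_eq
  have eedge : (node k hn h t x c).edge = (node k' hn' h' t x' c').edge := by
    rw [edge, edge, hcon.compose_eq]
  rw [etime] at hst ⊢
  rw [eedge]
  have hpos : ∀ i, 1 ≤ k' i := fun i => (c' i).pos
  have hblock : ∀ (i : Fin n') (a b : ℕ), a ≤ b → b < k' i →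
      s (blockStart k' i + a) (blockStart k' i + b) = 1 := by
    intro i a b hab hb
    by_contra hcon
    have hle := blockStart_add_le_sum k' h' i
    obtain ⟨j, h1, h2, h3⟩ := hst _ _ (by omega) (by omega) hcon
    obtain ⟨r, rfl⟩ := Nat.exists_eq_add_of_le (show blockStart k' i ≤ j by omega)
    rw [time_node_in _ _ _ _ _ _ i (by omega) (by omega)] at h3
    exact (lt_time (hmono i).2 (hgt i) (by omega) (by omega)).ne' h3
  have hleaf : ∀ a : Fin n', s (blockStart k' a) (blockStart k' (a.val + 1) - 1) = 1 := by
    intro a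
    have := hblock a 0 (k' a - 1) (by omega) (by have := hpos a; omega)
    rw [blockStart_succ, Nat.add_sub_assoc (hpos a)]
    exact this
  have hwhole : ∀ a b : Fin n', a.val = 0 → b.val + 1 = n' →
      s (blockStart k' a) (blockStart k' (b.val + 1) - 1) = 1 := by
    intro a b ha hb
    rw [ha, hb, blockStart_zero, blockStart_last k' h', hs]
  obtain ⟨x2, hx2⟩ : ∃ x2 : stasheff.X n', ∀ i j : Fin n', natLength (m := n') x2 i j =
      natLength (m := n') x' i j * s (blockStart k' i) (blockStart k' (j.val + 1) - 1) :=
    ⟨StasheffSpace.scale (x' : StasheffSpace n')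
      (fun i j => s (blockStart k' i) (blockStart k' (j.val + 1) - 1)) hleaf hwhole,
      StasheffSpace.natLength_scale _ _ hleaf hwhole⟩
  refine ⟨node k' hn' h' t x2 c', hmono, ?_, ?_⟩
  · funext j
    by_cases hj : j < m
    · obtain ⟨i, r, hr, rfl⟩ := exists_eq_blockStart_add h' hj
      rw [time_node _ _ _ _ _ _ i hr, time_node _ _ _ _ _ _ i hr]
    · rw [time_of_le _ (not_lt.1 hj), time_of_le _ (not_lt.1 hj)]
  · intro a b hab hb
    obtain ⟨i, r, hr, rfl⟩ := exists_eq_blockStart_add h' (hab.trans hb)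
    obtain ⟨j, q, hq, rfl⟩ := exists_eq_blockStart_add h' hb
    have hij : i ≤ j := le_of_blockStart_add_le hq hab.le
    rcases eq_or_lt_of_le hij with rfl | hij
    · rw [edge_node_in i hr hq, edge_node_in i hr hq, hblock i r q (by omega) hq]
      simp
    · rw [edge_node_cross hij.ne hr hq, edge_node_cross hij.ne hr hq]
      split_ifs with h3
      · obtain ⟨rfl, h4⟩ := h3
        rw [hx2, blockStart_succ, ← h4]
        rfl
      · rw [zero_mul]

/-- The coordinates `y` of a branch at a bead with parameter `t` are realised by a tree and the
length `l` of the edge below it. A length different from `1` requires that the parameter `t` also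
occurs in the tree. -/
theorem exists_branch {m : ℕ} (hm : 1 ≤ m)
    (ih : ∀ y : ℕ → ℝ, (∀ j, 0 < j → j < m → 0 ≤ y j ∧ y j ≤ 1) →
      ∃ D : DTree stasheff m, D.Mono ∧ ∀ j, 0 < j → j < m → D.coord j = y j)
    (t : unitInterval) (y : ℕ → ℝ) (hy : ∀ j, 0 < j → j < m → 0 ≤ y j ∧ y j ≤ 1 - t) :
    ∃ (D : DTree stasheff m) (l : unitInterval), D.Mono ∧ D.RootGe t ∧
      (l ≠ 1 → ∃ j, 0 < j ∧ j < m ∧ D.time j = t) ∧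
      ∀ j, 0 < j → j < m → (1 - t * l / 2) * D.coord j = y j := by
  have ht0 := unitInterval.nonneg t
  have ht1 := unitInterval.le_one t
  rcases eq_or_lt_of_le hm with rfl | hm
  · exact ⟨.leaf rfl, 1, trivial, trivial, fun h => absurd rfl h, fun j h1 h2 => by omega⟩
  obtain ⟨j0, hj0, hmax⟩ := Finset.exists_max_image (Finset.Ioo 0 m) y ⟨1, by simp; omega⟩
  simp only [Finset.mem_Ioo] at hj0 hmax
  -- the edge below the branch has a factor `q`, to be chosen
  have key : ∀ q : ℝ, 0 < q → (∀ j, 0 < j → j < m → y j ≤ (1 - t) * q) →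
      ∃ D : DTree stasheff m, D.Mono ∧ D.RootGe t ∧
        ∀ j, 0 < j → j < m → q * D.coord j = y j := by
    intro q hq hle
    have hdiv : ∀ j, 0 < j → j < m → y j / q ≤ 1 - t := fun j h1 h2 =>
      (div_le_iff₀ hq).2 (hle j h1 h2)
    obtain ⟨D, hD, hc⟩ := ih (fun j => y j / q) fun j h1 h2 =>
      ⟨div_nonneg (hy j h1 h2).1 hq.le, (hdiv j h1 h2).trans (by linarith)⟩
    refine ⟨D, hD, rootGe_of_coord_le hD fun j h1 h2 => ?_, fun j h1 h2 => ?_⟩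
    · rw [hc j h1 h2]
      exact hdiv j h1 h2
    · rw [hc j h1 h2, mul_div_cancel₀ _ hq.ne']
  -- if the largest coordinate is small enough, then the edge has length `1`; otherwise the lowest bead
  -- of the branch has parameter `t`, and the largest coordinate determines the length
  by_cases hM : y j0 ≤ (1 - t) * (1 - t / 2)
  · obtain ⟨D, hD, hge, hc⟩ := key (1 - t / 2) (by linarith)
      fun j h1 h2 => (hmax j ⟨h1, h2⟩).trans hM
    refine ⟨D, 1, hD, hge, fun h => absurd rfl h, fun j h1 h2 => ?_⟩
    rw [← hc j h1 h2]
    simp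
  · rw [not_le] at hM
    have hy0 := hy j0 hj0.1 hj0.2
    have h1 : 0 < 1 - (t : ℝ) := by nlinarith
    have h2 : 0 < (t : ℝ) := by
      by_contra hcon
      have : (t : ℝ) = 0 := le_antisymm (not_lt.1 hcon) ht0
      rw [this] at hM hy0
      linarith
    have h3 : 1 - (t : ℝ) / 2 < y j0 / (1 - t) := by
      rw [lt_div_iff₀ h1]; linarith
    have h4 : y j0 / (1 - t) ≤ 1 := by
      rw [div_le_one h1]; exact hy0.2
    obtain ⟨q, hq⟩ : ∃ q, q = y j0 / (1 - (t : ℝ)) := ⟨_, rfl⟩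
    rw [← hq] at h3 h4
    have h5 : (1 - (t : ℝ)) * q = y j0 := by rw [hq, mul_div_cancel₀ _ h1.ne']
    have hq0 : 0 < q := by linarith
    obtain ⟨D, hD, hge, hc⟩ := key q hq0 fun j h1 h2 => (hmax j ⟨h1, h2⟩).trans h5.ge
    have hl0 : 0 ≤ 2 * (1 - q) / t := div_nonneg (by linarith) ht0
    have hl1 : 2 * (1 - q) / t ≤ 1 := (div_le_one h2).2 (by linarith)
    refine ⟨D, ⟨2 * (1 - q) / t, hl0, hl1⟩, hD, hge, fun _ => ⟨j0, hj0.1, hj0.2, ?_⟩,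
      fun j h1 h2' => ?_⟩
    · apply le_antisymm _ (le_time hD hge hj0.1 hj0.2)
      have h6 := coord_le hD j0
      have h7 : D.coord j0 = 1 - t := by
        apply mul_left_cancel₀ hq0.ne'
        rw [hc j0 hj0.1 hj0.2, ← h5, mul_comm]
      linarith
    · rw [← hc j h1 h2']
      congr 1
      have : (t : ℝ) * (2 * (1 - q) / t) = 2 * (1 - q) := mul_div_cancel₀ _ h2.ne'
      simp only [this]
      ring

/-- Every point of the cube consists of the coordinates of a tree. The tree is obtained from a tree
whose lowest bead has two branches, separated at a position with the largest coordinate, by adjusting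
the lengths of the edges below these branches. -/
theorem exists_coord_eq {m : ℕ} (hm : 1 ≤ m) (y : ℕ → ℝ)
    (hy : ∀ j, 0 < j → j < m → 0 ≤ y j ∧ y j ≤ 1) :
    ∃ D : DTree stasheff m, D.Mono ∧ ∀ j, 0 < j → j < m → D.coord j = y j := by
  classical
  induction m using Nat.strong_induction_on generalizing y with
  | _ m ih =>
    rcases eq_or_lt_of_le hm with rfl | hm1
    · exact ⟨.leaf rfl, trivial, fun j h1 h2 => by omega⟩
    obtain ⟨j0, hj0, hmax⟩ := Finset.exists_max_image (Finset.Ioo 0 m) y ⟨1, by simp; omega⟩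
    simp only [Finset.mem_Ioo] at hj0 hmax
    have hy0 := hy j0 hj0.1 hj0.2
    obtain ⟨t, ht⟩ : ∃ t : unitInterval, (t : ℝ) = 1 - y j0 :=
      ⟨⟨1 - y j0, by linarith, by linarith⟩, rfl⟩
    obtain ⟨k, hk⟩ : ∃ k : Fin 2 → ℕ, k = ![j0, m - j0] := ⟨_, rfl⟩
    have hk0 : k 0 = j0 := by rw [hk]; rfl
    have hk1 : k 1 = m - j0 := by rw [hk]; rfl
    have h : ∑ i, k i = m := by rw [Fin.sum_univ_two, hk0, hk1]; omega
    have hs1 : blockStart k 1 = j0 := by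
      have := blockStart_succ k 0
      rw [Fin.val_zero, blockStart_zero, zero_add, zero_add, hk0] at this
      exact this
    have hpos : ∀ i, 1 ≤ k i := by
      intro i
      fin_cases i
      · exact hk0.symm ▸ hj0.1
      · simp only [Fin.mk_one, hk1]; omega
    have hlt : ∀ i, k i < m := lt_of_sum_eq h (le_refl 2) hpos
    have hle := fun i => blockStart_add_le_sum k h i
    choose c l hmono hge hl hc using fun i => exists_branch (hpos i)
      (fun y hy => ih (k i) (hlt i) (hpos i) y hy) t (fun r => y (blockStart k i + r))
      fun r h1 h2 => by
        have h3 := hle i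
        have h4 := hy (blockStart k i + r) (by omega) (by omega)
        have h5 := hmax (blockStart k i + r) (by omega)
        exact ⟨h4.1, by linarith⟩
    obtain ⟨x⟩ : Nonempty (stasheff.X 2) := ⟨StasheffSpace.corolla 2 one_le_two⟩
    have hD : (node k (le_refl 2) h t x c).Mono :=
      fun i => ⟨hge i, hmono i⟩
    -- the lengths of the edges below the two branches, and `1` for all other intervals
    let s : ℕ → ℕ → unitInterval := fun a b =>
      if e : ∃ i : Fin 2, a = blockStart k i ∧ b + 1 = blockStart k i + k i then l e.choose else 1
    have hs : ∀ (i : Fin 2) (a b : ℕ), a = blockStart k i → b + 1 = blockStart k i + k i →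
        s a b = l i := by
      intro i a b ha hb
      have e : ∃ i : Fin 2, a = blockStart k i ∧ b + 1 = blockStart k i + k i := ⟨i, ha, hb⟩
      have : e.choose = i := (blockStart_add_inj (k := k) (r := 0) (s := 0) (hpos _) (hpos _)
        (by have := e.choose_spec.1; omega)).1
      simp only [s, dif_pos e, this]
    have hs' : ∀ a b, s a b ≠ 1 → ∃ i : Fin 2, a = blockStart k i ∧
        b + 1 = blockStart k i + k i ∧ l i ≠ 1 := by
      intro a b hab
      by_cases e : ∃ i : Fin 2, a = blockStart k i ∧ b + 1 = blockStart k i + k i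
      · obtain ⟨i, ha, hb⟩ := e
        exact ⟨i, ha, hb, hs i a b ha hb ▸ hab⟩
      · exact absurd (dif_neg e) hab
    obtain ⟨D, hDm, htime, hedge⟩ := exists_scale hD s (by
      by_contra hcon
      obtain ⟨i, h1, h2, -⟩ := hs' _ _ hcon
      have := hlt i
      omega) (by
      intro a b hab hb hne
      obtain ⟨i, h1, h2, h3⟩ := hs' _ _ hne
      obtain ⟨r, h4, h5, h6⟩ := hl i h3
      exact ⟨blockStart k i + r, by omega, by omega,
        (time_node_in _ _ _ _ _ _ i h4 h5).trans h6⟩)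
    have hcross : ∀ a b, (a, b) ∈ pairsAt 0 m j0 → D.edge a b = 0 := by
      intro a b hab
      obtain ⟨h1, -, h2, h3, h4⟩ := mem_pairsAt.1 hab
      have e1 : a = blockStart k (0 : Fin 2) + a := by
        rw [Fin.val_zero, blockStart_zero, zero_add]
      have e2 : b = blockStart k (1 : Fin 2) + (b - j0) := by
        change b = blockStart k 1 + (b - j0)
        rw [hs1]; omega
      rw [hedge a b (by omega) h4, e1, e2, edge_node_cross (by decide) (by omega) (by omega), if_neg,
        zero_mul]
      omega
    refine ⟨D, hDm, fun j hj hjm => ?_⟩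
    obtain ⟨i, r, hr, rfl⟩ := exists_eq_blockStart_add h hjm
    by_cases hr0 : r = 0
    · subst hr0
      obtain rfl : i = 1 := by
        by_contra hne
        obtain rfl : i = 0 := by omega
        rw [Fin.val_zero, blockStart_zero] at hj
        omega
      have e : blockStart k (1 : Fin 2) + 0 = j0 := hs1
      rw [e, coord, coordOn, htime, Finset.prod_eq_one]
      · have := time_node_start k (le_refl 2) h t x c one_pos
          one_lt_two
        rw [hs1] at this
        rw [this, ht]
        ring
      · rintro ⟨a, b⟩ hab
        simp [edgeFactor, hcross a b hab]
    · have hr0 : 0 < r := Nat.pos_of_ne_zero hr0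
      have hli := hlt i
      have hlei := hle i
      have hs1' : blockStart k (1 : Fin 2) = j0 := hs1
      have hs0' : blockStart k (0 : Fin 2) = 0 := blockStart_zero k
      have hi : (i = 0 ∧ blockStart k i = 0 ∧ k i = j0) ∨
          (i = 1 ∧ blockStart k i = j0 ∧ k i = m - j0) := by
        by_cases h0 : i = 0
        · subst h0; exact Or.inl ⟨rfl, hs0', hk0⟩
        · obtain rfl : i = 1 := by omega
          exact Or.inr ⟨rfl, hs1', hk1⟩
      rw [← hc i r hr0 hr, coord, coordOn_eq_mul (lo' := blockStart k i)
        (hi' := blockStart k i + k i) (Nat.zero_le _) (by omega) (by omega) (hle i) (by omega)]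
      · congr 1
        · rw [edgeFactor]
          simp only
          have e1 : blockStart k i + k i - 1 = blockStart k i + (k i - 1) := by omega
          have e2 : blockStart k i + (k i - 1) + 1 = blockStart k (i.val + 1) := by
            rw [blockStart_succ]; omega
          have e3 := edge_node_in (hn := le_refl 2) (h := h) (t := t)
            (x := x) (c := c) i (r := 0) (s := k i - 1)
            (by omega) (by omega)
          rw [edge_whole _ rfl (by omega)] at e3
          rw [hedge _ _ (by omega) (by omega), hs i _ _ rfl (by omega), e1, e2, htime,
            max_time_node_cross (by omega) i.2 (by omega)]
          rw [add_zero] at e3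
          rw [e3, one_mul]
        · apply coordOn_shift
          · rw [htime, time_node_in _ _ _ _ _ _ i hr0 hr]
          · intro a b hab
            obtain ⟨h1, -, h2, h3, h4⟩ := mem_pairsAt.1 hab
            rw [edgeFactor, edgeFactor]
            simp only
            rw [htime, max_time_node_in hD i (by omega) h4 h1, hedge _ _ (by omega) (by omega),
              edge_node_in i (by omega) h4]
            have : s (blockStart k i + a) (blockStart k i + b) = 1 := by
              by_contra hne
              obtain ⟨i', h5, h6, -⟩ := hs' _ _ hne
              obtain ⟨rfl, rfl⟩ := blockStart_add_inj (k := k) (i := i) (j := i') (r := a) (s := 0)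
                (by omega) (hpos i') (by omega)
              omega
            rw [this]
            simp
      · intro a b hab hnot
        obtain ⟨h1, -, h2, h3, h4⟩ := mem_pairsAt.1 hab
        have : D.edge a b = 0 := hcross a b (mem_pairsAt.2 (by omega))
        simp [edgeFactor, this]

end DTree

/-! ### The homeomorphism to the cube -/

instance stasheff.compactSpace (n : ℕ) : CompactSpace (stasheff.X n) := by
  change CompactSpace (StasheffSpace n)
  suffices IsClosed {d : Fin n → Fin n → unitInterval | IsTreeLength d} from
    isCompact_iff_compactSpace.1 this.isCompact
  have happ : ∀ a b : Fin n, Continuous fun d : Fin n → Fin n → unitInterval => d a b :=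
    fun a b => (continuous_apply b).comp (continuous_apply a)
  have : {d : Fin n → Fin n → unitInterval | IsTreeLength d} =
      {_d | 1 ≤ n} ∩ {d | ∀ a b, b < a → d a b = 0} ∩ {d | ∀ a, d a a = 1} ∩
      {d | ∀ a b, a.val = 0 → b.val + 1 = n → d a b = 1} ∩
      {d | ∀ a b c e, a < c → c ≤ b → b < e → d a b = 0 ∨ d c e = 0} := by
    ext d
    exact ⟨fun h => ⟨⟨⟨⟨h.1, h.2⟩, h.3⟩, h.4⟩, h.5⟩,
      fun h => ⟨h.1.1.1.1, h.1.1.1.2, h.1.1.2, h.1.2, h.2⟩⟩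
  rw [this]
  refine (((isClosed_const.inter ?_).inter ?_).inter ?_).inter ?_
  · simp only [Set.ofPred_forall]
    exact isClosed_iInter fun a => isClosed_iInter fun b => isClosed_iInter fun _ =>
      isClosed_eq (happ a b) continuous_const
  · simp only [Set.ofPred_forall]
    exact isClosed_iInter fun a => isClosed_eq (happ a a) continuous_const
  · simp only [Set.ofPred_forall]
    exact isClosed_iInter fun a => isClosed_iInter fun b => isClosed_iInter fun _ =>
      isClosed_iInter fun _ => isClosed_eq (happ a b) continuous_const
  · simp only [Set.ofPred_forall, Set.ofPred_or]
    exact isClosed_iInter fun a => isClosed_iInter fun b => isClosed_iInter fun c =>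
      isClosed_iInter fun e => isClosed_iInter fun _ => isClosed_iInter fun _ =>
      isClosed_iInter fun _ => (isClosed_eq (happ a b) continuous_const).union
        (isClosed_eq (happ c e) continuous_const)

instance stasheff.t2Space (n : ℕ) : T2Space (stasheff.X n) :=
  inferInstanceAs (T2Space (StasheffSpace n))

instance PTree.compactSpace_chi {m : ℕ} (T : PTree m) : CompactSpace T.Chi :=
  isCompact_iff_compactSpace.1 isClosed_monotone.isCompact

instance BSpace.compactSpace {P : NSOperad.{0}} [∀ n, CompactSpace (P.X n)] (m : ℕ) :
    CompactSpace (BSpace P m) :=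
  inferInstance

theorem continuous_natLength {m : ℕ} (a b : ℕ) :
    Continuous fun x : stasheff.X m => natLength (m := m) x a b := by
  by_cases h : a < m ∧ b < m
  · simp only [natLength, dif_pos h]
    exact continuous_subtype_val.comp ((continuous_apply (⟨b, h.2⟩ : Fin m)).comp
      ((continuous_apply (⟨a, h.1⟩ : Fin m)).comp
        (continuous_subtype_val (p := fun d : Fin m → Fin m → unitInterval => IsTreeLength d))))
  · simp only [natLength, dif_neg h]
    exact continuous_const

theorem continuous_tree_time {P : NSOperad.{0}} {m : ℕ} (T : PTree m) (j : ℕ) :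
    Continuous fun p : T.Cell P => (BRaw.tree ⟨T, p⟩).time j := by
  by_cases h : j < m
  · simp only [DTree.time, dif_pos h]
    exact continuous_subtype_val.comp ((continuous_decorate_cutTime T ⟨j, h⟩).comp
      (continuous_fst.prodMk (continuous_subtype_val.comp continuous_snd)))
  · simp only [DTree.time, dif_neg h]
    exact continuous_const

theorem continuous_tree_coord {m : ℕ} (T : PTree m) (j : ℕ) :
    Continuous fun p : T.Cell stasheff => (BRaw.tree ⟨T, p⟩).coord j := by
  have hedge : ∀ a b, Continuous fun p : T.Cell stasheff => (BRaw.tree ⟨T, p⟩).edge a b :=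
    fun a b => (continuous_natLength a b).comp ((continuous_decorate_compose T).comp
      (continuous_fst.prodMk (continuous_subtype_val.comp continuous_snd)))
  refine (continuous_const.sub (continuous_tree_time T j)).mul (continuous_finsetProd _ ?_)
  rintro ⟨a, b⟩ -
  exact continuous_const.sub ((((continuous_tree_time T a).max
    (continuous_tree_time T (b + 1))).mul (hedge a b)).div_const 2)

/-- The point of the cube given by the coordinates of a tree. -/
noncomputable def BRaw.toCube {m : ℕ} (p : BRaw stasheff m) : CubeSpace m :=
  ⟨fun g => ⟨p.tree.coord (g + 1), DTree.coord_nonneg p.mono _, DTree.coord_le_one p.mono _⟩,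
    p.1.pos⟩

theorem BRaw.toCube_eq_of_rel {m : ℕ} {p q : BRaw stasheff m} (h : DTree.Rel p.tree q.tree) :
    p.toCube = q.toCube := by
  apply Subtype.ext
  funext g
  apply Subtype.ext
  have := g.2
  exact h.coord_eq p.mono q.mono (by omega)

/-- The map from `B K` to the cube given by the coordinates. -/
noncomputable def BSpace.toCube {m : ℕ} : BSpace stasheff m → CubeSpace m :=
  lift BRaw.toCube (fun _ _ h => BRaw.toCube_eq_of_rel h.rel)
    (fun _ _ _ h => BRaw.toCube_eq_of_rel h.rel)

theorem BSpace.toCube_mk {m : ℕ} (p : BRaw stasheff m) : toCube (mk p) = p.toCube := rfl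

theorem BSpace.continuous_toCube {m : ℕ} : Continuous (toCube (m := m)) :=
  continuous_lift _ _ fun T => Continuous.subtype_mk (f := fun p : T.Cell stasheff =>
    (BRaw.toCube ⟨T, p⟩).1) (continuous_pi fun g =>
    (continuous_tree_coord T (g + 1)).subtype_mk _) fun p => (BRaw.toCube ⟨T, p⟩).2

theorem BSpace.toCube_injective {m : ℕ} : Function.Injective (toCube (m := m)) := by
  intro u v huv
  obtain ⟨p, rfl⟩ := mk_surjective u
  obtain ⟨q, rfl⟩ := mk_surjective v
  apply mk_eq_of_rel
  apply DTree.rel_of_coord_eq p.mono q.mono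
  intro j h0 hj
  have := congrArg (fun y : CubeSpace m => (y.1 ⟨j - 1, by omega⟩ : ℝ)) huv
  simpa only [toCube_mk, BRaw.toCube, Nat.sub_add_cancel h0] using this

theorem BSpace.toCube_surjective {m : ℕ} : Function.Surjective (toCube (m := m)) := by
  intro y
  obtain ⟨D, hD, hc⟩ := DTree.exists_coord_eq y.2
    (fun j => if h : j - 1 < m - 1 then (y.1 ⟨j - 1, h⟩ : ℝ) else 0) (by
      intro j h1 h2
      rw [dif_pos (by omega)]
      exact ⟨unitInterval.nonneg _, unitInterval.le_one _⟩)
  obtain ⟨p, rfl⟩ := BRaw.exists_tree_eq D hD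
  refine ⟨mk p, Subtype.ext (funext fun g => Subtype.ext ?_)⟩
  have hg := g.2
  change p.tree.coord (g + 1) = _
  rw [hc _ (by omega) (by omega), dif_pos (by omega)]
  rfl

/-- A continuous bijection from a compact space to a Hausdorff space is a homeomorphism. -/
theorem BSpace.isHomeomorph_toCube (m : ℕ) : IsHomeomorph (toCube (m := m)) :=
  isHomeomorph_iff_continuous_bijective.2
    ⟨continuous_toCube, toCube_injective, toCube_surjective⟩

/-- The homeomorphism from `B K` to the cube. -/
noncomputable def BSpace.cubeHomeo (m : ℕ) : BSpace stasheff m ≃ₜ CubeSpace m :=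
  (isHomeomorph_toCube m).homeomorph _

/-! ### The bimodule structure -/

/-- The transport of a bimodule structure along homeomorphisms. -/
def BimodStr.transport {P : NSOperad.{0}} {X Y : ℕ → Type u} [∀ n, TopologicalSpace (X n)]
    [∀ n, TopologicalSpace (Y n)] (S : BimodStr P X) (e : ∀ n, Y n ≃ₜ X n)
    (hY : ∀ n, CompactlyGeneratedSpace (Y n)) : BimodStr P Y where
  cg := hY
  left {n m} k h x y := (e m).symm (S.left k h x fun i => e (k i) (y i))
  right {n m} k h x y := (e m).symm (S.right k h (e n x) y)
  left_cont {n m} k h K _ _ _ g hg := (e m).symm.continuous.comp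
    (S.left_cont k h K (fun z => ((g z).1, fun i => e (k i) ((g z).2 i)))
      ((continuous_fst.comp hg).prodMk (continuous_pi fun i => (e (k i)).continuous.comp
        ((continuous_apply i).comp (continuous_snd.comp hg)))))
  right_cont {n m} k h K _ _ _ g hg := (e m).symm.continuous.comp
    (S.right_cont k h K (fun z => (e n (g z).1, (g z).2))
      (((e n).continuous.comp (continuous_fst.comp hg)).prodMk (continuous_snd.comp hg)))
  one_left {m} h y := by rw [S.one_left h, (e m).symm_apply_apply]
  right_one {n} h x := by rw [S.right_one h, (e n).symm_apply_apply]
  left_left {n p m} k h1 l h2 s hs h3 x y z := by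
    simp only [Homeomorph.apply_symm_apply]
    rw [S.left_left k h1 l h2 s hs h3]
  right_right {n p m} k h1 l h2 s hs h3 x y z := by
    simp only [Homeomorph.apply_symm_apply]
    rw [S.right_right k h1 l h2 s hs h3]
  left_right {n p m} k h1 l h2 s hs h3 x y z := by
    simp only [Homeomorph.apply_symm_apply]
    rw [S.left_right k h1 l h2 s hs h3]

namespace BSpace

instance t2Space (m : ℕ) : T2Space (BSpace stasheff m) :=
  (cubeHomeo m).isEmbedding.t2Space

/-- The structure of a bimodule on `B K` that corresponds to that of the cube. -/
noncomputable def bimodStr : BimodStr assocPos (BSpace stasheff) :=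
  cube.str.transport cubeHomeo fun _ => inferInstance

/-- The isomorphism of bimodules from `B K` to the cube. -/
noncomputable def cubeHom : (NSBimod.mk (BSpace stasheff) bimodStr).Hom cube where
  toFun m := cubeHomeo m
  cont m := (cubeHomeo m).continuous
  map_left {_ m} _ _ _ _ := (cubeHomeo m).apply_symm_apply _
  map_right {_ m} _ _ _ _ := (cubeHomeo m).apply_symm_apply _

theorem isGrafting_bimodStr : IsGrafting bimodStr where
  left {n m} k hn h a x p := by
    have hp : ∀ i, (p i).tree.RootGe 0 := by
      intro i
      cases (p i).tree with
      | leaf => trivial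
      | node => exact unitInterval.nonneg'
    refine ⟨.node k hn h 0 x p hp, BRaw.tree_node .., ?_⟩
    · refine (Homeomorph.symm_apply_eq _).2 ?_
      apply Subtype.ext
      funext g
      apply Subtype.ext
      obtain ⟨⟨i, r⟩, e⟩ := (blk k h).surjective (gapPos g)
      have hg : g.val = blockStart k i + r := by
        rw [← blk_val_eq k h, e]
        rfl
      have hr := r.2
      have hg' := g.2
      change (cubeLeft k h (fun i => (p i).toCube) g : ℝ) =
        (DTree.node k hn h 0 x fun i => (p i).tree).coord (g + 1)
      rw [cubeLeft_eq k h _ g i r e.symm, hg]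
      split_ifs with hr'
      · have hmono := (BRaw.node k hn h 0 x p hp).mono
        rw [BRaw.tree_node] at hmono
        rw [add_assoc, DTree.coord_node_zero_in hmono i (by omega) hr']
        rfl
      · have e1 : blockStart k i + r.val + 1 = blockStart k (i.val + 1) := by
          rw [blockStart_succ]; omega
        have hi : i.val + 1 < n := by
          by_contra hcon
          have : i.val + 1 = n := by omega
          rw [this, blockStart_last k h] at e1
          omega
        rw [e1, DTree.coord_node_zero_start (by omega) hi]
        rfl
  right {n m} k hk h p y a := by
    obtain ⟨q, hq⟩ := BRaw.exists_tree_eq _ (p.mono.graft k h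
      (fun i => DTree.corolla (hk i) 1 (y i)) (fun i => DTree.mono_corolla _ _ _)
      fun i s => DTree.rootGe_corolla_one _ _ _)
    refine ⟨q, hq, (Homeomorph.symm_apply_eq _).2 ?_⟩
    apply Subtype.ext
    funext g
    apply Subtype.ext
    obtain ⟨⟨i, r⟩, e⟩ := (blk k h).surjective (gapPos g)
    have hg : g.val = blockStart k i + r := by
      rw [← blk_val_eq k h, e]
      rfl
    have hr := r.2
    have hg' := g.2
    change (cubeRight k h p.toCube g : ℝ) = q.tree.coord (g + 1)
    rw [cubeRight_eq k h _ g i r e.symm, hg, hq]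
    split_ifs with hr' hi
    · rw [add_assoc, DTree.coord_graft_in p.tree _ (by omega) hr'
        (DTree.time_corolla_one _ _ (by omega) hr')]
      rfl
    · have e1 : blockStart k i + r.val + 1 = blockStart k (i.val + 1) := by
        rw [blockStart_succ]; omega
      rw [e1, DTree.coord_graft_start p.tree _ hi]
      rfl
    · have e1 : blockStart k i + r.val + 1 = blockStart k (i.val + 1) := by
        rw [blockStart_succ]; omega
      have : i.val + 1 = n := by omega
      rw [this, blockStart_last k h] at e1
      omega

theorem isEmpty_zero {P : NSOperad.{0}} : IsEmpty (BSpace P 0) := by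
  refine ⟨fun u => ?_⟩
  obtain ⟨p, -⟩ := mk_surjective u
  exact absurd p.1.pos (by omega)

end BSpace

theorem CubeSpace.contractibleSpace {m : ℕ} (hm : 1 ≤ m) : ContractibleSpace (CubeSpace m) := by
  rw [contractible_iff_id_nullhomotopic]
  refine ⟨⟨fun _ => 0, hm⟩, ⟨{
    toFun := fun q => ⟨fun g => unitInterval.symm q.1 * q.2.1 g, hm⟩
    continuous_toFun := ?_
    map_zero_left := ?_
    map_one_left := ?_ }⟩⟩
  · refine Continuous.subtype_mk (continuous_pi fun g => ?_) _
    exact (unitInterval.continuous_symm.comp continuous_fst).mul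
      ((continuous_apply g).comp (continuous_subtype_val.comp continuous_snd))
  · intro y
    apply Subtype.ext
    funext g
    simp
  · intro y
    apply Subtype.ext
    funext g
    simp

theorem BSpace.contractibleSpace {m : ℕ} (hm : 1 ≤ m) : ContractibleSpace (BSpace stasheff m) :=
  have := CubeSpace.contractibleSpace hm
  (cubeHomeo m).contractibleSpace

/-! ### Evaluation along a loop -/

section Evaluation

variable {O : NSOperad.{u}} {η : assocPos.Hom O} (l : OperadLoop (stasheffProj.trans η))

theorem OperadLoop.hom_eq {t : unitInterval} (ht : t = 0 ∨ t = 1) {n : ℕ} (x : stasheff.X n)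
    (a : assocPos.X n) : (l.hom t).toFun n x = η.toFun n a := by
  rcases ht with rfl | rfl
  · rw [l.zero]; rfl
  · rw [l.one]; rfl

theorem PTree.Collapse.eval_eq {m : ℕ} {T : PTree m} {p q : T.Cell stasheff}
    (hpq : T.Collapse p q) : (BRaw.tree ⟨T, p⟩).eval l = (BRaw.tree ⟨T, q⟩).eval l := by
  induction T with
  | leaf h => rfl
  | node k hn h c ih =>
    have hp := (PTree.monotone_node_iff.1 p.2.2).2
    have hq := (PTree.monotone_node_iff.1 q.2.2).2
    have e1 := fun i => ih i (p := ⟨fun b => p.1 (PTree.branchBead k hn h c i b),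
      ⟨fun b => p.2.1 (PTree.branchBead k hn h c i b), hp i⟩⟩)
      (q := ⟨fun b => q.1 (PTree.branchBead k hn h c i b),
      ⟨fun b => q.2.1 (PTree.branchBead k hn h c i b), hq i⟩⟩)
      (fun b => hpq (PTree.branchBead k hn h c i b))
    have e2 : (l.hom (p.2.1 (rootBead k hn h c))).toFun _ (p.1 (rootBead k hn h c)) =
        (l.hom (q.2.1 (rootBead k hn h c))).toFun _ (q.1 (rootBead k hn h c)) := by
      rcases hpq (rootBead k hn h c) with h' | h' | h'
      · rw [h'.1, h'.2]
      · exact (l.hom_eq (Or.inl h'.1) _ ⟨one_le_two.trans hn⟩).trans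
          (l.hom_eq (Or.inl h'.2) _ ⟨one_le_two.trans hn⟩).symm
      · exact (l.hom_eq (Or.inr h'.1) _ ⟨one_le_two.trans hn⟩).trans
          (l.hom_eq (Or.inr h'.2) _ ⟨one_le_two.trans hn⟩).symm
    exact congrArg₂ (O.comp k h) e2 (funext e1)

/-- Evaluation along a loop. -/
def BSpace.eval {m : ℕ} : BSpace stasheff m → O.X m :=
  lift (fun p => p.tree.eval l) (fun _ _ h => h.eval_eq l) (fun _ _ _ h => h.eval_eq l)

theorem BSpace.eval_mk {m : ℕ} (p : BRaw stasheff m) : eval l (mk p) = p.tree.eval l := rfl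

/-- Evaluation along a loop as a morphism of bimodules. -/
theorem BSpace.exists_evalHom {S : BimodStr assocPos (BSpace stasheff)} (hS : IsGrafting S) :
    ∃ ζ : (NSBimod.mk (BSpace stasheff) S).Hom (O.toBimod η),
      ∀ (m : ℕ) (p : BRaw stasheff m), ζ.toFun m (mk p) = p.tree.eval l := by
  refine ⟨⟨fun m => eval l, fun m => ?_, fun {n m} k h x y => ?_, fun {n m} k h x y => ?_⟩,
    fun m p => rfl⟩
  · exact continuous_lift _ _ fun T => (continuous_decorate_eval l T).comp
      (continuous_fst.prodMk (continuous_subtype_val.comp continuous_snd))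
  · choose p hp using fun i => mk_surjective (P := stasheff) (y i)
    obtain rfl : (fun i => mk (p i)) = y := funext hp
    have hn : 1 ≤ n := x.down
    rcases eq_or_lt_of_le hn with rfl | hn
    · obtain ⟨m', rfl⟩ : ∃ m', k = fun _ => m' :=
        ⟨k 0, funext fun i => congrArg k (Subsingleton.elim _ _)⟩
      obtain rfl : m' = m := by simpa using h
      obtain ⟨p', rfl⟩ : ∃ p', p = fun _ => p' :=
        ⟨p 0, funext fun i => by rw [Subsingleton.elim i 0]⟩
      change eval l (S.left (fun _ : Fin 1 => m') h assocPos.one fun _ => mk p') =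
        O.comp (fun _ : Fin 1 => m') h (η.toFun 1 assocPos.one) fun _ => eval l (mk p')
      rw [S.one_left, η.map_one, O.one_comp]
    · obtain ⟨q, hq, e⟩ := hS.left k hn h x (StasheffSpace.corolla n (by omega)) p
      change eval l (S.left k h x fun i => mk (p i)) =
        O.comp k h (η.toFun n x) fun i => eval l (mk (p i))
      rw [e, eval_mk, hq]
      exact congrArg (O.comp k h · _) (l.hom_eq (Or.inl rfl) _ x)
  · obtain ⟨p, rfl⟩ := mk_surjective (P := stasheff) x
    obtain ⟨q, hq, e⟩ := hS.right k (fun i => (y i).down) h p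
      (fun i => StasheffSpace.corolla (k i) (y i).down) y
    change eval l (S.right k h (mk p) y) =
      O.comp k h (eval l (mk p)) fun i => η.toFun (k i) (y i)
    rw [e, eval_mk, hq, DTree.eval_graft, eval_mk]
    congr 1
    funext i
    refine (DTree.eval_corolla l _ 1 _ fun hk => ?_).trans (l.hom_eq (Or.inr rfl) _ (y i))
    have : ∀ (j : ℕ) (hj : 1 ≤ j), j = 1 →
        HEq (StasheffSpace.corolla j hj : stasheff.X j) stasheff.one := by
      rintro j hj rfl
      apply heq_of_eq
      apply Subtype.ext
      funext a b
      obtain rfl : a = b := Subsingleton.elim _ _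
      exact (StasheffSpace.corolla 1 hj).2.leaf a
    exact this (k i) _ hk

end Evaluation

/-! ### Bimodules over the operad of associative algebras -/

instance assocPos.subsingleton (n : ℕ) : Subsingleton (assocPos.X n) :=
  inferInstanceAs (Subsingleton (PLift (1 ≤ n)))

/-- The element of the operad `assocPos` in a positive arity. -/
def assocPos.point {n : ℕ} (hn : 1 ≤ n) : assocPos.X n := ⟨hn⟩

namespace NSBimod

/-- The elements of all arities of a bimodule. -/
abbrev Tot (M : NSBimod.{u} assocPos) : Type u := Σ n, M.X n

variable {M : NSBimod.{u} assocPos}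

namespace Tot

/-- The left action of the element of `assocPos` in arity `n`. -/
def prod {n : ℕ} (hn : 1 ≤ n) (f : Fin n → M.Tot) : M.Tot :=
  ⟨∑ i, (f i).1, M.str.left (fun i => (f i).1) rfl (assocPos.point hn) fun i => (f i).2⟩

/-- The right action of the elements of `assocPos` in the arities `l 0, l 1, …`. -/
def act (x : M.Tot) (l : ℕ → ℕ) (hl : ∀ a, 1 ≤ l a) : M.Tot :=
  ⟨∑ i : Fin x.1, l i, M.str.right (fun i => l i) rfl x.2 fun i => assocPos.point (hl i)⟩

theorem mk_left {n m : ℕ} (k : Fin n → ℕ) (h : ∑ i, k i = m) (hn : 1 ≤ n) (a : assocPos.X n)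
    (c : ∀ i, M.X (k i)) :
    (⟨m, M.str.left k h a c⟩ : M.Tot) = prod hn fun i => ⟨k i, c i⟩ := by
  subst h
  rw [Subsingleton.elim a (assocPos.point hn)]
  rfl

theorem mk_right {n m : ℕ} (l : ℕ → ℕ) (hl : ∀ a, 1 ≤ l a) (h : ∑ i : Fin n, l i = m) (x : M.X n)
    (a : ∀ i : Fin n, assocPos.X (l i)) :
    (⟨m, M.str.right (fun i => l i) h x a⟩ : M.Tot) = act ⟨n, x⟩ l hl := by
  subst h
  rw [Subsingleton.elim a fun i => assocPos.point (hl i)]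
  rfl

theorem act_congr {x : M.Tot} {l l' : ℕ → ℕ} {hl : ∀ a, 1 ≤ l a} {hl' : ∀ a, 1 ≤ l' a}
    (e : ∀ a, a < x.1 → l a = l' a) : act x l hl = act x l' hl' := by
  have : (fun i : Fin x.1 => l i) = fun i : Fin x.1 => l' i := funext fun i => e i i.2
  have key : ∀ (k : Fin x.1 → ℕ) (a : ∀ i, assocPos.X (k i)), k = (fun i : Fin x.1 => l' i) →
      (⟨∑ i, k i, M.str.right k rfl x.2 a⟩ : M.Tot) = act x l' hl' := by
    rintro k a rfl
    exact mk_right l' hl' rfl x.2 a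
  exact key _ _ this

/-- A family of families of elements as a single family. -/
def flat {A : Type*} {n : ℕ} {k : Fin n → ℕ} (g : ∀ i, Fin (k i) → A) (a : Fin (∑ i, k i)) : A :=
  g ((blk k rfl).symm a).1 ((blk k rfl).symm a).2

theorem flat_blk {A : Type*} {n : ℕ} {k : Fin n → ℕ} (g : ∀ i, Fin (k i) → A) (i : Fin n)
    (j : Fin (k i)) : flat g (blk k rfl ⟨i, j⟩) = g i j :=
  congrArg (fun s : Σ i, Fin (k i) => g s.1 s.2) ((blk k rfl).symm_apply_apply ⟨i, j⟩)

theorem prod_flat {n : ℕ} (hn : 1 ≤ n) {k : Fin n → ℕ} (hk : ∀ i, 1 ≤ k i)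
    (g : ∀ i, Fin (k i) → M.Tot) :
    prod (one_le_of_sum k rfl hn hk) (flat g) = prod hn fun i => prod (hk i) (g i) := by
  have h2 := sum_blk k rfl (fun a => (flat g a).1) rfl
  refine (mk_left (fun a => (flat g a).1) h2.symm _ (assocPos.comp k rfl (assocPos.point hn)
    fun i => assocPos.point (hk i)) fun a => (flat g a).2).symm.trans ?_
  rw [M.str.left_left k rfl _ _ _ (fun _ => rfl) rfl]
  refine (mk_left _ rfl hn _ _).trans (congrArg (prod hn) (funext fun i => ?_))
  refine (mk_left _ rfl (hk i) _ _).trans (congrArg (prod (hk i)) (funext fun j => ?_))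
  exact flat_blk g i j

theorem act_act (x : M.Tot) {l l' : ℕ → ℕ} (hl : ∀ a, 1 ≤ l a) (hl' : ∀ a, 1 ≤ l' a) :
    act (act x l hl) l' hl' =
      act x (fun a => ∑ j : Fin (l a), l' (blockStart (fun i : Fin x.1 => l i) a + j))
        fun a => one_le_of_sum _ rfl (hl a) fun _ => hl' _ := by
  have h3 := sum_blk (fun i : Fin x.1 => l i) rfl (fun a => l' a) rfl
  have e := M.str.right_right (fun i : Fin x.1 => l i) rfl (fun a => l' a) rfl _ (fun _ => rfl) h3
    x.2 (fun i => assocPos.point (hl i)) fun a => assocPos.point (hl' a)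
  refine (congrArg (Sigma.mk _) e).trans ?_
  have key : ∀ (k : Fin x.1 → ℕ) (m : ℕ) (h : ∑ i, k i = m) (a : ∀ i, assocPos.X (k i)),
      k = (fun i : Fin x.1 => ∑ j : Fin (l i), l' (blockStart (fun i : Fin x.1 => l i) i + j)) →
      (⟨m, M.str.right k h x.2 a⟩ : M.Tot) = act x
        (fun a => ∑ j : Fin (l a), l' (blockStart (fun i : Fin x.1 => l i) a + j))
        fun a => one_le_of_sum _ rfl (hl a) fun _ => hl' _ := by
    rintro k m h a rfl
    exact mk_right (fun a => ∑ j : Fin (l a), l' (blockStart (fun i : Fin x.1 => l i) a + j)) _ h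
      x.2 a
  refine key _ _ _ _ (funext fun i => Finset.sum_congr rfl fun j _ => ?_)
  rw [blk_val_eq]

theorem act_prod {n : ℕ} (hn : 1 ≤ n) (f : Fin n → M.Tot) {l : ℕ → ℕ} (hl : ∀ a, 1 ≤ l a) :
    act (prod hn f) l hl = prod hn fun i =>
      act (f i) (fun j => l (blockStart (fun i => (f i).1) i + j)) fun _ => hl _ := by
  have h3 := sum_blk (fun i => (f i).1) rfl (fun a => l a) rfl
  have e := M.str.left_right (fun i => (f i).1) rfl (fun a => l a) rfl _ (fun _ => rfl) h3
    (assocPos.point hn) (fun i => (f i).2) fun a => assocPos.point (hl a)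
  refine (congrArg (Sigma.mk _) e).trans ((mk_left _ h3 hn _ _).trans
    (congrArg (prod hn) (funext fun i => ?_)))
  have key : ∀ (k : Fin (f i).1 → ℕ) (a : ∀ i, assocPos.X (k i)),
      k = (fun j : Fin (f i).1 => l (blockStart (fun i => (f i).1) i + j)) →
      (⟨∑ j, k j, M.str.right k rfl (f i).2 a⟩ : M.Tot) = act (f i)
        (fun j => l (blockStart (fun i => (f i).1) i + j)) fun _ => hl _ := by
    rintro k a rfl
    exact mk_right (fun j => l (blockStart (fun i => (f i).1) i + j)) _ rfl (f i).2 a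
  exact key _ _ (funext fun j => congrArg l (blk_val_eq _ _ _ _))

/-- The lengths `l i 0, …, l i (k i - 1)` for all `i` as a single sequence, extended by `1`. -/
def flatLength {n : ℕ} (k : Fin n → ℕ) (l : Fin n → ℕ → ℕ) (a : ℕ) : ℕ :=
  if h : a < ∑ i, k i then flat (fun i (r : Fin (k i)) => l i r) ⟨a, h⟩ else 1

theorem flatLength_start {n : ℕ} (k : Fin n → ℕ) (l : Fin n → ℕ → ℕ) (i : Fin n) {r : ℕ}
    (hr : r < k i) : flatLength k l (blockStart k i + r) = l i r := by
  have hle := blockStart_add_le_sum k rfl i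
  rw [flatLength, dif_pos (by omega)]
  have e : (⟨blockStart k i + r, by omega⟩ : Fin (∑ i, k i)) = blk k rfl ⟨i, ⟨r, hr⟩⟩ :=
    Fin.ext (blk_val_eq k rfl i ⟨r, hr⟩).symm
  rw [e, flat_blk]

theorem one_le_flatLength {n : ℕ} {k : Fin n → ℕ} {l : Fin n → ℕ → ℕ} (hl : ∀ i a, 1 ≤ l i a)
    (a : ℕ) : 1 ≤ flatLength k l a := by
  rw [flatLength]
  split_ifs
  · exact hl _ _
  · exact le_refl 1

/-- Products of elements of the form `act (prod _ f) l` have the same form. -/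
theorem prod_act_prod {n : ℕ} (hn : 1 ≤ n) {k : Fin n → ℕ} (hk : ∀ i, 1 ≤ k i)
    (g : ∀ i, Fin (k i) → M.Tot) {l : Fin n → ℕ → ℕ} (hl : ∀ i a, 1 ≤ l i a) :
    (prod hn fun i => act (prod (hk i) (g i)) (l i) (hl i)) =
      act (prod (one_le_of_sum k rfl hn hk) (flat g))
        (flatLength (fun i => ∑ j, (g i j).1) l) (one_le_flatLength hl) := by
  rw [prod_flat hn hk g, act_prod]
  refine congrArg (prod hn) (funext fun i => act_congr fun a ha => ?_)
  exact (flatLength_start (fun i => ∑ j, (g i j).1) l i ha).symm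

theorem prod_one (x : M.Tot) : prod (le_refl 1) (fun _ : Fin 1 => x) = x := by
  have h : ∑ _i : Fin 1, x.1 = x.1 := by simp
  refine (mk_left (fun _ : Fin 1 => x.1) h _ assocPos.one fun _ => x.2).symm.trans ?_
  rw [M.str.one_left]

theorem act_one (x : M.Tot) : act x (fun _ => 1) (fun _ => le_refl 1) = x := by
  have h : ∑ _i : Fin x.1, 1 = x.1 := by simp
  refine (mk_right (fun _ => 1) _ h x.2 fun _ => assocPos.one).symm.trans ?_
  rw [M.str.right_one]

/-- A morphism of bimodules on elements of all arities. -/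
def map {N : NSBimod.{v} assocPos} (φ : M.Hom N) (x : M.Tot) : N.Tot := ⟨x.1, φ.toFun x.1 x.2⟩

theorem map_prod {N : NSBimod.{v} assocPos} (φ : M.Hom N) {n : ℕ} (hn : 1 ≤ n)
    (f : Fin n → M.Tot) : map φ (prod hn f) = prod hn fun i => map φ (f i) :=
  congrArg (Sigma.mk _) (φ.map_left _ _ _ _)

theorem map_act {N : NSBimod.{v} assocPos} (φ : M.Hom N) (x : M.Tot) {l : ℕ → ℕ}
    (hl : ∀ a, 1 ≤ l a) : map φ (act x l hl) = act (map φ x) l hl :=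
  congrArg (Sigma.mk _) (φ.map_right _ _ _ _)

end Tot

/-- Elements of `M` that are products of elements of arities at most `N`, up to the right action. -/
def IsGenerated (N : ℕ) (x : M.Tot) : Prop :=
  ∃ (n : ℕ) (hn : 1 ≤ n) (f : Fin n → M.Tot) (l : ℕ → ℕ) (hl : ∀ a, 1 ≤ l a),
    (∀ i, (f i).1 ≤ N) ∧ x = Tot.act (Tot.prod hn f) l hl

theorem IsGenerated.prod {N n : ℕ} (hn : 1 ≤ n) {f : Fin n → M.Tot}
    (hf : ∀ i, IsGenerated N (f i)) : IsGenerated N (Tot.prod hn f) := by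
  choose k hk g l hl hg e using hf
  refine ⟨_, one_le_of_sum k rfl hn hk, Tot.flat g, _,
    Tot.one_le_flatLength (k := fun i => ∑ j, (g i j).1) hl, fun a => hg _ _, ?_⟩
  rw [← Tot.prod_act_prod hn hk g hl, funext e]

theorem IsGenerated.act {N : ℕ} {x : M.Tot} (hx : IsGenerated N x) {l : ℕ → ℕ}
    (hl : ∀ a, 1 ≤ l a) : IsGenerated N (Tot.act x l hl) := by
  obtain ⟨n, hn, f, l', hl', hf, rfl⟩ := hx
  rw [Tot.act_act]
  exact ⟨n, hn, f, _, _, hf, rfl⟩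

theorem IsGenerated.of_le {N : ℕ} {x : M.Tot} (hx : x.1 ≤ N) : IsGenerated N x := by
  refine ⟨1, le_refl 1, fun _ => x, fun _ => 1, fun _ => le_refl 1, fun _ => hx, ?_⟩
  rw [Tot.prod_one, Tot.act_one]

theorem IsGenerated.mono {N N' : ℕ} (hN : N ≤ N') {x : M.Tot} (hx : IsGenerated N x) :
    IsGenerated N' x := by
  obtain ⟨n, hn, f, l, hl, hf, e⟩ := hx
  exact ⟨n, hn, f, l, hl, fun i => (hf i).trans hN, e⟩

end NSBimod

/-! ### Decomposition of the points of cubes -/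

namespace CubeSpace

open NSBimod Tot

/-- The coordinate of a point of a cube that belongs to the gap between the positions `a - 1` and
`a`, extended by `0`. -/
def cut (x : cube.Tot) (a : ℕ) : unitInterval :=
  if h : a - 1 < x.1 - 1 then (x.2 : CubeSpace x.1).1 ⟨a - 1, h⟩ else 0

theorem pos (x : cube.Tot) : 1 ≤ x.1 := (x.2 : CubeSpace x.1).2

theorem cut_succ (x : cube.Tot) (g : Fin (x.1 - 1)) :
    cut x (g.val + 1) = (x.2 : CubeSpace x.1).1 g := by
  rw [cut, dif_pos (by rw [Nat.add_sub_cancel]; exact g.2)]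
  rfl

theorem tot_ext {x x' : cube.Tot} (h : x.1 = x'.1)
    (e : ∀ a, 0 < a → a < x.1 → cut x a = cut x' a) : x = x' := by
  obtain ⟨n, y⟩ := x
  obtain ⟨n', y'⟩ := x'
  obtain rfl : n = n' := h
  refine congrArg (Sigma.mk n) (Subtype.ext (funext fun g => ?_))
  have hg := g.2
  have := e (g.val + 1) (by omega) (by simp only; omega)
  rwa [cut_succ ⟨n, y⟩ g, cut_succ ⟨n, y'⟩ g] at this

/-- The point with given coordinates. -/
def ofCut (n : ℕ) (hn : 1 ≤ n) (c : ℕ → unitInterval) : cube.Tot :=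
  ⟨n, (⟨fun g => c (g.val + 1), hn⟩ : CubeSpace n)⟩

theorem cut_ofCut {n : ℕ} (hn : 1 ≤ n) (c : ℕ → unitInterval) {a : ℕ} (h0 : 0 < a) (ha : a < n) :
    cut (ofCut n hn c) a = c a := by
  have := cut_succ (ofCut n hn c) ⟨a - 1, by simp only [ofCut]; omega⟩
  simp only [Nat.sub_add_cancel h0] at this
  rw [this]
  exact congrArg c (Nat.sub_add_cancel h0)

section Prod

variable {n : ℕ} (hn : 1 ≤ n) (f : Fin n → cube.Tot)

theorem cut_prod (i : Fin n) {r : ℕ} (hr : r < (f i).1)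
    (hlt : blockStart (fun i => (f i).1) i + r + 1 < ∑ i, (f i).1) :
    cut (prod hn f) (blockStart (fun i => (f i).1) i + r + 1) =
      if r + 1 < (f i).1 then cut (f i) (r + 1) else 1 := by
  rw [cut_succ (prod hn f) ⟨blockStart (fun i => (f i).1) i + r, by simp only [Tot.prod]; omega⟩]
  refine (cubeLeft_eq (fun i => (f i).1) rfl (fun i => (f i).2)
    ⟨blockStart (fun i => (f i).1) i + r, by omega⟩ i ⟨r, hr⟩
    (Fin.ext (blk_val_eq (fun i => (f i).1) rfl i ⟨r, hr⟩).symm)).trans ?_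
  split_ifs with h
  · exact (cut_succ (f i) ⟨r, by simp only at h; omega⟩).symm
  · rfl

theorem cut_prod_in (i : Fin n) {r : ℕ} (h0 : 0 < r) (hr : r < (f i).1) :
    cut (prod hn f) (blockStart (fun i => (f i).1) i + r) = cut (f i) r := by
  have hle := blockStart_add_le_sum (fun i => (f i).1) rfl i
  obtain ⟨s, rfl⟩ := Nat.exists_eq_add_of_le' h0
  rw [← add_assoc, cut_prod hn f i (by omega) (by omega), if_pos hr]

theorem cut_prod_start {i : ℕ} (hi : 0 < i) (hin : i < n) :
    cut (prod hn f) (blockStart (fun i => (f i).1) i) = 1 := by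
  have hle := blockStart_add_le_sum (fun i => (f i).1) rfl ⟨i, hin⟩
  have h1 := pos (f ⟨i - 1, by omega⟩)
  have h2 := pos (f ⟨i, hin⟩)
  have e := blockStart_succ (fun i => (f i).1) ⟨i - 1, by omega⟩
  simp only [Nat.sub_add_cancel hi] at e hle
  have := cut_prod hn f ⟨i - 1, by omega⟩ (r := (f ⟨i - 1, by omega⟩).1 - 1) (by omega)
    (by simp only; omega)
  rw [if_neg (by omega), add_assoc, Nat.sub_add_cancel h1] at this
  rw [e, this]

end Prod

section Act

variable (x : cube.Tot) {l : ℕ → ℕ} (hl : ∀ a, 1 ≤ l a)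

theorem cut_act (i : Fin x.1) {r : ℕ} (hr : r < l i)
    (hlt : blockStart (fun i : Fin x.1 => l i) i + r + 1 < ∑ i : Fin x.1, l i) :
    cut (act x l hl) (blockStart (fun i : Fin x.1 => l i) i + r + 1) =
      if r + 1 < l i then 0 else cut x (i + 1) := by
  have e := blockStart_succ (fun i : Fin x.1 => l i) i
  rw [cut_succ (act x l hl) ⟨blockStart (fun i : Fin x.1 => l i) i + r,
    by simp only [act]; omega⟩]
  refine (cubeRight_eq (fun i : Fin x.1 => l i) rfl x.2
    ⟨blockStart (fun i : Fin x.1 => l i) i + r, by omega⟩ i ⟨r, hr⟩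
    (Fin.ext (blk_val_eq (fun i : Fin x.1 => l i) rfl i ⟨r, hr⟩).symm)).trans ?_
  by_cases h : r + 1 < l i
  · rw [if_pos h, if_pos h]
  · have hi : i.val + 1 < x.1 := by
      by_contra hcon
      have h1 : i.val + 1 = x.1 := by omega
      rw [h1, blockStart_last _ rfl] at e
      omega
    rw [if_neg h, if_neg h, dif_pos hi]
    exact (cut_succ x ⟨i, by omega⟩).symm

theorem cut_act_in (i : Fin x.1) {r : ℕ} (h0 : 0 < r) (hr : r < l i) :
    cut (act x l hl) (blockStart (fun i : Fin x.1 => l i) i + r) = 0 := by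
  have hle := blockStart_add_le_sum (fun i : Fin x.1 => l i) rfl i
  obtain ⟨s, rfl⟩ := Nat.exists_eq_add_of_le' h0
  rw [← add_assoc, cut_act x hl i (by omega) (by omega), if_pos hr]

theorem cut_act_start {i : ℕ} (hi : 0 < i) (hin : i < x.1) :
    cut (act x l hl) (blockStart (fun i : Fin x.1 => l i) i) = cut x i := by
  have hle := blockStart_add_le_sum (fun i : Fin x.1 => l i) rfl ⟨i, hin⟩
  have h1 := hl (i - 1)
  have h2 := hl i
  have e := blockStart_succ (fun i : Fin x.1 => l i) ⟨i - 1, by omega⟩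
  simp only [Nat.sub_add_cancel hi] at e hle
  have := cut_act x hl ⟨i - 1, by omega⟩ (r := l (i - 1) - 1) (by simp only; omega)
    (by simp only; omega)
  simp only [Nat.sub_add_cancel hi] at this
  rw [if_neg (by omega), add_assoc, Nat.sub_add_cancel h1] at this
  rw [e, this]

end Act

/-- A point with a coordinate `1` is a product. -/
theorem exists_eq_prod (x : cube.Tot) {a : ℕ} (h0 : 0 < a) (ha : a < x.1) (h : cut x a = 1) :
    ∃ f : Fin 2 → cube.Tot, x = prod one_le_two f ∧ ∀ i, (f i).1 < x.1 := by
  obtain ⟨f, hf⟩ : ∃ f : Fin 2 → cube.Tot, f = ![ofCut a h0 (cut x),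
      ofCut (x.1 - a) (by omega) fun b => cut x (a + b)] := ⟨_, rfl⟩
  have hf0 : f 0 = ofCut a h0 (cut x) := by rw [hf]; rfl
  have hf1 : f 1 = ofCut (x.1 - a) (by omega) fun b => cut x (a + b) := by rw [hf]; rfl
  have h1 : (f 0).1 = a := by rw [hf0]; rfl
  have h2 : (f 1).1 = x.1 - a := by rw [hf1]; rfl
  have hs : ∑ i, (f i).1 = x.1 := by rw [Fin.sum_univ_two, h1, h2]; omega
  have hs0 : blockStart (fun i => (f i).1) (0 : Fin 2) = 0 := blockStart_zero _
  have hs1 : blockStart (fun i => (f i).1) (1 : Fin 2) = a := by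
    have := blockStart_succ (fun i => (f i).1) 0
    rw [Fin.val_zero, blockStart_zero, zero_add, zero_add, h1] at this
    exact this
  refine ⟨f, tot_ext hs.symm fun b hb0 hb => ?_, fun i => ?_⟩
  · obtain ⟨i, r, hr, rfl⟩ := exists_eq_blockStart_add hs hb
    rcases Nat.eq_zero_or_pos r with rfl | hr0
    · have hi : i = 1 := by
        by_contra hne
        obtain rfl : i = 0 := by omega
        omega
      subst hi
      have := cut_prod_start one_le_two f (i := 1) one_pos one_lt_two
      rw [add_zero]
      refine Eq.trans ?_ this.symm
      rw [hs1, h]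
    · rw [cut_prod_in _ f i hr0 hr]
      have hi : i = 0 ∨ i = 1 := by omega
      rcases hi with rfl | rfl
      · rw [hs0, hf0, cut_ofCut _ _ hr0 (h1 ▸ hr), zero_add]
      · rw [hs1, hf1, cut_ofCut _ _ hr0 (h2 ▸ hr)]
  · have hi : i = 0 ∨ i = 1 := by omega
    rcases hi with rfl | rfl <;> omega

/-- A point with a coordinate `0` is in the image of the right action. -/
theorem exists_eq_act (x : cube.Tot) {a : ℕ} (h0 : 0 < a) (ha : a < x.1) (h : cut x a = 0) :
    ∃ (y : cube.Tot) (l : ℕ → ℕ) (hl : ∀ a, 1 ≤ l a), x = act y l hl ∧ y.1 < x.1 := by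
  let l : ℕ → ℕ := fun b => if b = a - 1 then 2 else 1
  have hl : ∀ b, 1 ≤ l b := fun b => by simp only [l]; split_ifs <;> omega
  obtain ⟨y, hy⟩ : ∃ y, y = ofCut (x.1 - 1) (by omega) fun b =>
    if b < a then cut x b else cut x (b + 1) := ⟨_, rfl⟩
  have hy1 : y.1 = x.1 - 1 := by rw [hy]; rfl
  have hstart : ∀ b, b ≤ y.1 →
      blockStart (fun i : Fin y.1 => l i) b = if b < a then b else b + 1 := by
    intro b hb
    induction b with
    | zero => rw [blockStart_zero, if_pos h0]
    | succ b ih =>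
      have := blockStart_succ (fun i : Fin y.1 => l i) ⟨b, hb⟩
      simp only at this
      rw [this, ih (by omega)]
      simp only [l]
      split_ifs <;> omega
  have hs : ∑ i : Fin y.1, l i = x.1 := by
    rw [← blockStart_last (fun i : Fin y.1 => l i) rfl, hstart _ (le_refl _), if_neg (by omega)]
    omega
  refine ⟨y, l, hl, tot_ext hs.symm fun b hb0 hb => ?_, by omega⟩
  obtain ⟨i, r, hr, rfl⟩ := exists_eq_blockStart_add hs hb
  have hi := i.2
  rcases Nat.eq_zero_or_pos r with rfl | hr0
  · rw [add_zero] at hb0 ⊢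
    have hi0 : 0 < i.val := by
      by_contra hcon
      obtain hcon : i.val = 0 := by omega
      rw [hcon, blockStart_zero] at hb0
      omega
    rw [cut_act_start y hl hi0 hi, hstart _ hi.le]
    have := cut_ofCut (n := x.1 - 1) (by omega)
      (fun b => if b < a then cut x b else cut x (b + 1)) hi0 (by omega)
    rw [← hy] at this
    rw [this]
    split_ifs <;> rfl
  · rw [cut_act_in y hl i hr0 hr]
    have h1 : i.val = a - 1 ∧ r = 1 := by
      simp only [l] at hr
      split_ifs at hr <;> omega
    rw [hstart _ hi.le, if_pos (by omega), h1.1, h1.2, Nat.sub_add_cancel h0, h]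

/-- The points that are neither products nor in the image of the right action. -/
def IsInterior (x : cube.Tot) : Prop := ∀ a, 0 < a → a < x.1 → cut x a ≠ 0 ∧ cut x a ≠ 1

/-- The factors of a product of interior points are separated by the coordinates `1`, so they are
determined by the product. -/
theorem prod_injective {n n' : ℕ} {hn : 1 ≤ n} {hn' : 1 ≤ n'} {f : Fin n → cube.Tot}
    {f' : Fin n' → cube.Tot} (hf : ∀ i, IsInterior (f i)) (hf' : ∀ i, IsInterior (f' i))
    (e : prod hn f = prod hn' f') : ∃ h : n = n', ∀ i, f i = f' (Fin.cast h i) := by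
  have key : ∀ {n : ℕ} (hn : 1 ≤ n) (f : Fin n → cube.Tot), (∀ i, IsInterior (f i)) → ∀ a,
      (∃ i : Fin n, a = blockStart (fun i => (f i).1) i) ↔
        a = 0 ∨ (0 < a ∧ a < (prod hn f).1 ∧ cut (prod hn f) a = 1) := by
    intro n hn f hf a
    constructor
    · rintro ⟨i, rfl⟩
      have h1 := pos (f i)
      have h2 := blockStart_add_le_sum (fun i => (f i).1) rfl i
      rcases Nat.eq_zero_or_pos i.val with h0 | h0
      · left
        rw [h0, blockStart_zero]
      · right
        have h3 := blockStart_add_le (fun i => (f i).1) (i := ⟨0, by omega⟩) (j := i) h0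
        have h4 := pos (f ⟨0, by omega⟩)
        simp only at h2 h3
        exact ⟨by omega, by simp only [Tot.prod]; omega, cut_prod_start hn f h0 i.2⟩
    · rintro (rfl | ⟨h0, ha, e⟩)
      · exact ⟨⟨0, by omega⟩, (blockStart_zero _).symm⟩
      · obtain ⟨i, r, hr, rfl⟩ := exists_eq_blockStart_add (k := fun i => (f i).1) rfl ha
        rcases Nat.eq_zero_or_pos r with rfl | hr0
        · exact ⟨i, rfl⟩
        · rw [cut_prod_in hn f i hr0 hr] at e
          exact absurd e (hf i r hr0 hr).2
  have hm : ∑ i, (f i).1 = ∑ i, (f' i).1 := congrArg Sigma.fst e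
  obtain ⟨rfl, h⟩ := blocks_eq (k := fun i => (f i).1) (k' := fun i => (f' i).1) hm rfl
    (fun i => pos _) (fun i => pos _) fun a => by rw [key hn f hf, key hn' f' hf', e]
  have h' : (fun i => (f i).1) = fun i => (f' i).1 := funext h
  refine ⟨rfl, fun i => tot_ext (h i) fun r h0 hr => ?_⟩
  have h1 := cut_prod_in hn f i h0 hr
  have h2 := cut_prod_in hn' f' i h0 ((h i : (f i).1 = (f' i).1) ▸ hr)
  rw [← h1, e, h', h2]
  rfl

/-- The blocks of the right action on a point without coordinates `0` are separated by the nonzero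
coordinates. -/
theorem act_injective {x x' : cube.Tot} {l l' : ℕ → ℕ} {hl : ∀ a, 1 ≤ l a} {hl' : ∀ a, 1 ≤ l' a}
    (hx : ∀ a, 0 < a → a < x.1 → cut x a ≠ 0) (hx' : ∀ a, 0 < a → a < x'.1 → cut x' a ≠ 0)
    (e : act x l hl = act x' l' hl') : x = x' ∧ ∀ a, a < x.1 → l a = l' a := by
  have key : ∀ (x : cube.Tot) (l : ℕ → ℕ) (hl : ∀ a, 1 ≤ l a),
      (∀ a, 0 < a → a < x.1 → cut x a ≠ 0) → ∀ a,
      (∃ i : Fin x.1, a = blockStart (fun i : Fin x.1 => l i) i) ↔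
        a = 0 ∨ (0 < a ∧ a < (act x l hl).1 ∧ cut (act x l hl) a ≠ 0) := by
    intro x l hl hx a
    have hx1 := pos x
    constructor
    · rintro ⟨i, rfl⟩
      have h1 := hl i
      have h2 := blockStart_add_le_sum (fun i : Fin x.1 => l i) rfl i
      rcases Nat.eq_zero_or_pos i.val with h0 | h0
      · left
        rw [h0, blockStart_zero]
      · right
        have h3 := blockStart_add_le (fun i : Fin x.1 => l i) (i := ⟨0, by omega⟩) (j := i) h0
        have h4 := hl 0
        simp only at h2 h3
        refine ⟨by omega, by simp only [act]; omega, ?_⟩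
        rw [cut_act_start x hl h0 i.2]
        exact hx i h0 i.2
    · rintro (rfl | ⟨h0, ha, e⟩)
      · exact ⟨⟨0, by omega⟩, (blockStart_zero _).symm⟩
      · obtain ⟨i, r, hr, rfl⟩ := exists_eq_blockStart_add (k := fun i : Fin x.1 => l i) rfl ha
        rcases Nat.eq_zero_or_pos r with rfl | hr0
        · exact ⟨i, rfl⟩
        · exact absurd (cut_act_in x hl i hr0 hr) e
  have hm : ∑ i : Fin x.1, l i = ∑ i : Fin x'.1, l' i := congrArg Sigma.fst e
  obtain ⟨n, y⟩ := x
  obtain ⟨n', y'⟩ := x'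
  obtain ⟨h, h'⟩ := blocks_eq hm rfl (fun i => hl _) (fun i => hl' _) fun a => by
    rw [key _ l hl hx, key _ l' hl' hx', e]
  obtain rfl : n = n' := h
  have h2 : (fun i : Fin n => l i) = fun i : Fin n => l' i := funext h'
  refine ⟨tot_ext rfl fun i h0 hi => ?_, fun a ha => h' ⟨a, ha⟩⟩
  rw [← cut_act_start ⟨n, y⟩ hl h0 hi, ← cut_act_start ⟨n, y'⟩ hl' h0 hi, e]
  simp only
  rw [h2]

theorem cut_prod_ne_zero {n : ℕ} (hn : 1 ≤ n) {f : Fin n → cube.Tot}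
    (hf : ∀ i, IsInterior (f i)) (a : ℕ) (h0 : 0 < a) (ha : a < (prod hn f).1) :
    cut (prod hn f) a ≠ 0 := by
  obtain ⟨i, r, hr, rfl⟩ := exists_eq_blockStart_add (k := fun i => (f i).1) rfl ha
  rcases Nat.eq_zero_or_pos r with rfl | hr0
  · have hi : 0 < i.val := by
      by_contra hcon
      obtain hcon : i.val = 0 := by omega
      rw [hcon, blockStart_zero] at h0
      omega
    rw [add_zero, cut_prod_start hn f hi i.2]
    exact one_ne_zero
  · rw [cut_prod_in hn f i hr0 hr]
    exact (hf i r hr0 hr).1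

end CubeSpace

/-! ### The filtration of the cube bimodule -/

namespace NSBimod

variable {M : NSBimod.{u} assocPos}

namespace Tot

theorem le_prod {n : ℕ} (hn : 1 ≤ n) (f : Fin n → M.Tot) (i : Fin n) : (f i).1 ≤ (prod hn f).1 :=
  Finset.single_le_sum (f := fun i => (f i).1) (fun _ _ => Nat.zero_le _) (Finset.mem_univ i)

theorem le_act (x : M.Tot) {l : ℕ → ℕ} (hl : ∀ a, 1 ≤ l a) : x.1 ≤ (act x l hl).1 := by
  have : ∑ _i : Fin x.1, 1 ≤ ∑ i : Fin x.1, l i := Finset.sum_le_sum fun i _ => hl i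
  rw [Finset.sum_const, Finset.card_univ, Fintype.card_fin, smul_eq_mul, mul_one] at this
  exact this

/-- A finite family of numbers extended by `1`. -/
def extendOne {n : ℕ} (k : Fin n → ℕ) (a : ℕ) : ℕ := if h : a < n then k ⟨a, h⟩ else 1

theorem extendOne_val {n : ℕ} (k : Fin n → ℕ) : (fun i : Fin n => extendOne k i) = k :=
  funext fun i => dif_pos i.2

theorem one_le_extendOne {n : ℕ} {k : Fin n → ℕ} (hk : ∀ i, 1 ≤ k i) (a : ℕ) :
    1 ≤ extendOne k a := by
  rw [extendOne]
  split_ifs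
  · exact hk _
  · exact le_refl 1

theorem mk_right_extendOne {n m : ℕ} (k : Fin n → ℕ) (hk : ∀ i, 1 ≤ k i) (h : ∑ i, k i = m)
    (x : M.X n) (a : ∀ i, assocPos.X (k i)) :
    (⟨m, M.str.right k h x a⟩ : M.Tot) = act ⟨n, x⟩ (extendOne k) (one_le_extendOne hk) := by
  have key : ∀ (k' : Fin n → ℕ) (h : ∑ i, k' i = m) (a : ∀ i, assocPos.X (k' i)),
      k' = (fun i : Fin n => extendOne k i) →
      (⟨m, M.str.right k' h x a⟩ : M.Tot) = act ⟨n, x⟩ (extendOne k) (one_le_extendOne hk) := by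
    rintro k' h a rfl
    exact mk_right (extendOne k) _ h x a
  exact key k h a (extendOne_val k).symm

end Tot

/-- The sub-bimodule of the elements with a property. -/
def sub (M : NSBimod.{u} assocPos) (p : M.Tot → Prop)
    (hprod : ∀ {n : ℕ} (hn : 1 ≤ n) (f : Fin n → M.Tot), (∀ i, p (f i)) → p (Tot.prod hn f))
    (hact : ∀ (x : M.Tot) (l : ℕ → ℕ) (hl : ∀ a, 1 ≤ l a), p x → p (Tot.act x l hl))
    (hcg : ∀ m, CompactlyGeneratedSpace {y : M.X m // p ⟨m, y⟩}) : NSBimod.{u} assocPos where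
  X m := {y : M.X m // p ⟨m, y⟩}
  str :=
    { cg := hcg
      left := fun k h a y => ⟨M.str.left k h a fun i => (y i).1, by
        rw [Tot.mk_left k h a.down]
        exact hprod _ _ fun i => (y i).2⟩
      right := fun k h x a => ⟨M.str.right k h x.1 a, by
        rw [Tot.mk_right_extendOne k (fun i => (a i).down)]
        exact hact _ _ _ x.2⟩
      left_cont := fun k h K _ _ _ g hg => (M.str.left_cont k h K
        (fun z => ((g z).1, fun i => ((g z).2 i).1)) ((continuous_fst.comp hg).prodMk
          (continuous_pi fun i => continuous_subtype_val.comp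
            ((continuous_apply i).comp (continuous_snd.comp hg))))).subtype_mk _
      right_cont := fun k h K _ _ _ g hg => (M.str.right_cont k h K
        (fun z => ((g z).1.1, (g z).2)) ((continuous_subtype_val.comp
          (continuous_fst.comp hg)).prodMk (continuous_snd.comp hg))).subtype_mk _
      one_left := fun h y => Subtype.ext (M.str.one_left h y.1)
      right_one := fun h x => Subtype.ext (M.str.right_one h x.1)
      left_left := fun k h1 l h2 s hs h3 x y z =>
        Subtype.ext (M.str.left_left k h1 l h2 s hs h3 x y fun a => (z a).1)
      right_right := fun k h1 l h2 s hs h3 x y z =>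
        Subtype.ext (M.str.right_right k h1 l h2 s hs h3 x.1 y z)
      left_right := fun k h1 l h2 s hs h3 x y z =>
        Subtype.ext (M.str.left_right k h1 l h2 s hs h3 x (fun i => (y i).1) z) }

end NSBimod

namespace CubeSpace

open NSBimod

instance compactSpace (m : ℕ) : CompactSpace (CubeSpace m) := by
  by_cases h : 1 ≤ m
  · have hs : Function.Surjective fun d : Fin (m - 1) → unitInterval => (⟨d, h⟩ : CubeSpace m) :=
      fun y => ⟨y.1, rfl⟩
    exact hs.compactSpace (continuous_id.subtype_mk _)
  · have : IsEmpty (CubeSpace m) := ⟨fun y => h y.2⟩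
    infer_instance

/-- The combinatorial types of the elements of arity `m` of the form
`Tot.act (Tot.prod hn f) l hl` with factors of arities at most `N`. -/
abbrev GenType (N m : ℕ) : Type :=
  {j : Σ n : Fin (m + 1), (Fin n → Fin (N + 1)) × (Fin m → Fin (m + 1)) //
    1 ≤ j.1.val ∧ (∀ a, 1 ≤ (j.2.2 a).val) ∧
      ∑ i : Fin (∑ i, (j.2.1 i).val), Tot.extendOne (fun a => (j.2.2 a).val) i = m}

/-- The elements with a given combinatorial type. -/
def genMap (M : NSBimod.{0} assocPos) {N m : ℕ} (j : GenType N m)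
    (z : ∀ i, M.X (j.1.2.1 i)) : M.X m :=
  M.str.right _ j.2.2.2 (M.str.left (fun i => (j.1.2.1 i).val) rfl (assocPos.point j.2.1) z)
    fun i => assocPos.point (Tot.one_le_extendOne j.2.2.1 i)

theorem mk_genMap (M : NSBimod.{0} assocPos) {N m : ℕ} (j : GenType N m)
    (z : ∀ i, M.X (j.1.2.1 i)) :
    (⟨m, genMap M j z⟩ : M.Tot) =
      Tot.act (Tot.prod j.2.1 fun i => ⟨j.1.2.1 i, z i⟩) _ (Tot.one_le_extendOne j.2.2.1) := by
  rw [genMap, Tot.mk_right (Tot.extendOne fun a => (j.1.2.2 a).val) (Tot.one_le_extendOne j.2.2.1)]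
  rfl

theorem continuous_genMap (M : NSBimod.{0} assocPos) {N m : ℕ} (j : GenType N m) {Z : Type}
    [TopologicalSpace Z] [CompactSpace Z] [T2Space Z] {g : Z → ∀ i, M.X (j.1.2.1 i)}
    (hg : Continuous g) : Continuous fun z => genMap M j (g z) :=
  M.str.right_cont _ j.2.2.2 Z (fun _ => (_, _))
    ((M.str.left_cont (fun i => (j.1.2.1 i).val) rfl Z (fun z => (assocPos.point j.2.1, g z))
      (continuous_const.prodMk hg)).prodMk continuous_const)

theorem exists_genMap_eq {N m : ℕ} {y : CubeSpace m} (hy : IsGenerated N (⟨m, y⟩ : cube.Tot)) :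
    ∃ (j : GenType N m) (z : ∀ i, CubeSpace (j.1.2.1 i)), genMap cube j z = y := by
  obtain ⟨n, hn, f, l, hl, hf, e⟩ := hy
  have hm : ∑ i : Fin (∑ i, (f i).1), l i = m := (congrArg Sigma.fst e).symm
  have hn' : n ≤ ∑ i, (f i).1 := by
    have : ∑ _i : Fin n, 1 ≤ ∑ i, (f i).1 := Finset.sum_le_sum fun i _ => pos (f i)
    simpa using this
  have hm' : ∑ i, (f i).1 ≤ m := by
    have : ∑ _i : Fin (∑ i, (f i).1), 1 ≤ ∑ i : Fin (∑ i, (f i).1), l i :=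
      Finset.sum_le_sum fun i _ => hl i
    rw [hm] at this
    simpa using this
  have hlm : ∀ a, a < ∑ i, (f i).1 → l a ≤ m := fun a ha => hm ▸
    Finset.single_le_sum (f := fun i : Fin (∑ i, (f i).1) => l i) (fun _ _ => Nat.zero_le _)
      (Finset.mem_univ ⟨a, ha⟩)
  have hL : ∀ a, a < ∑ i, (f i).1 →
      Tot.extendOne (fun a : Fin m => min (l a) m) a = l a := by
    intro a ha
    rw [Tot.extendOne, dif_pos (by omega)]
    exact min_eq_left (hlm a ha)
  let j : GenType N m := ⟨⟨⟨n, by omega⟩, fun i => ⟨(f i).1, by have := hf i; omega⟩,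
    fun a => ⟨min (l a) m, by omega⟩⟩, hn, fun a => le_min (hl a) (by omega),
    (Finset.sum_congr rfl fun (i : Fin (∑ i, (f i).1)) _ => hL i i.2).trans hm⟩
  refine ⟨j, fun i => (f i).2, ?_⟩
  have : (⟨m, genMap cube j fun i => (f i).2⟩ : cube.Tot) = ⟨m, y⟩ := by
    rw [mk_genMap, e]
    exact Tot.act_congr fun a ha => hL a ha
  exact eq_of_heq (Sigma.ext_iff.1 this).2

theorem isGenerated_genMap {N m : ℕ} (j : GenType N m) (z : ∀ i, CubeSpace (j.1.2.1 i)) :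
    IsGenerated N (⟨m, genMap cube j z⟩ : cube.Tot) :=
  ⟨_, j.2.1, _, _, _, fun i => Nat.le_of_lt_succ (j.1.2.1 i).2, mk_genMap cube j z⟩

/-- The points of a cube that are generated by the points of arities at most `N`. -/
abbrev Filtration (N m : ℕ) : Type := {y : CubeSpace m // IsGenerated N (⟨m, y⟩ : cube.Tot)}

/-- The elements of arity `m` with all combinatorial types: a map from a compact space, so that the
topology of `Filtration N m` is the quotient topology. -/
def genQuot {N m : ℕ} (q : Σ j : GenType N m, ∀ i, CubeSpace (j.1.2.1 i)) : Filtration N m :=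
  ⟨genMap cube q.1 q.2, isGenerated_genMap q.1 q.2⟩

theorem continuous_genQuot {N m : ℕ} : Continuous (genQuot (N := N) (m := m)) := by
  refine continuous_sigma fun j => ?_
  have h : Continuous fun z : ∀ i, CubeSpace (j.1.2.1 i) => genMap cube j z :=
    continuous_genMap cube j (g := fun z : ∀ i, CubeSpace (j.1.2.1 i) => z) continuous_id
  exact h.subtype_mk _

theorem genQuot_surjective {N m : ℕ} : Function.Surjective (genQuot (N := N) (m := m)) := by
  rintro ⟨y, hy⟩
  obtain ⟨j, z, rfl⟩ := exists_genMap_eq hy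
  exact ⟨⟨j, z⟩, rfl⟩

theorem isQuotientMap_genQuot {N m : ℕ} : Topology.IsQuotientMap (genQuot (N := N) (m := m)) :=
  Topology.IsQuotientMap.of_surjective_continuous genQuot_surjective continuous_genQuot

instance compactSpace_filtration (N m : ℕ) : CompactSpace (Filtration N m) :=
  isQuotientMap_genQuot.surjective.compactSpace continuous_genQuot

/-- The sub-bimodule of the cube that is generated by the elements of arities at most `N`. -/
def filtration (N : ℕ) : NSBimod.{0} assocPos :=
  cube.sub (IsGenerated N) (fun hn _ => IsGenerated.prod hn) (fun _ _ hl h => h.act hl) fun m =>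
    inferInstanceAs (CompactlyGeneratedSpace (Filtration N m))

/-- The inclusions of the sub-bimodules. -/
def filtrationLe {N N' : ℕ} (h : N ≤ N') : filtration N ⟶ filtration N' where
  toFun _ y := ⟨y.1, y.2.mono h⟩
  cont _ := continuous_subtype_val.subtype_mk _
  map_left _ _ _ _ := rfl
  map_right _ _ _ _ := rfl

/-- The inclusion of the sub-bimodules into the cube. -/
def filtrationIncl (N : ℕ) : filtration N ⟶ cube where
  toFun _ y := y.1
  cont _ := continuous_subtype_val
  map_left _ _ _ _ := rfl
  map_right _ _ _ _ := rfl

/-! ### Extension of morphisms from the generators -/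

variable {N : ℕ} {C : NSBimod.{0} assocPos}

/-- Maps from the cubes of arities at most `N` to a bimodule, on elements of all arities. -/
def onTot (ψ : ∀ k, k ≤ N → CubeSpace k → C.X k) (x : cube.Tot) (hx : x.1 ≤ N) : C.Tot :=
  ⟨x.1, ψ x.1 hx x.2⟩

theorem onTot_congr (ψ : ∀ k, k ≤ N → CubeSpace k → C.X k) {x x' : cube.Tot} (e : x = x')
    {hx : x.1 ≤ N} {hx' : x'.1 ≤ N} : onTot ψ x hx = onTot ψ x' hx' := by
  subst e
  rfl

variable (N C) in
/-- A morphism of bimodules from the cube to `C` that is defined in the arities at most `N`. -/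
structure PartialHom where
  toFun : ∀ k, k ≤ N → CubeSpace k → C.X k
  cont : ∀ k hk, Continuous (toFun k hk)
  map_prod : ∀ {n : ℕ} (hn : 1 ≤ n) (f : Fin n → cube.Tot) (h : (Tot.prod hn f).1 ≤ N),
    onTot toFun (Tot.prod hn f) h =
      Tot.prod hn fun i => onTot toFun (f i) ((Tot.le_prod hn f i).trans h)
  map_act : ∀ (x : cube.Tot) (l : ℕ → ℕ) (hl : ∀ a, 1 ≤ l a) (h : (Tot.act x l hl).1 ≤ N),
    onTot toFun (Tot.act x l hl) h =
      Tot.act (onTot toFun x ((Tot.le_act x hl).trans h)) l hl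

namespace PartialHom

variable (ψ : PartialHom N C)

/-- The graph of the extension of `ψ`. By `prod_injective` and `act_injective` an element has
at most one representation as in the definition, since the factors `f i` are interior. -/
def Rel (y : cube.Tot) (c : C.Tot) : Prop :=
  ∃ (n : ℕ) (hn : 1 ≤ n) (f : Fin n → cube.Tot) (hf : ∀ i, (f i).1 ≤ N) (l : ℕ → ℕ)
    (hl : ∀ a, 1 ≤ l a), (∀ i, IsInterior (f i)) ∧ y = Tot.act (Tot.prod hn f) l hl ∧
      c = Tot.act (Tot.prod hn fun i => onTot ψ.toFun (f i) (hf i)) l hl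

variable {ψ}

theorem Rel.fst_eq {y : cube.Tot} {c : C.Tot} (h : ψ.Rel y c) : c.1 = y.1 := by
  obtain ⟨n, hn, f, hf, l, hl, -, rfl, rfl⟩ := h
  rfl

theorem Rel.unique {y : cube.Tot} {c c' : C.Tot} (h : ψ.Rel y c) (h' : ψ.Rel y c') : c = c' := by
  obtain ⟨n, hn, f, hf, l, hl, hi, rfl, rfl⟩ := h
  obtain ⟨n', hn', f', hf', l', hl', hi', e, rfl⟩ := h'
  obtain ⟨e1, e2⟩ := act_injective (cut_prod_ne_zero hn hi) (cut_prod_ne_zero hn' hi') e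
  obtain ⟨rfl, e3⟩ := prod_injective hi hi' e1
  obtain rfl : f = f' := funext e3
  exact Tot.act_congr e2

theorem Rel.prod {n : ℕ} (hn : 1 ≤ n) {f : Fin n → cube.Tot} {c : Fin n → C.Tot}
    (h : ∀ i, ψ.Rel (f i) (c i)) : ψ.Rel (Tot.prod hn f) (Tot.prod hn c) := by
  choose k hk g hg l hl hi e e' using h
  refine ⟨_, one_le_of_sum k rfl hn hk, Tot.flat g, fun a => hg _ _, _,
    Tot.one_le_flatLength (k := fun i => ∑ j, (g i j).1) hl, fun a => hi _ _, ?_, ?_⟩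
  · rw [← Tot.prod_act_prod hn hk g hl, funext e]
  · rw [funext e']
    exact Tot.prod_act_prod hn hk (fun i j => onTot ψ.toFun (g i j) (hg i j)) hl

theorem Rel.act {y : cube.Tot} {c : C.Tot} (h : ψ.Rel y c) {l : ℕ → ℕ} (hl : ∀ a, 1 ≤ l a) :
    ψ.Rel (Tot.act y l hl) (Tot.act c l hl) := by
  obtain ⟨n, hn, f, hf, l', hl', hi, rfl, rfl⟩ := h
  rw [Tot.act_act, Tot.act_act]
  exact ⟨n, hn, f, hf, _, _, hi, rfl, rfl⟩

variable (ψ)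

/-- Compatibility with products and the right action in low arities reduces this to interior
points. -/
theorem rel_onTot (x : cube.Tot) (hx : x.1 ≤ N) : ψ.Rel x (onTot ψ.toFun x hx) := by
  obtain ⟨m, hm⟩ : ∃ m, x.1 = m := ⟨_, rfl⟩
  induction m using Nat.strong_induction_on generalizing x with
  | _ m ih =>
    by_cases hi : IsInterior x
    · refine ⟨1, le_refl 1, fun _ => x, fun _ => hx, fun _ => 1, fun _ => le_refl 1,
        fun _ => hi, ?_, ?_⟩ <;> rw [Tot.prod_one, Tot.act_one]
    · simp only [IsInterior, not_forall] at hi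
      obtain ⟨a, h0, ha, h⟩ := hi
      rw [not_and_or, not_not, not_not] at h
      rcases h with h | h
      · obtain ⟨y, l, hl, rfl, hlt⟩ := exists_eq_act x h0 ha h
        rw [ψ.map_act]
        exact (ih _ (hm ▸ hlt) y _ rfl).act hl
      · obtain ⟨f, rfl, hlt⟩ := exists_eq_prod x h0 ha h
        rw [ψ.map_prod]
        exact Rel.prod _ fun i => ih _ (hm ▸ hlt i) (f i) _ rfl

theorem exists_rel {m : ℕ} (y : Filtration N m) :
    ∃ c : C.X m, ψ.Rel ⟨m, y.1⟩ ⟨m, c⟩ := by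
  obtain ⟨n, hn, f, l, hl, hf, e⟩ := y.2
  have h : ψ.Rel ⟨m, y.1⟩ (Tot.act (Tot.prod hn fun i => onTot ψ.toFun (f i) (hf i)) l hl) := by
    rw [e]
    exact (Rel.prod hn fun i => ψ.rel_onTot (f i) (hf i)).act hl
  generalize Tot.act (Tot.prod hn fun i => onTot ψ.toFun (f i) (hf i)) l hl = c at h
  obtain ⟨m', c⟩ := c
  obtain rfl : m' = m := h.fst_eq
  exact ⟨c, h⟩

/-- The extension of `ψ` to the elements generated by those of arities at most `N`. -/
noncomputable def value {m : ℕ} (y : Filtration N m) : C.X m := (ψ.exists_rel y).choose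

theorem rel_value {m : ℕ} (y : Filtration N m) : ψ.Rel ⟨m, y.1⟩ ⟨m, ψ.value y⟩ :=
  (ψ.exists_rel y).choose_spec

theorem value_eq {m : ℕ} {y : Filtration N m} {c : C.X m} (h : ψ.Rel ⟨m, y.1⟩ ⟨m, c⟩) :
    ψ.value y = c := by
  simpa using (ψ.rel_value y).unique h

theorem continuous_value (m : ℕ) : Continuous (ψ.value (m := m)) := by
  refine isQuotientMap_genQuot.continuous_iff.2 (continuous_sigma fun j => ?_)
  have hk := fun i => Nat.le_of_lt_succ (j.1.2.1 i).2
  have h : ∀ z : ∀ i, CubeSpace (j.1.2.1 i), ψ.value (genQuot ⟨j, z⟩) =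
      genMap C j fun i => ψ.toFun _ (hk i) (z i) := by
    intro z
    refine ψ.value_eq ?_
    rw [mk_genMap]
    refine Eq.subst (motive := fun y => ψ.Rel y _) (mk_genMap cube j z).symm ?_
    exact (Rel.prod _ fun i => ψ.rel_onTot ⟨_, z i⟩ (hk i)).act _
  refine Continuous.congr ?_ fun z => (h z).symm
  exact continuous_genMap C j (continuous_pi fun i => (ψ.cont _ (hk i)).comp (continuous_apply i))

/-- The extension of `ψ` as a morphism. -/
noncomputable def extend : filtration N ⟶ C where
  toFun _ y := ψ.value y
  cont := ψ.continuous_value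
  map_left {n m} k h a y := by
    refine ψ.value_eq ?_
    rw [Tot.mk_left k h a.down]
    refine Eq.subst (motive := fun y => ψ.Rel y _)
      (Tot.mk_left (M := cube) k h a.down a fun i => (y i).1).symm ?_
    exact Rel.prod _ fun i => ψ.rel_value (y i)
  map_right {n m} k h x a := by
    refine ψ.value_eq ?_
    have hk := fun i => (a i).down
    rw [Tot.mk_right_extendOne k hk]
    refine Eq.subst (motive := fun y => ψ.Rel y _)
      (Tot.mk_right_extendOne (M := cube) k hk h x.1 a).symm ?_
    exact (ψ.rel_value x).act _

theorem extend_eq {k : ℕ} (hk : k ≤ N) (y : Filtration N k) :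
    ψ.extend.toFun k y = ψ.toFun k hk y.1 :=
  ψ.value_eq (ψ.rel_onTot ⟨k, y.1⟩ hk)

end PartialHom

/-- A morphism from `filtration N` is determined by its values in arities at most `N`. -/
theorem filtration_hom_ext {φ φ' : filtration N ⟶ C}
    (h : ∀ k ≤ N, ∀ y : Filtration N k, φ.toFun k y = φ'.toFun k y) : φ = φ' := by
  have key : ∀ x : (filtration N).Tot, Tot.map φ x = Tot.map φ' x := by
    rintro ⟨m, y⟩
    obtain ⟨n, hn, f, l, hl, hf, e⟩ := y.2
    let f' : Fin n → (filtration N).Tot := fun i =>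
      ⟨(f i).1, (⟨(f i).2, IsGenerated.of_le (hf i)⟩ : Filtration N (f i).1)⟩
    have hx : (⟨m, y⟩ : (filtration N).Tot) = Tot.act (Tot.prod hn f') l hl := by
      obtain rfl := congrArg Sigma.fst e
      refine congrArg (Sigma.mk _) (Subtype.ext ?_)
      exact eq_of_heq (Sigma.ext_iff.1 e).2
    rw [hx, Tot.map_act, Tot.map_act, Tot.map_prod, Tot.map_prod]
    have : ∀ i, Tot.map φ (f' i) = Tot.map φ' (f' i) :=
      fun i => congrArg (Sigma.mk _) (h _ (hf i) _)
    rw [funext this]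
  refine NSBimod.Hom.ext (funext fun m => funext fun y => ?_)
  have := key ⟨m, y⟩
  simpa [Tot.map] using this

end CubeSpace

/-! ### Cubes as cells -/

/-- The disc is homeomorphic to the cube, and the boundary sphere corresponds to the boundary. -/
theorem exists_discHomeo (d : ℕ) : ∃ φ : Disc d ≃ₜ (Fin d → unitInterval),
    ∀ z, z.1 ∈ Metric.sphere (0 : EuclideanSpace ℝ (Fin d)) 1 ↔ ∃ g, φ z g = 0 ∨ φ z g = 1 := by
  let e := EuclideanSpace.equiv (Fin d) ℝ
  let s : Set (EuclideanSpace ℝ (Fin d)) := e ⁻¹' Set.univ.pi fun _ => Set.Icc 0 1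
  have hmem : ∀ x, x ∈ s ↔ ∀ g, e x g ∈ Set.Icc (0 : ℝ) 1 := fun _ => Set.mem_univ_pi
  have hint : interior s = e ⁻¹' Set.univ.pi fun _ => Set.Ioo 0 1 := by
    have := e.toHomeomorph.preimage_interior (Set.univ.pi fun _ => Set.Icc 0 1)
    rw [interior_pi_set Set.finite_univ] at this
    simp only [interior_Icc] at this
    exact this.symm
  have hc : IsCompact s := e.toHomeomorph.isCompact_preimage.2
    (isCompact_univ_pi fun _ => isCompact_Icc)
  have hconv : Convex ℝ s := Convex.linear_preimage
    (convex_pi fun _ _ => convex_Icc (0 : ℝ) 1) e.toLinearEquiv.toLinearMap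
  have hne : (interior s).Nonempty := by
    refine ⟨e.symm fun _ => 1 / 2, ?_⟩
    rw [hint, Set.mem_preimage, e.apply_symm_apply]
    intro g _
    constructor <;> norm_num
  obtain ⟨h, -, hcl, hfr⟩ :=
    exists_homeomorph_image_interior_closure_frontier_eq_unitBall hconv hne hc.isBounded
  rw [hc.isClosed.closure_eq] at hcl
  rw [hc.isClosed.frontier_eq] at hfr
  have h1 : ∀ z : Disc d, h.symm z.1 ∈ s := by
    intro z
    obtain ⟨x, hx, hxz⟩ := hcl.ge z.2
    rw [← hxz, h.symm_apply_apply]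
    exact hx
  refine ⟨{
    toFun := fun z g => ⟨e (h.symm z.1) g, (hmem _).1 (h1 z) g⟩
    invFun := fun c => ⟨h (e.symm fun g => (c g : ℝ)), by
      rw [← hcl]
      refine Set.mem_image_of_mem _ ((hmem _).2 fun g => ?_)
      rw [e.apply_symm_apply]
      exact (c g).2⟩
    left_inv := fun z => ?_
    right_inv := fun c => ?_
    continuous_toFun := ?_
    continuous_invFun := ?_ }, fun z => ?_⟩
  · exact Subtype.ext ((congrArg h (e.symm_apply_apply (h.symm z.1))).trans (h.apply_symm_apply _))
  · funext g
    apply Subtype.ext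
    simp
  · exact continuous_pi fun g => Continuous.subtype_mk ((continuous_apply g).comp
      (e.continuous.comp (h.symm.continuous.comp continuous_subtype_val))) _
  · exact Continuous.subtype_mk (h.continuous.comp (e.symm.continuous.comp
      (continuous_pi fun g => continuous_subtype_val.comp (continuous_apply g)))) _
  · have h2 : z.1 ∈ Metric.sphere (0 : EuclideanSpace ℝ (Fin d)) 1 ↔
        h.symm z.1 ∉ interior s := by
      rw [← hfr]
      constructor
      · rintro ⟨x, hx, hxz⟩
        rw [← hxz, h.symm_apply_apply]
        exact hx.2
      · exact fun hz => ⟨h.symm z.1, ⟨h1 z, hz⟩, h.apply_symm_apply _⟩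
    rw [h2, hint]
    simp only [Set.mem_preimage, Set.mem_pi, Set.mem_univ, true_implies, not_forall]
    refine exists_congr fun g => ?_
    have := (hmem _).1 (h1 z) g
    change ¬ (0 < e (h.symm z.1) g ∧ e (h.symm z.1) g < 1) ↔ _
    rw [Subtype.ext_iff, Subtype.ext_iff]
    change _ ↔ e (h.symm z.1) g = 0 ∨ e (h.symm z.1) g = 1
    rw [not_and_or, not_lt, not_lt, this.1.ge_iff_eq', this.2.ge_iff_eq]

/-- A homeomorphism of the disc with the cube. -/
noncomputable def discHomeo (d : ℕ) : Disc d ≃ₜ (Fin d → unitInterval) :=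
  (exists_discHomeo d).choose

theorem mem_sphere_iff {d : ℕ} (z : Disc d) :
    z.1 ∈ Metric.sphere (0 : EuclideanSpace ℝ (Fin d)) 1 ↔
      ∃ g, discHomeo d z g = 0 ∨ discHomeo d z g = 1 := (exists_discHomeo d).choose_spec z

namespace CubeSpace

open NSBimod

theorem isInterior_iff (x : cube.Tot) :
    IsInterior x ↔ ¬ ∃ g, (x.2 : CubeSpace x.1).1 g = 0 ∨ (x.2 : CubeSpace x.1).1 g = 1 := by
  simp only [not_exists, not_or]
  constructor
  · intro h g
    have := h (g.val + 1) (by omega) (by omega)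
    rwa [cut_succ] at this
  · intro h a h0 ha
    have := h ⟨a - 1, by omega⟩
    rw [← cut_succ] at this
    simpa only [Nat.sub_add_cancel h0] using this

/-- A product of at least two factors has a coordinate `1`. -/
theorem IsInterior.lt_two {n : ℕ} {hn : 1 ≤ n} {f : Fin n → cube.Tot}
    (h : IsInterior (Tot.prod hn f)) : n < 2 := by
  by_contra hcon
  have h1 := blockStart_add_le_sum (fun i => (f i).1) rfl ⟨1, by omega⟩
  have h2 := pos (f ⟨1, by omega⟩)
  have h3 := blockStart_succ (fun i => (f i).1) ⟨0, by omega⟩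
  have h4 := pos (f ⟨0, by omega⟩)
  simp only [zero_add] at h1 h3
  exact (h _ (by omega) (by simp only [Tot.prod]; omega)).2
    (cut_prod_start hn f one_pos (by omega))

/-- A nontrivial right action produces a coordinate `0`. -/
theorem IsInterior.eq_one {x : cube.Tot} {l : ℕ → ℕ} {hl : ∀ a, 1 ≤ l a}
    (h : IsInterior (Tot.act x l hl)) {a : ℕ} (ha : a < x.1) : l a = 1 := by
  by_contra hcon
  have h0 := hl a
  have h1 := blockStart_add_le_sum (fun i : Fin x.1 => l i) rfl ⟨a, ha⟩
  simp only at h1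
  exact (h _ (by omega) (by simp only [Tot.act]; omega)).1
    (cut_act_in x hl ⟨a, ha⟩ (r := 1) one_pos (by simp only; omega))

theorem isGenerated_of_not_isInterior {N : ℕ} {x : cube.Tot} (hx : x.1 ≤ N + 1)
    (h : ¬ IsInterior x) : IsGenerated N x := by
  simp only [IsInterior, not_forall] at h
  obtain ⟨a, h0, ha, h⟩ := h
  rw [not_and_or, not_not, not_not] at h
  rcases h with h | h
  · obtain ⟨y, l, hl, rfl, hlt⟩ := exists_eq_act x h0 ha h
    exact (IsGenerated.of_le (by omega)).act hl
  · obtain ⟨f, rfl, hlt⟩ := exists_eq_prod x h0 ha h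
    exact IsGenerated.prod _ fun i => IsGenerated.of_le (by have := hlt i; omega)

section Cell

variable {N n : ℕ} (hn : n = N + 1)

include hn

/-- The characteristic map of the cell of arity `N + 1`. -/
noncomputable def charMap (z : Disc (n - 1)) : Filtration (N + 1) n :=
  ⟨⟨discHomeo (n - 1) z, by omega⟩, IsGenerated.of_le hn.le⟩

theorem continuous_charMap : Continuous (charMap hn) :=
  Continuous.subtype_mk (Continuous.subtype_mk (discHomeo (n - 1)).continuous _) _

/-- The attaching map of the cell of arity `N + 1`. -/
noncomputable def attachMap (z : DiscBoundary (n - 1)) : Filtration N n :=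
  ⟨⟨discHomeo (n - 1) z.incl, by omega⟩, isGenerated_of_not_isInterior hn.le (by
    rw [isInterior_iff, not_not]
    exact (mem_sphere_iff z.incl).1 z.2)⟩

theorem continuous_attachMap : Continuous (attachMap hn) :=
  Continuous.subtype_mk (Continuous.subtype_mk ((discHomeo (n - 1)).continuous.comp
    (continuous_subtype_val.subtype_mk _)) _) _

end Cell

section Glue

variable {N : ℕ} {C : NSBimod.{0} assocPos} (g : filtration N ⟶ C)
  (e : ∀ n, n = N + 1 → Disc (n - 1) → C.X n)

/-- The map that is given by `g` in arities at most `N` and by `e` on the cell. -/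
noncomputable def glue (k : ℕ) (hk : k ≤ N + 1) (y : CubeSpace k) : C.X k :=
  if h : k ≤ N then g.toFun k (⟨y, IsGenerated.of_le h⟩ : Filtration N k)
  else e k (by omega) ((discHomeo (k - 1)).symm y.1)

variable {e}

theorem continuous_glue (he : ∀ n hn, Continuous (e n hn)) (k : ℕ) (hk : k ≤ N + 1) :
    Continuous (glue g e k hk) := by
  by_cases h : k ≤ N
  · have : glue g e k hk = fun y => g.toFun k (⟨y, IsGenerated.of_le h⟩ : Filtration N k) :=
      funext fun y => dif_pos h
    rw [this]
    exact (g.cont k).comp (continuous_id.subtype_mk _)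
  · have : glue g e k hk = fun y => e k (by omega) ((discHomeo (k - 1)).symm y.1) :=
      funext fun y => dif_neg h
    rw [this]
    exact (he k _).comp ((discHomeo (k - 1)).symm.continuous.comp continuous_subtype_val)

variable (hge : ∀ n hn (z : DiscBoundary (n - 1)), e n hn z.incl = g.toFun n (attachMap hn z))

include hge

/-- On the elements of `filtration N`, including those on the boundary of the cell, the glued map
is `g`. -/
theorem onTot_glue (x : cube.Tot) (hx : x.1 ≤ N + 1) (hg : IsGenerated N x)
    (h : x.1 ≤ N ∨ ¬ IsInterior x) : onTot (glue g e) x hx =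
      Tot.map g ⟨x.1, (⟨x.2, hg⟩ : Filtration N x.1)⟩ := by
  refine congrArg (Sigma.mk x.1) ?_
  by_cases hN : x.1 ≤ N
  · exact dif_pos hN
  · have hi := h.resolve_left hN
    rw [isInterior_iff, not_not] at hi
    have hz : ((discHomeo (x.1 - 1)).symm (x.2 : CubeSpace x.1).1).1 ∈
        Metric.sphere (0 : EuclideanSpace ℝ (Fin (x.1 - 1))) 1 := by
      rw [mem_sphere_iff, Homeomorph.apply_symm_apply]
      exact hi
    refine (dif_neg hN).trans ((hge x.1 (by omega) ⟨_, hz⟩).trans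
      (congrArg (g.toFun x.1) (Subtype.ext (Subtype.ext ?_))))
    exact (discHomeo (x.1 - 1)).apply_symm_apply _

/-- The map `glue g e` as a morphism. -/
noncomputable def gluePartialHom (he : ∀ n hn, Continuous (e n hn)) : PartialHom (N + 1) C where
  toFun := glue g e
  cont := continuous_glue g he
  map_prod {n} hn f h := by
    by_cases hn2 : n < 2
    · obtain rfl : n = 1 := by omega
      have hf : f = fun _ => f 0 := funext fun i => congrArg f (Subsingleton.elim _ _)
      generalize f 0 = x at hf
      subst hf
      exact (onTot_congr _ (Tot.prod_one x) (hx' := (Tot.le_prod hn _ 0).trans h)).trans (Tot.prod_one _).symm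
    · have hf : ∀ i, (f i).1 ≤ N := by
        intro i
        obtain ⟨i', hi'⟩ : ∃ i', i' ≠ i := by
          have : Nontrivial (Fin n) := Fin.nontrivial_iff_two_le.2 (by omega)
          exact exists_ne i
        have h1 := Finset.add_le_sum (f := fun i => (f i).1) (s := Finset.univ)
          (fun _ _ => Nat.zero_le _) (Finset.mem_univ i) (Finset.mem_univ i') hi'.symm
        have h2 := pos (f i')
        simp only [Tot.prod] at h
        omega
      have hg := fun i => IsGenerated.of_le (hf i)
      rw [onTot_glue g hge _ h (IsGenerated.prod hn hg) (Or.inr fun hi => hn2 hi.lt_two)]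
      refine (Tot.map_prod g hn fun i => ⟨(f i).1, (⟨(f i).2, hg i⟩ : Filtration N _)⟩).trans ?_
      exact congrArg (Tot.prod hn) (funext fun i =>
        (onTot_glue g hge (f i) _ (hg i) (Or.inl (hf i))).symm)
  map_act x l hl h := by
    by_cases hl1 : ∀ a, a < x.1 → l a = 1
    · have e1 : Tot.act x l hl = x := (Tot.act_congr hl1).trans (Tot.act_one x)
      have e2 : ∀ c : C.Tot, c.1 = x.1 → Tot.act c l hl = c := fun c hc =>
        (Tot.act_congr (hc ▸ hl1)).trans (Tot.act_one c)
      exact (onTot_congr _ e1).trans (e2 _ rfl).symm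
    · have hx : x.1 ≤ N := by
        simp only [not_forall] at hl1
        obtain ⟨a, ha, hla⟩ := hl1
        have : ∑ _i : Fin x.1, 1 < ∑ i : Fin x.1, l i :=
          Finset.sum_lt_sum (fun i _ => hl i) ⟨⟨a, ha⟩, Finset.mem_univ _, by
            have := hl a
            simp only
            omega⟩
        rw [Finset.sum_const, Finset.card_univ, Fintype.card_fin, smul_eq_mul, mul_one] at this
        simp only [Tot.act] at h
        omega
      have hg := IsGenerated.of_le hx
      rw [onTot_glue g hge _ h (hg.act hl) (Or.inr fun hi => hl1 fun a ha => hi.eq_one ha),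
        onTot_glue g hge x _ hg (Or.inl hx)]
      exact Tot.map_act g ⟨x.1, (⟨x.2, hg⟩ : Filtration N _)⟩ hl

end Glue

/-- The sub-bimodule `filtration (N + 1)` is obtained from `filtration N` by the attachment of one
cell, the cube of arity `N + 1`. -/
theorem cellAttachment_filtration (N : ℕ) :
    CellAttachment assocPos (filtrationLe (Nat.le_add_right N 1)) := by
  refine ⟨fun n => PLift (n = N + 1), fun n _ => n - 1, fun n c => attachMap c.down,
    fun n c => charMap c.down, fun n c => continuous_attachMap c.down,
    fun n c => continuous_charMap c.down, fun n c z => rfl, fun C g e he hge => ?_⟩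
  let ψ := gluePartialHom g (e := fun n hn => e n ⟨hn⟩) (fun n hn z => hge n ⟨hn⟩ z)
    fun n hn => he n ⟨hn⟩
  refine ⟨ψ.extend, ⟨filtration_hom_ext fun k hk y => ?_, fun n c z => ?_⟩,
    fun ψ' h => filtration_hom_ext fun k hk y => ?_⟩
  · exact (ψ.extend_eq (by omega) _).trans (dif_pos hk)
  · obtain ⟨rfl⟩ := c
    refine (ψ.extend_eq (le_refl _) _).trans ((dif_neg (by omega)).trans ?_)
    exact congrArg _ ((discHomeo _).symm_apply_apply z)
  · rw [ψ.extend_eq hk]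
    by_cases hkN : k ≤ N
    · refine Eq.trans ?_ (dif_pos hkN).symm
      rw [← h.1]
      rfl
    · obtain rfl : k = N + 1 := by omega
      have hy : ψ.toFun (N + 1) hk y.1 = e (N + 1) ⟨rfl⟩ ((discHomeo N).symm y.1.1) := dif_neg hkN
      refine Eq.trans ?_ ((h.2 _ ⟨rfl⟩ ((discHomeo N).symm y.1.1)).trans hy.symm)
      refine congrArg _ (Subtype.ext (Subtype.ext ?_))
      exact ((discHomeo _).apply_symm_apply _).symm

/-! ### Cofibrancy -/

instance isEmpty_filtration_zero (m : ℕ) : IsEmpty ((filtration 0).X m) := by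
  refine ⟨fun y => ?_⟩
  obtain ⟨n, hn, f, l, hl, hf, -⟩ := Subtype.property (y : Filtration 0 m)
  have h1 := hf ⟨0, hn⟩
  have h2 := pos (f ⟨0, hn⟩)
  omega

/-- The bimodule `filtration 0` has no elements, so it is initial. -/
def isInitialFiltrationZero : Limits.IsInitial (filtration 0) :=
  Limits.IsInitial.ofUniqueHom
    (fun _ => {
      toFun := fun _ y => isEmptyElim y
      cont := fun _ => continuous_of_const fun y => isEmptyElim y
      map_left := fun _ _ _ y => isEmptyElim ((filtration 0).str.left _ _ _ y)
      map_right := fun _ _ x _ => isEmptyElim x })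
    fun _ _ => NSBimod.Hom.ext (funext fun _ => funext fun y => isEmptyElim y)

/-- The sub-bimodules as a sequence. -/
def filtrationFunctor : ℕ ⥤ NSBimod.{0} assocPos where
  obj := filtration
  map φ := filtrationLe (leOfHom φ)

/-- The inclusions into the cube as a cocone. -/
def filtrationInclTrans : filtrationFunctor ⟶ (Functor.const _).obj cube where
  app := filtrationIncl

section Colimit

variable (s : Limits.Cocone filtrationFunctor)

theorem cocone_eq {N N' m : ℕ} {y : CubeSpace m} (h : IsGenerated N (⟨m, y⟩ : cube.Tot))
    (h' : IsGenerated N' (⟨m, y⟩ : cube.Tot)) :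
    (s.ι.app N).toFun m (⟨y, h⟩ : Filtration N m) =
      (s.ι.app N').toFun m (⟨y, h'⟩ : Filtration N' m) := by
  have key : ∀ {N N' : ℕ} (hN : N ≤ N') (h : IsGenerated N (⟨m, y⟩ : cube.Tot)),
      (s.ι.app N').toFun m (⟨y, h.mono hN⟩ : Filtration N' m) =
        (s.ι.app N).toFun m (⟨y, h⟩ : Filtration N m) := by
    intro N N' hN h
    rw [← s.w (homOfLE hN)]
    rfl
  rw [← key (le_max_left N N') h, ← key (le_max_right N N') h']

/-- The morphism from the cube to a cocone. -/
def cubeDesc : cube ⟶ s.pt where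
  toFun m y := (s.ι.app m).toFun m (⟨y, IsGenerated.of_le (le_refl m)⟩ : Filtration m m)
  cont m := ((s.ι.app m).cont m).comp (continuous_id.subtype_mk _)
  map_left {n m} k h a y := by
    have hk : ∀ i, k i ≤ m := fun i => h ▸
      Finset.single_le_sum (fun _ _ => Nat.zero_le _) (Finset.mem_univ i)
    have := (s.ι.app m).map_left k h a fun i =>
      (⟨y i, IsGenerated.of_le (hk i)⟩ : Filtration m (k i))
    refine Eq.trans ?_ (this.trans ?_)
    · rfl
    · exact congrArg _ (funext fun i => cocone_eq s _ _)
  map_right {n m} k h x a := by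
    have := (s.ι.app (max n m)).map_right k h
      (⟨x, IsGenerated.of_le (le_max_left n m)⟩ : Filtration _ n) a
    refine Eq.trans (cocone_eq s _ _) (this.trans ?_)
    exact congrArg (fun z => s.pt.str.right k h z a) (cocone_eq s _ _)

end Colimit

/-- The cube is the colimit of the sub-bimodules. -/
def isColimitCube : Limits.IsColimit (Limits.Cocone.mk cube filtrationInclTrans) where
  desc s := cubeDesc s
  fac s N := NSBimod.Hom.ext (funext fun m => funext fun y => cocone_eq s _ _)
  uniq s φ h := NSBimod.Hom.ext (funext fun m => funext fun y => by
    have := congrArg (fun ψ : filtration m ⟶ s.pt =>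
      ψ.toFun m (⟨y, IsGenerated.of_le (le_refl m)⟩ : Filtration m m)) (h m)
    exact this)

theorem nonempty_transfiniteCompositionOfShape :
    Nonempty ((CellAttachment assocPos).TransfiniteCompositionOfShape ℕ
      (isInitialFiltrationZero.to cube)) :=
  ⟨{  F := filtrationFunctor
      isoBot := Iso.refl _
      incl := filtrationInclTrans
      isColimit := isColimitCube
      fac := isInitialFiltrationZero.hom_ext _ _
      map_mem := fun N _ => cellAttachment_filtration N }⟩

end CubeSpace

/-- The isomorphism given by a morphism of bimodules that consists of homeomorphisms. -/
def NSBimod.Hom.isoOfHomeomorph {P : NSOperad.{0}} {M N : NSBimod.{u} P} (φ : M ⟶ N)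
    (e : ∀ m, M.X m ≃ₜ N.X m) (h : ∀ m y, φ.toFun m y = e m y) : M ≅ N where
  hom := φ
  inv :=
    { toFun := fun m => (e m).symm
      cont := fun m => (e m).symm.continuous
      map_left := fun k hk x y => by
        rw [Homeomorph.symm_apply_eq, ← h, φ.map_left]
        simp only [h, Homeomorph.apply_symm_apply]
      map_right := fun k hk x y => by
        rw [Homeomorph.symm_apply_eq, ← h, φ.map_right]
        simp only [h, Homeomorph.apply_symm_apply] }
  hom_inv_id := NSBimod.Hom.ext (funext fun m => funext fun y =>
    (congrArg _ (h m y)).trans ((e m).symm_apply_apply y))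
  inv_hom_id := NSBimod.Hom.ext (funext fun m => funext fun y =>
    (h m _).trans ((e m).apply_symm_apply y))

/-- The bimodule `B K` is cofibrant, as it is isomorphic to the cube bimodule. -/
theorem BSpace.cofibrant : (NSBimod.mk (BSpace stasheff) bimodStr).Cofibrant := by
  obtain ⟨t⟩ := CubeSpace.nonempty_transfiniteCompositionOfShape
  refine ⟨_, CubeSpace.isInitialFiltrationZero, (MorphismProperty.transfiniteCompositions_iff _ _).2
    ⟨ℕ, inferInstance, inferInstance, inferInstance, inferInstance,
      ⟨t.ofArrowIso (Arrow.isoMk (Iso.refl _)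
        (NSBimod.Hom.isoOfHomeomorph cubeHom cubeHomeo fun _ _ => rfl).symm
        (CubeSpace.isInitialFiltrationZero.hom_ext _ _))⟩⟩⟩

theorem propositionp :
    ∃ S : BimodStr assocPos (BSpace stasheff), BSpace.IsGrafting S ∧
      (NSBimod.mk (BSpace stasheff) S).Cofibrant ∧
      (∀ (O : NSOperad.{u}) (η : assocPos.Hom O) (l : OperadLoop (stasheffProj.trans η)),
        ∃ ζ : (NSBimod.mk (BSpace stasheff) S).Hom (O.toBimod η),
          ∀ (m : ℕ) (p : BRaw stasheff m), ζ.toFun m (BSpace.mk p) = p.tree.eval l) ∧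
      IsEmpty (BSpace stasheff 0) ∧
      (∀ m : ℕ, 1 ≤ m → ContractibleSpace (BSpace stasheff m)) ∧
      (∃ φ : (NSBimod.mk (BSpace stasheff) S).Hom cube, ∀ m, IsHomeomorph (φ.toFun m)) :=
  ⟨BSpace.bimodStr, BSpace.isGrafting_bimodStr, BSpace.cofibrant,
    fun _ _ l => BSpace.exists_evalHom l BSpace.isGrafting_bimodStr, BSpace.isEmpty_zero,
    fun _ hm => BSpace.contractibleSpace hm, BSpace.cubeHom, BSpace.isHomeomorph_toCube⟩
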